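/- Let $R$ be a reduced irreducible (crystallographic) root system spanning a finite-dimensional $\mathbb{Q}$-vector space $E$ with a Weyl-group-invariant inner product $(\cdot,\cdot)$, with basis $\{\alpha_1,\dots,\alpha_r\}$, positive roots $R^+$, Weyl group $W$, root lattice $Q$, weight lattice $P$ and coweight lattice $P^\vee$. Roots of maximal length are called long and the others short (so all roots are long if $R$ is simply laced). Let $\theta$ be the long dominant root and, in the non-simply-laced case, $\theta_s$ the short dominant root. For $\beta=\sum_i k_i\alpha_i$ put $\mathrm{ht}_l\beta=\sum_{\alpha_i\text{ long}}k_i$ and $\mathrm{ht}_s\beta=\sum_{\alpha_i\text{ short}}k_i$, and let $L=\mathrm{ht}_l\theta$, $S=\mathrm{ht}_s\theta$. Let $R^+_s(\theta)$ be the set of positive short roots not orthogonal to $\theta$. Let $m\ge1$ be an integer with $mP\subset Q$, and let $\mathbb{Q}_{q,t}[P]$ be the group algebra of $P$ over $\mathbb{Q}_{q,t}=\mathbb{Q}(q^{1/m},t)$, with basis $e^\mu$, $\mu\in P$. The extended affine Weyl group $\widehat W=W\ltimes\tau(P^\vee)$ acts on $E\oplus\mathbb{Q}\delta$ by $w\tau(\lambda)(y+n\delta)=wy+(n-(\lambda,y))\delta$,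 and hence on $\mathbb{Q}_{q,t}[P]$ by $we^\mu=e^{w\mu}$, where $e^{y+n\delta}=q^{-n}e^y$. Let $\alpha_0=-\theta+\delta$, let $s_0,\dots,s_r$ be the reflections in $\alpha_0,\dots,\alpha_r$, and let $\ell(w)$ be the number of positive affine roots (the $\alpha+n\delta$ with $\alpha\in R$, $n\in\mathbb{Z}$, and either $n>0$, or $\alpha\in R^+$ and $n\ge0$) that $w$ makes negative. The affine Hecke algebra $\mathcal{H}_t$ is the $\mathbb{Q}(t)$-algebra generated by the braid group with generators $T(w)$, $w\in\widehat W$, and relations $T(v)T(w)=T(vw)$ whenever $\ell(v)+\ell(w)=\ell(vw)$, modulo $(T_i-t)(T_i+t^{-1})=0$ for $T_i=T(s_i)$, $0\le i\le r$. It acts on $\mathbb{Q}_{q,t}[P]$ by the Demazure--Lusztig operators $$T_i=ts_i+(t-t^{-1})\frac{1-s_i}{1-e^{\alpha_i}},\qquad i=0,\dots,r,$$ and by $T(\omega)e^\mu=e^{\omega\mu}$ for $\ell(\omega)=0$; thus $T(w)$ acts as $\omega T_{j_p}\cdots T_{j_1}$ for any reduced decomposition $w=\omega s_{j_p}\cdots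 s_{j_1}$ ($\ell(\omega)=0$, $p=\ell(w)$). For a dominant coweight $\lambda$ let $Y^\lambda=T(\tau(\lambda))$; in particular $Y^{\theta^\vee}=T(\tau(\theta^\vee))$. **Proposition.** A reduced decomposition of $\tau(\theta^\vee)$ exists, and the operator by which $Y^{\theta^\vee}$ acts on $\mathbb{Q}_{q,t}[P]$ (in the above representation; equivalently, the product $\omega T_{j_p}\cdots T_{j_1}$ for any reduced decomposition of $\tau(\theta^\vee)$) satisfies the following. (1) If $R$ is not of type $G_2$, then $$Y^{\theta^\vee}e^0=t^{2L+S}e^0,$$ $$Y^{\theta^\vee}e^\theta=q^2t^{-(2L+S)}e^\theta-(t-t^{-1})qt^{-(L+S)}\sum_{\alpha\in R^+_s(\theta)}e^\alpha-(t-t^{-1})t^{-S+1}(qt^{-2L}+1)e^0,$$ and, in the non-simply-laced case, $$Y^{\theta^\vee}e^{\theta_s}=qt^{-S}e^{\theta_s}-(t-t^{-1})t^{L-S+2}e^0.$$ (2) If $R$ is of type $G_2$, with short simple root $\alpha_1$ and long simple root $\alpha_2$, and $\beta=\alpha_1+\alpha_2$, then $$Y^{\theta^\vee}e^0=t^6e^0,$$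 $$Y^{\theta^\vee}e^\theta=q^2t^{-6}e^\theta-(t-t^{-1})qt^{-3}(e^{\theta_s}+e^\beta)-(t-t^{-1})t^{-1}(e^{\alpha_1}+e^{-\alpha_1})-(t-t^{-1})(qt^{-5}+t^{-1})e^0,$$ $$Y^{\theta^\vee}e^{\theta_s}=qt^{-4}e^{\theta_s}-(t-t^{-1})te^0.$$ -/

import Mathlib

noncomputable section

namespace AffineHecke

/-! ### The coefficient field -/

/-- The field `ℚ(t)`. -/
abbrev Qt : Type := RatFunc ℚ

/-- The field `ℚ_{q,t} = ℚ(q^{1/m}, t)`, realised as `ℚ(t)(q^{1/m})`: rational functions in two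
independent variables. -/
abbrev Qqt : Type := RatFunc (RatFunc ℚ)

/-- The variable `t`, as an element of `ℚ_{q,t}`. -/
def tt : Qqt := RatFunc.C (RatFunc.X : Qt)

/-- The variable `q^{1/m}`, as an element of `ℚ_{q,t}`. -/
def qroot : Qqt := RatFunc.X

/-- The element `q = (q^{1/m})^m`. -/
def qq (m : ℕ) : Qqt := qroot ^ m

/-- The power `q^x = (q^{1/m})^{m x}` for `x ∈ (1/m)ℤ`, so that `m * x` is an integer. -/
def qpow (m : ℕ) (x : ℚ) : Qqt := qroot ^ ⌊(m : ℚ) * x⌋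

theorem qroot_ne_zero : qroot ≠ 0 := RatFunc.X_ne_zero

theorem qpow_add_int (m : ℕ) (x : ℚ) (n : ℤ) :
    qpow m (x + n) = qpow m x * qpow m n := by
  have h1 : (m : ℚ) * (x + n) = (m : ℚ) * x + ((m * n : ℤ) : ℚ) := by push_cast; ring
  have h2 : (m : ℚ) * (n : ℚ) = ((m * n : ℤ) : ℚ) := by push_cast; ring
  unfold qpow
  rw [h1, h2, Int.floor_add_intCast, Int.floor_intCast, zpow_add₀ qroot_ne_zero]

variable {ι M N : Type*} [AddCommGroup M] [Module ℚ M] [AddCommGroup N] [Module ℚ N]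

/-! ### Lattices, long and short roots, heights -/

section Lattices

variable (P : RootPairing ι ℚ M N)

/-- The root lattice `Q`. -/
def rootLattice : AddSubgroup M := AddSubgroup.closure (Set.range P.root)

/-- The weight lattice `P`: the vectors on which every coroot is integral. -/
def weightLattice : AddSubgroup M where
  carrier := {x | ∀ i, ∃ k : ℤ, P.coroot' i x = k}
  zero_mem' := fun i => ⟨0, by simp⟩
  add_mem' := by
    intro x y hx hy i
    obtain ⟨k, hk⟩ := hx i
    obtain ⟨l, hl⟩ := hy i
    exact ⟨k + l, by rw [map_add, hk, hl, Int.cast_add]⟩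
  neg_mem' := by
    intro x hx i
    obtain ⟨k, hk⟩ := hx i
    exact ⟨-k, by rw [map_neg, hk, Int.cast_neg]⟩

/-- The coweight lattice `P^∨`: the covectors on which every root is integral. -/
def coweightLattice : AddSubgroup N := weightLattice P.flip

theorem root_mem_weightLattice [P.IsCrystallographic] (i : ι) : P.root i ∈ weightLattice P :=
  fun j => ⟨P.pairingIn ℤ i j, by
    have := P.algebraMap_pairingIn ℤ i j
    simpa using this.symm⟩

theorem coroot_mem_coweightLattice [P.IsCrystallographic] (i : ι) :
    P.coroot i ∈ coweightLattice P :=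
  root_mem_weightLattice P.flip i

/-- A root, as an element of the weight lattice. -/
def rootWt [P.IsCrystallographic] (i : ι) : weightLattice P :=
  ⟨P.root i, root_mem_weightLattice P i⟩

/-- A coroot, as an element of the coweight lattice. -/
def corootCowt [P.IsCrystallographic] (i : ι) : coweightLattice P :=
  ⟨P.coroot i, coroot_mem_coweightLattice P i⟩

end Lattices

section Lengths

variable {P : RootPairing ι ℚ M N}

/-- A root is long if it has maximal length with respect to the inner product `B`; in particular
all the roots are long if they all have the same length. The remaining roots are short. -/
def IsLong (B : P.RootPositiveForm ℚ) (i : ι) : Prop :=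
  ∀ j, B.form (P.root j) (P.root j) ≤ B.form (P.root i) (P.root i)

/-- The root with index `i` is a dominant weight. -/
def IsDominantRoot (b : P.Base) (i : ι) : Prop :=
  ∀ j ∈ b.support, 0 ≤ P.pairing i j

/-- The dominant coweights. -/
def IsDominantCoweight (b : P.Base) (lam : coweightLattice P) : Prop :=
  ∀ j ∈ b.support, 0 ≤ P.root' j (lam : N)

theorem coroot_dominant [P.IsCrystallographic] (b : P.Base) (B : P.RootPositiveForm ℚ) {i : ι}
    (hi : IsDominantRoot b i) : IsDominantCoweight b (corootCowt P i) := by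
  intro j hj
  have h := B.toInvariantForm.pairing_mul_eq_pairing_mul_swap i j
  have h1 : 0 < B.form (P.root i) (P.root i) := by
    obtain ⟨s, hs, hs'⟩ := B.exists_pos_eq i
    rw [← hs']; exact hs
  have h2 : 0 < B.form (P.root j) (P.root j) := by
    obtain ⟨s, hs, hs'⟩ := B.exists_pos_eq j
    rw [← hs']; exact hs
  have h3 := hi j hj
  have h4 : 0 ≤ P.pairing j i := by
    by_contra hneg
    push Not at hneg
    have h5 : P.pairing j i * B.form (P.root i) (P.root i) < 0 := mul_neg_of_neg_of_pos hneg h1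
    have h6 : 0 ≤ P.pairing i j * B.form (P.root j) (P.root j) := mul_nonneg h3 h2.le
    simp only [RootPairing.RootPositiveForm.toInvariantForm_form] at h
    linarith
  simpa [corootCowt] using h4

open Classical in
/-- `ht_l (∑ kᵢ αᵢ)`: the sum of the `kᵢ` over the long simple roots `αᵢ`. -/
def htLong [P.IsRootSystem] (b : P.Base) (B : P.RootPositiveForm ℚ) (x : M) : ℚ :=
  ∑ i : b.support, if IsLong B i then b.toWeightBasis.repr x i else 0

open Classical in
/-- `ht_s (∑ kᵢ αᵢ)`: the sum of the `kᵢ` over the short simple roots `αᵢ`. -/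
def htShort [P.IsRootSystem] (b : P.Base) (B : P.RootPositiveForm ℚ) (x : M) : ℚ :=
  ∑ i : b.support, if IsLong B i then 0 else b.toWeightBasis.repr x i

open Classical in
/-- The positive short roots not orthogonal to the root `θ`. -/
def posShortNonorth [Fintype ι] (b : P.Base) (B : P.RootPositiveForm ℚ) (θ : ι) : Finset ι :=
  {i | b.IsPos i ∧ ¬ IsLong B i ∧ B.form (P.root i) (P.root θ) ≠ 0}

end Lengths

/-! ### The affine root system and the extended affine Weyl group -/

section Affine

variable (P : RootPairing ι ℚ M N)

/-- The vector `α + n δ` attached to the affine root `(α, n)`. The space `M × ℚ` is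
`E ⊕ ℚ δ`, a pair `(y, n)` being `y + n δ`. -/
def affVec (a : ι × ℤ) : M × ℚ := (P.root a.1, (a.2 : ℚ))

/-- The reflection in the affine root `α + n δ`:
`y + k δ ↦ (y + k δ) - (y, α^∨) (α + n δ)`. -/
def affRefl (a : ι × ℤ) : (M × ℚ) ≃ₗ[ℚ] (M × ℚ) :=
  Module.reflection (x := affVec P a) (f := P.coroot' a.1 ∘ₗ LinearMap.fst ℚ M ℚ)
    (by simp [affVec])

theorem affRefl_apply (a : ι × ℤ) (v : M × ℚ) :
    affRefl P a v = v - P.coroot' a.1 v.1 • affVec P a := by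
  simp [affRefl, Module.reflection_apply]

/-- The translation `τ(λ)`, acting by `y + n δ ↦ y + (n - (λ, y)) δ`. -/
def trans (lam : N) : (M × ℚ) ≃ₗ[ℚ] (M × ℚ) where
  toFun v := (v.1, v.2 - P.toLinearMap v.1 lam)
  invFun v := (v.1, v.2 + P.toLinearMap v.1 lam)
  map_add' v w := by ext <;> simp; ring
  map_smul' c v := by ext <;> simp; ring
  left_inv v := by ext <;> simp
  right_inv v := by ext <;> simp

@[simp] theorem trans_apply (lam : N) (v : M × ℚ) :
    trans P lam v = (v.1, v.2 - P.toLinearMap v.1 lam) := rfl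

/-- The extended affine Weyl group `W ⋉ τ(P^∨)`, realised by its (faithful) action on `E ⊕ ℚ δ`:
it is generated by the reflections in the roots and the translations by coweights. -/
def extAffWeyl : Subgroup ((M × ℚ) ≃ₗ[ℚ] (M × ℚ)) :=
  Subgroup.closure
    (Set.range (fun i : ι => affRefl P (i, 0)) ∪
      Set.range (fun lam : coweightLattice P => trans P (lam : N)))

/-- The translation by a coweight, as an element of the extended affine Weyl group. -/
def tau (lam : coweightLattice P) : extAffWeyl P :=
  ⟨trans P (lam : N), Subgroup.subset_closure (Or.inr ⟨lam, rfl⟩)⟩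

theorem affRefl_eq (a : ι × ℤ) :
    affRefl P a = trans P (-(a.2 • P.coroot a.1)) * affRefl P (a.1, 0) := by
  ext v
  all_goals simp [affRefl_apply, affVec, LinearEquiv.mul_apply]
  all_goals ring

theorem affRefl_mem [P.IsCrystallographic] (a : ι × ℤ) : affRefl P a ∈ extAffWeyl P := by
  rw [affRefl_eq]
  refine mul_mem (Subgroup.subset_closure (Or.inr ⟨-(a.2 • corootCowt P a.1), ?_⟩))
    (Subgroup.subset_closure (Or.inl ⟨a.1, rfl⟩))
  simp [corootCowt]

theorem affRefl_fst_mem [P.IsCrystallographic] (a : ι × ℤ) {v : M × ℚ}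
    (hv : v.1 ∈ weightLattice P) : (affRefl P a v).1 ∈ weightLattice P := by
  rw [affRefl_apply]
  obtain ⟨k, hk⟩ := hv a.1
  have : (v - P.coroot' a.1 v.1 • affVec P a).1 = v.1 - k • P.root a.1 := by
    simp [hk, affVec, Int.cast_smul_eq_zsmul]
  rw [this]
  exact sub_mem hv (zsmul_mem (root_mem_weightLattice P a.1) k)

theorem extAffWeyl_fst_mem [P.IsCrystallographic] (w : extAffWeyl P) {v : M × ℚ}
    (hv : v.1 ∈ weightLattice P) :
    ((w : (M × ℚ) ≃ₗ[ℚ] (M × ℚ)) v).1 ∈ weightLattice P := by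
  let S : Subgroup ((M × ℚ) ≃ₗ[ℚ] (M × ℚ)) :=
    { carrier := {g | ∀ x : M × ℚ, (g x).1 ∈ weightLattice P ↔ x.1 ∈ weightLattice P}
      one_mem' := fun x => Iff.rfl
      mul_mem' := fun {g h} hg hh x => (hg (h x)).trans (hh x)
      inv_mem' := fun {g} hg x => by
        have := hg (g⁻¹ x)
        rw [← LinearEquiv.mul_apply, mul_inv_cancel] at this
        exact this.symm }
  have hS : extAffWeyl P ≤ S := by
    refine (Subgroup.closure_le S).2 ?_
    rintro g (⟨i, rfl⟩ | ⟨lam, rfl⟩) x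
    · refine ⟨fun h => ?_, affRefl_fst_mem P _⟩
      have := affRefl_fst_mem P (i, 0) h
      simpa [affRefl, Module.involutive_reflection _ x] using this
    · exact Iff.rfl
  exact (hS w.2 v).2 hv

variable {P} (b : P.Base)

/-- The positive affine roots: `α + n δ` with `n > 0`, or with `α` positive and `n ≥ 0`. -/
def AffPos (a : ι × ℤ) : Prop := 0 < a.2 ∨ (b.IsPos a.1 ∧ 0 ≤ a.2)

/-- The length of `w`: the number of positive affine roots made negative by `w`. -/
def len (w : extAffWeyl P) : ℕ :=
  Set.ncard {a : ι × ℤ | AffPos b a ∧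
    ∃ c, AffPos b c ∧ (w : (M × ℚ) ≃ₗ[ℚ] (M × ℚ)) (affVec P a) = -affVec P c}

/-- The simple affine roots `α₀ = -θ + δ` (index `none`; `reflectionPerm θ θ` is the index of the
root `-θ`) and `α₁, …, α_r` (indexed by the simple roots). -/
def simpleAff (θ : ι) : Option b.support → ι × ℤ
  | none => (P.reflectionPerm θ θ, 1)
  | some i => (i, 0)

/-- The simple reflections `s₀, s₁, …, s_r`. -/
def simpleRefl [P.IsCrystallographic] (θ : ι) (i : Option b.support) : extAffWeyl P :=
  ⟨affRefl P (simpleAff b θ i), affRefl_mem P _⟩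

end Affine

/-! ### The affine Hecke algebra -/

section Hecke

variable {P : RootPairing ι ℚ M N} (b : P.Base)

/-- The relations `T(v) T(w) = T(v w)`, whenever `ℓ(v) + ℓ(w) = ℓ(v w)`. -/
def braidRels : Set (FreeGroup (extAffWeyl P)) :=
  {r | ∃ v w : extAffWeyl P, len b v + len b w = len b (v * w) ∧
    r = FreeGroup.of v * FreeGroup.of w * (FreeGroup.of (v * w))⁻¹}

/-- The braid group of the extended affine Weyl group. -/
abbrev BraidGroup : Type _ := PresentedGroup (braidRels b)

/-- The image of the generator `T(w)` in the group algebra of the braid group. -/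
def braidT (w : extAffWeyl P) : MonoidAlgebra Qt (BraidGroup b) :=
  MonoidAlgebra.of Qt (BraidGroup b) (PresentedGroup.of w)

/-- The quadratic relations `(Tᵢ - t) (Tᵢ + t⁻¹) = 0`, `i = 0, …, r`. -/
inductive HeckeRel [P.IsCrystallographic] (θ : ι) :
    MonoidAlgebra Qt (BraidGroup b) → MonoidAlgebra Qt (BraidGroup b) → Prop
  | quad (i : Option b.support) : HeckeRel θ
      ((braidT b (simpleRefl b θ i) - algebraMap Qt _ RatFunc.X) *
        (braidT b (simpleRefl b θ i) + algebraMap Qt _ (RatFunc.X)⁻¹)) 0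

/-- The affine Hecke algebra `ℋ_t` of the extended affine Weyl group. -/
abbrev HeckeAlgebra [P.IsCrystallographic] (θ : ι) : Type _ := RingQuot (HeckeRel b θ)

/-- The element `T(w)` of the affine Hecke algebra. -/
def heckeT [P.IsCrystallographic] (θ : ι) (w : extAffWeyl P) : HeckeAlgebra b θ :=
  RingQuot.mkAlgHom Qt (HeckeRel b θ) (braidT b w)

/-- The element `Y^λ = T(τ(λ))` of the affine Hecke algebra, for a dominant coweight `λ`. -/
def heckeY [P.IsCrystallographic] (θ : ι) (lam : coweightLattice P)
    (_hlam : IsDominantCoweight b lam) : HeckeAlgebra b θ :=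
  heckeT b θ (tau P lam)

end Hecke

/-! ### Polynomials and Demazure-Lusztig operators -/

section Polynomials

variable (P : RootPairing ι ℚ M N)

/-- The group algebra `ℚ_{q,t}[P]` of the weight lattice. -/
abbrev Poly : Type _ := AddMonoidAlgebra Qqt (weightLattice P)

variable {P}

/-- The exponential `e^μ`. -/
def ex (μ : weightLattice P) : Poly P := AddMonoidAlgebra.single μ 1

/-- The exponential `e^{y + n δ} = q^{-n} e^y`. -/
def affEx (m : ℕ) (y : weightLattice P) (n : ℚ) : Poly P := qpow m (-n) • ex y

/-- The linear operator with prescribed values on the exponentials `e^μ`. -/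
def opOfExp (f : weightLattice P → Poly P) : Module.End Qqt (Poly P) :=
  (AddMonoidAlgebra.basis (weightLattice P) Qqt).constr Qqt f

theorem opOfExp_ex (f : weightLattice P → Poly P) (μ : weightLattice P) :
    opOfExp f (ex μ) = f μ := by
  have h : ex μ = AddMonoidAlgebra.basis (weightLattice P) Qqt μ := by simp [ex]
  rw [h, opOfExp, Module.Basis.constr_basis]

/-- The action of the extended affine Weyl group on polynomials, `w e^μ = e^{w μ}`. -/
def weylOp [P.IsCrystallographic] (m : ℕ) (w : extAffWeyl P) : Module.End Qqt (Poly P) :=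
  opOfExp fun μ => affEx m
    ⟨((w : (M × ℚ) ≃ₗ[ℚ] (M × ℚ)) ((μ : M), 0)).1, extAffWeyl_fst_mem P w μ.2⟩
    ((w : (M × ℚ) ≃ₗ[ℚ] (M × ℚ)) ((μ : M), 0)).2

/-- The operator `(1 - s_α) / (1 - e^α)` for the affine root `α`. If `k = (μ, α^∨)`, then the
quotient of `e^μ - e^{μ - k α}` by `1 - e^α` is `-∑_{j=1}^{k} e^{μ - j α}` for `k ≥ 0` and
`∑_{j=k+1}^{0} e^{μ - j α}` for `k ≤ 0`; see `one_sub_mul_divDiff`. -/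
def divDiff [P.IsCrystallographic] (m : ℕ) (a : ι × ℤ) : Module.End Qqt (Poly P) :=
  opOfExp fun μ =>
    ∑ j ∈ Finset.Ioc ⌊P.coroot' a.1 (μ : M)⌋ 0,
        affEx m (μ - j • rootWt P a.1) ((-(j * a.2) : ℤ) : ℚ) -
      ∑ j ∈ Finset.Ioc 0 ⌊P.coroot' a.1 (μ : M)⌋,
        affEx m (μ - j • rootWt P a.1) ((-(j * a.2) : ℤ) : ℚ)

theorem ex_mul (μ ν : weightLattice P) : ex μ * ex ν = ex (μ + ν) := by
  simp [ex, AddMonoidAlgebra.single_mul_single]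

theorem affEx_mul_int (m : ℕ) (y z : weightLattice P) (n k : ℤ) :
    affEx m y n * affEx m z k = affEx m (y + z) ((n + k : ℤ) : ℚ) := by
  have h : (-((n + k : ℤ) : ℚ)) = -(n : ℚ) + ((-k : ℤ) : ℚ) := by push_cast; ring
  unfold affEx
  rw [h, qpow_add_int, smul_mul_smul_comm, ex_mul]
  push_cast
  rfl

theorem sum_Ioc_telescope {A : Type*} [AddCommGroup A] (g : ℤ → A) {a c : ℤ} (h : a ≤ c) :
    ∑ j ∈ Finset.Ioc a c, (g j - g (j - 1)) = g c - g a := by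
  induction c, h using Int.leInduction with
  | base => simp
  | succ n hn ih =>
    have : Finset.Ioc a (n + 1) = insert (n + 1) (Finset.Ioc a n) := by
      ext x; simp only [Finset.mem_Ioc, Finset.mem_insert]; omega
    rw [this, Finset.sum_insert (by simp), ih]
    simp

/-- The defining property of the operator `(1 - s_α) / (1 - e^α)`. -/
theorem one_sub_mul_divDiff [P.IsCrystallographic] (m : ℕ) (a : ι × ℤ) (f : Poly P) :
    (1 - affEx m (rootWt P a.1) a.2) * divDiff m a f =
      f - weylOp m ⟨affRefl P a, affRefl_mem P a⟩ f := by
  suffices H : LinearMap.mulLeft Qqt (1 - affEx m (rootWt P a.1) a.2) ∘ₗ divDiff m a =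
      LinearMap.id - weylOp m ⟨affRefl P a, affRefl_mem P a⟩ from
    LinearMap.congr_fun H f
  refine (AddMonoidAlgebra.basis (weightLattice P) Qqt).ext fun μ => ?_
  have hb : AddMonoidAlgebra.basis (weightLattice P) Qqt μ = ex μ := by simp [ex]
  rw [hb]
  simp only [LinearMap.comp_apply, LinearMap.mulLeft_apply, LinearMap.sub_apply,
    LinearMap.id_apply]
  rw [divDiff, opOfExp_ex, weylOp, opOfExp_ex]
  obtain ⟨k, hk⟩ := μ.2 a.1
  set g : ℤ → Poly P := fun j => affEx m (μ - j • rootWt P a.1) ((-(j * a.2) : ℤ) : ℚ) with hg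
  have hstep : ∀ j, (1 - affEx m (rootWt P a.1) a.2) * g j = g j - g (j - 1) := by
    intro j
    rw [sub_mul, one_mul, hg]
    simp only
    rw [affEx_mul_int]
    congr 2
    · rw [sub_smul, one_smul]; abel
    · congr 1; ring
  have h0 : g 0 = ex μ := by simp [hg, affEx, qpow]
  have hfl : ⌊P.coroot' a.1 (μ : M)⌋ = k := by rw [hk, Int.floor_intCast]
  have hgk : affEx m
      ⟨(affRefl P a ((μ : M), 0)).1, extAffWeyl_fst_mem P ⟨affRefl P a, affRefl_mem P a⟩ μ.2⟩
      (affRefl P a ((μ : M), 0)).2 = g k := by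
    rw [hg]
    congr 1
    · ext
      simp only [affRefl_apply, hk]
      simp [affVec, rootWt, Int.cast_smul_eq_zsmul]
    · rw [affRefl_apply]
      simp only [hk]
      simp [affVec]
  rw [hfl, hgk, mul_sub, Finset.mul_sum, Finset.mul_sum]
  have hgj : ∀ j : ℤ, affEx m (μ - j • rootWt P a.1) ((-(j * a.2) : ℤ) : ℚ) = g j :=
    fun _ => rfl
  simp only [hgj, hstep]
  rcases le_total k 0 with h | h
  · rw [sum_Ioc_telescope g h, Finset.Ioc_eq_empty_of_le h, h0]; simp
  · rw [sum_Ioc_telescope g h, Finset.Ioc_eq_empty_of_le h, h0]; simp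

variable (b : P.Base)

/-- The Demazure-Lusztig operator `Tᵢ = t sᵢ + (t - t⁻¹) (1 - sᵢ) / (1 - e^{αᵢ})`, `i = 0, …, r`. -/
def demLus [P.IsCrystallographic] (θ : ι) (m : ℕ) (i : Option b.support) :
    Module.End Qqt (Poly P) :=
  tt • weylOp m (simpleRefl b θ i) + (tt - tt⁻¹) • divDiff m (simpleAff b θ i)

/-- An action `ρ` of the affine Hecke algebra on the space of polynomials is the polynomial
representation if `T₀, …, T_r` act by the Demazure-Lusztig operators and every element `ω` of
length zero acts by `ω e^μ = e^{ω μ}`. -/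
structure IsPolyRep [P.IsCrystallographic] (θ : ι) (m : ℕ)
    (ρ : HeckeAlgebra b θ →ₐ[Qt] Module.End Qqt (Poly P)) : Prop where
  simple : ∀ i, ρ (heckeT b θ (simpleRefl b θ i)) = demLus b θ m i
  omega : ∀ ω, len b ω = 0 → ρ (heckeT b θ ω) = weylOp m ω

/-- `F` is the operator by which `T(w)` acts on polynomials, computed from some reduced
decomposition of `w`: `w = ω s_{j_p} ⋯ s_{j_1}` with `ℓ(ω) = 0`, `ℓ(w) = p`, and
`F = ω T_{j_p} ⋯ T_{j_1}`. -/
def IsHeckeOp [P.IsCrystallographic] (θ : ι) (m : ℕ) (w : extAffWeyl P)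
    (F : Module.End Qqt (Poly P)) : Prop :=
  ∃ (ω : extAffWeyl P) (js : List (Option b.support)),
    len b ω = 0 ∧ w = ω * (js.map (simpleRefl b θ)).prod ∧ len b w = js.length ∧
      F = weylOp m ω * (js.map (demLus b θ m)).prod

end Polynomials

end AffineHecke

end

set_option linter.unusedSectionVars false

noncomputable section

namespace AffineHecke

variable {ι M N : Type*} [AddCommGroup M] [Module ℚ M] [AddCommGroup N] [Module ℚ N]
variable {P : RootPairing ι ℚ M N}

/-! ### Pairings, dominant roots and long roots of the finite root system -/

section FiniteRoots

/-! A reduced word of `τ(θ^∨)` makes `Y` a product of Demazure-Lusztig operators. Since `w T_β w⁻¹ =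
T_{wβ}`, all the reflections can be collected on the left: `Y` becomes `τ(θ^∨)` times a product of
operators `s_β T_β` (`intertwiner`), one for each inversion `β`, in the order of the word
(`exists_inversion_sequence`). Such a factor is almost diagonal. It multiplies `e^μ` by `t` or `t⁻¹`
if `⟨μ, β^∨⟩` is `0` or `1`; if this pairing is `2`, `3` or `-1`, one or two further exponentials of
the `β`-string split off.

The inversions are the roots `α` with `⟨α, θ^∨⟩ > 0`, together with `θ + δ`. Each initial segment of
the sequence is cut out by a linear form, so the order is convex: if a positive multiple of `γ` is
`a + c`, then `γ` lies between `a` and `c`. Hence `θ + δ` comes last (`exists_convexOrder`).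
Convexity (`IsConvexOrder`) is all that is kept of the reduced word, which is why every reduced word
gives the same formulas.

Outside `G₂`, exactly `2L - 2` long and `S` short roots pair to `1` with `θ^∨`; this follows by
pairing `θ^∨` with the sum of the positive roots of one length. Three kinds of terms arise: the
diagonal path of `e^θ`, with a factor `t⁻¹` at each step; a branch to `e^{θ-γ}` at each short `γ`,
and a branch to `e^0` at `θ`; a second branch from `e^α`, with `α = θ - γ`, to `e^0` at the factor
of `α`, present exactly when `α` comes after `θ - α`. The exponents of `t` count the roots
orthogonal to `α` among those before a given place. The involutions `γ ↦ θ - γ` and `γ ↦ ⟨γ, κ^∨⟩κ -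
γ` reverse the order around `θ` and `κ`, so these counts are halves of known numbers, up to the
number of short roots after `α`. Summed over `α`, the second branches form a telescoping geometric
series (`IsConvexOrder.sum_shortOne_geom`). For `e^{θ_s}` the only branch is at `θ_s`, which is the
last short root of the order.

In type `G₂` there is a single convex order, with five roots, and the product is computed directly.

Reduced words exist because an element of positive length makes some simple affine root negative
(`exists_simpleAff_mem_inversions`). -/

theorem isPos_neg_iff {b : P.Base} {i : ι} : b.IsPos (P.reflectionPerm i i) ↔ ¬ b.IsPos i :=
  RootPairing.Base.IsPos.neg_iff_not b i

/-- A positive root is a combination of simple roots with natural coefficients. -/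
theorem exists_root_eq_sum_nat {b : P.Base} {i : ι} (hi : b.IsPos i) :
    ∃ f : ι → ℕ, P.root i = ∑ j ∈ b.support, f j • P.root j := by
  obtain ⟨f, -, h | h⟩ := b.exists_root_eq_sum_nat_or_neg i
  · exact ⟨f, h⟩
  · exfalso
    have h' : P.root i = ∑ j ∈ b.support, (fun j => -(f j : ℤ)) j • P.root j := by
      rw [h, ← Finset.sum_neg_distrib]
      exact Finset.sum_congr rfl fun j _ => by simp
    have := RootPairing.Base.height_eq_sum h'
    rw [RootPairing.Base.isPos_iff, this, Finset.sum_neg_distrib] at hi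
    have h2 : (0 : ℤ) ≤ ∑ j ∈ b.support, (f j : ℤ) := Finset.sum_nonneg fun j _ => by positivity
    omega

variable [P.IsCrystallographic]

theorem cast_pairingIn (i j : ι) : ((P.pairingIn ℤ i j : ℤ) : ℚ) = P.pairing i j := by
  simpa using P.algebraMap_pairingIn ℤ i j

theorem isDominantRoot_iff {b : P.Base} {i : ι} :
    IsDominantRoot b i ↔ ∀ j ∈ b.support, 0 ≤ P.pairingIn ℤ i j := by
  simp only [IsDominantRoot, ← cast_pairingIn]
  exact_mod_cast Iff.rfl

theorem form_self_pos (B : P.RootPositiveForm ℚ) (i : ι) : 0 < B.form (P.root i) (P.root i) := by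
  obtain ⟨s, hs, hs'⟩ := B.exists_pos_eq i
  rw [← hs']; exact hs

theorem two_mul_form (B : P.RootPositiveForm ℚ) (i j : ι) :
    2 * B.form (P.root i) (P.root j) =
      P.pairingIn ℤ i j * B.form (P.root j) (P.root j) := by
  rw [B.two_mul_apply_root_root, cast_pairingIn]

theorem form_comm (B : P.RootPositiveForm ℚ) (x y : M) : B.form x y = B.form y x := by
  simpa using B.symm.eq x y

theorem pairingIn_mul_form_swap (B : P.RootPositiveForm ℚ) (i j : ι) :
    P.pairingIn ℤ i j * B.form (P.root j) (P.root j) =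
      P.pairingIn ℤ j i * B.form (P.root i) (P.root i) := by
  rw [← two_mul_form, ← two_mul_form, form_comm]

variable {b : P.Base}

theorem pairingIn_reflectionPerm_left (i j k : ι) :
    P.pairingIn ℤ (P.reflectionPerm i j) k =
      P.pairingIn ℤ j k - P.pairingIn ℤ j i * P.pairingIn ℤ i k := by
  have : (P.pairingIn ℤ (P.reflectionPerm i j) k : ℚ) =
      P.pairingIn ℤ j k - P.pairingIn ℤ j i * P.pairingIn ℤ i k := by
    rw [cast_pairingIn, cast_pairingIn, cast_pairingIn, cast_pairingIn,
      ← P.root_coroot'_eq_pairing, P.root_reflectionPerm, P.reflection_apply_root]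
    simp
  exact_mod_cast this

theorem pairingIn_eq_sum {i : ι} {f : ι → ℕ} (h : P.root i = ∑ j ∈ b.support, f j • P.root j)
    (k : ι) : P.pairingIn ℤ i k = ∑ j ∈ b.support, f j * P.pairingIn ℤ j k := by
  have h1 : P.coroot' k (P.root i) = ∑ j ∈ b.support, (f j : ℚ) * P.coroot' k (P.root j) := by
    rw [h, map_sum]
    exact Finset.sum_congr rfl fun j _ => by rw [map_nsmul, nsmul_eq_mul]
  simp only [P.root_coroot'_eq_pairing, ← cast_pairingIn] at h1
  exact_mod_cast h1

variable [Fintype ι]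

theorem pairingIn_nonneg_swap {i j : ι} : 0 ≤ P.pairingIn ℤ i j ↔ 0 ≤ P.pairingIn ℤ j i := by
  have h := P.pairingIn_pairingIn_mem_set_of_isCrystallographic i j
  simp only [Set.mem_insert_iff, Set.mem_singleton_iff, Prod.mk.injEq] at h
  omega

/-- The two pairings of a pair of roots have the same sign, so dominance settles the simple roots;
the other positive roots are reached by adding simple roots one at a time. -/
theorem IsDominantRoot.pairingIn_nonneg {x : ι} (hx : IsDominantRoot b x) {i : ι}
    (hi : b.IsPos i) : 0 ≤ P.pairingIn ℤ i x := by
  rw [isDominantRoot_iff] at hx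
  refine hi.induction_on_add (fun j hj => pairingIn_nonneg_swap.1 (hx j hj)) ?_
  intro j k l h hj hk
  rw [P.pairingIn_eq_add_of_root_eq_add h]
  exact add_nonneg hj (pairingIn_nonneg_swap.1 (hx k hk))

theorem IsDominantRoot.isPos_of_pairingIn_pos {x : ι} (hx : IsDominantRoot b x) {i : ι}
    (hi : 0 < P.pairingIn ℤ i x) : b.IsPos i := by
  by_contra h
  have := hx.pairingIn_nonneg (isPos_neg_iff.2 h)
  rw [P.pairingIn_reflectionPerm_self_left] at this
  omega

theorem IsDominantRoot.isPos {x : ι} (hx : IsDominantRoot b x) : b.IsPos x :=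
  hx.isPos_of_pairingIn_pos (by simp)

/-- Two dominant roots of an irreducible root system are not orthogonal. -/
theorem IsDominantRoot.pairingIn_pos [P.IsReduced] [P.IsIrreducible] {x y : ι}
    (hx : IsDominantRoot b x) (hy : IsDominantRoot b y) : 0 < P.pairingIn ℤ y x := by
  refine lt_of_le_of_ne (hx.pairingIn_nonneg hy.isPos) fun h0 => ?_
  obtain ⟨f, hf⟩ := exists_root_eq_sum_nat hy.isPos
  -- `I` is the set of simple roots occurring in `y`. All of them are orthogonal to `x`, since `⟨y,
  -- x^∨⟩ = 0` is a sum of nonnegative terms.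
  set I : Set ι := {j | j ∈ b.support ∧ f j ≠ 0} with hI
  have hterm : ∀ j ∈ I, P.pairingIn ℤ j x = 0 := by
    have h1 := pairingIn_eq_sum hf x
    rw [← h0] at h1
    rw [eq_comm, Finset.sum_eq_zero_iff_of_nonneg fun j hj => mul_nonneg (by positivity)
      (hx.pairingIn_nonneg (RootPairing.Base.isPos_of_mem_support hj))] at h1
    rintro j ⟨hj, hj'⟩
    have := h1 j hj
    simpa [hj'] using this
  have hne : Submodule.span ℚ (P.root '' I) ≠ ⊥ := by
    intro hbot
    apply P.ne_zero y
    rw [hf]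
    refine Finset.sum_eq_zero fun j hj => ?_
    by_cases hj' : f j = 0
    · simp [hj']
    · have : P.root j ∈ Submodule.span ℚ (P.root '' I) :=
        Submodule.subset_span ⟨j, ⟨hj, hj'⟩, rfl⟩
      rw [hbot, Submodule.mem_bot] at this
      exact absurd this (P.ne_zero j)
  -- The span of `I` is stable under the simple reflections: a simple root outside `I` pairs
  -- nonpositively with each element of `I`, and dominance of `y` makes the weighted sum
  -- nonnegative, so all these pairings vanish. Irreducibility then leaves no room for a vector not
  -- orthogonal to `x`.
  have htop : Submodule.span ℚ (P.root '' I) = ⊤ := by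
    refine RootPairing.IsIrreducible.eq_top_of_invtSubmodule_reflection (P := P) _
      ((b.forall_mem_support_invtSubmodule_iff _).1 fun j hj => ?_) hne
    by_cases hjI : j ∈ I
    · exact Submodule.mem_invtSubmodule_reflection_of_mem _ _
        (Submodule.subset_span ⟨j, hjI, rfl⟩)
    · have hfj : f j = 0 := by
        by_contra h; exact hjI ⟨hj, h⟩
      have h1 := pairingIn_eq_sum hf j
      have hle : ∀ k ∈ b.support, (f k : ℤ) * P.pairingIn ℤ k j ≤ 0 := by
        intro k hk
        rcases eq_or_ne k j with rfl | hkj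
        · simp [hfj]
        · exact mul_nonpos_of_nonneg_of_nonpos (by positivity)
            (b.pairingIn_le_zero_of_ne hkj hk hj)
      have hsum : ∑ k ∈ b.support, (f k : ℤ) * P.pairingIn ℤ k j = 0 :=
        le_antisymm (Finset.sum_nonpos hle) (h1 ▸ isDominantRoot_iff.1 hy j hj)
      rw [Finset.sum_eq_zero_iff_of_nonpos hle] at hsum
      have horth : ∀ k ∈ I, P.IsOrthogonal j k := by
        rintro k ⟨hk, hk'⟩
        have h2 : P.pairingIn ℤ k j = 0 := by simpa [hk'] using hsum k hk
        have h3 : P.pairingIn ℤ j k = 0 := P.pairingIn_eq_zero_iff.1 h2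
        constructor <;> rw [← cast_pairingIn]
        · rw [h3]; simp
        · rw [h2]; simp
      refine (Module.End.mem_invtSubmodule _).mpr fun z hz => ?_
      rwa [Submodule.mem_comap, LinearEquiv.coe_coe,
        (P.isFixedPt_reflection_of_isOrthogonal horth hz).eq]
  have hker : Submodule.span ℚ (P.root '' I) ≤ LinearMap.ker (P.coroot' x) := by
    rw [Submodule.span_le]
    rintro - ⟨j, hj, rfl⟩
    rw [SetLike.mem_coe, LinearMap.mem_ker, P.root_coroot'_eq_pairing, ← cast_pairingIn,
      hterm j hj]
    simp
  have hmem : P.root x ∈ LinearMap.ker (P.coroot' x) := hker (htop ▸ Submodule.mem_top)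
  rw [LinearMap.mem_ker, P.root_coroot'_eq_pairing, P.pairing_same] at hmem
  norm_num at hmem

section Reduced

variable [P.IsReduced] {B : P.RootPositiveForm ℚ} {θ : ι}

/-- A long root pairs to `-1`, `0` or `1` with all the roots but itself and its negative. -/
theorem IsLong.pairingIn_cases (hθ : IsLong B θ) (i : ι) :
    i = θ ∨ i = P.reflectionPerm θ θ ∨ P.pairingIn ℤ i θ = 0 ∧ P.pairingIn ℤ θ i = 0 ∨
      P.pairingIn ℤ i θ = 1 ∧ 0 < P.pairingIn ℤ θ i ∨
      P.pairingIn ℤ i θ = -1 ∧ P.pairingIn ℤ θ i < 0 := by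
  by_cases h1 : i = θ
  · exact Or.inl h1
  by_cases h2 : i = P.reflectionPerm θ θ
  · exact Or.inr (Or.inl h2)
  have h := P.pairingIn_pairingIn_mem_set_of_isCrystal_of_isRed' i θ
    (fun h => h1 (P.root.injective h)) (fun h => h2 (P.root_eq_neg_iff.1 h))
  have hs := pairingIn_mul_form_swap B i θ
  have hle := hθ i
  have hp := form_self_pos B i
  have hp' := form_self_pos B θ
  simp only [Set.mem_insert_iff, Set.mem_singleton_iff, Prod.mk.injEq] at h
  -- In every entry of the table with `|⟨i, θ^∨⟩| > 1` the root `i` is strictly longer than `θ`.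
  rcases h with h | h | h | h | h | h | h | h | h | h | h <;> rw [h.1, h.2] at hs <;>
    simp only [h.1, h.2] <;> norm_num at hs ⊢ <;> linarith

end Reduced

end FiniteRoots

/-! ### Numbers of long and short roots pairing to one with the highest coroot -/

section Heights

variable [Fintype ι] [P.IsCrystallographic] [P.IsReduced] {b : P.Base}
  {B : P.RootPositiveForm ℚ} {θ : ι}

open Classical in
/-- For a class of roots stable under reflections, the sum of the positive roots of the class pairs
to `2` with the simple coroots of the class and to `0` with the other ones. -/
theorem sum_pos_pairingIn_simple (C : ι → Prop) (hC : ∀ i j, C i → C (P.reflectionPerm j i))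
    {i : ι} (hi : i ∈ b.support) :
    ∑ α with b.IsPos α ∧ C α, P.pairingIn ℤ α i = if C i then 2 else 0 := by
  -- The simple reflection permutes the other positive roots of the class and changes the sign of
  -- their pairing with its coroot, so the terms cancel in pairs.
  have key : ∑ α with (b.IsPos α ∧ C α) ∧ α ≠ i, P.pairingIn ℤ α i = 0 := by
    refine Finset.sum_involution (fun α _ => P.reflectionPerm i α) ?_ ?_ ?_ ?_
    · intro α _
      rw [pairingIn_reflectionPerm_left, P.pairingIn_same]
      ring
    · intro α hα h0 heq
      have := pairingIn_reflectionPerm_left (P := P) i α i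
      rw [heq, P.pairingIn_same] at this
      omega
    · intro α hα
      simp only [Finset.mem_filter, Finset.mem_univ, true_and] at hα ⊢
      refine ⟨⟨hα.1.1.reflectionPerm hi hα.2, hC _ _ hα.1.2⟩, fun h => ?_⟩
      have h1 : α = P.reflectionPerm i i := by rw [← P.reflectionPerm_self i α, h]
      have h2 := isPos_neg_iff.1 (h1 ▸ hα.1.1)
      exact h2 (RootPairing.Base.isPos_of_mem_support hi)
    · intro α _
      exact P.reflectionPerm_self i α
  rw [← Finset.sum_filter_add_sum_filter_not _ (· ≠ i), Finset.filter_filter, key,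
    Finset.filter_filter, zero_add]
  split_ifs with h
  · rw [Finset.sum_eq_single_of_mem i]
    · simp
    · simp [h, RootPairing.Base.isPos_of_mem_support hi]
    · intro α hα hne
      simp [hne] at hα
  · refine Finset.sum_eq_zero fun α hα => ?_
    simp only [ne_eq, not_not, Finset.mem_filter, Finset.mem_univ, true_and] at hα
    exact absurd (hα.2 ▸ hα.1.2) h

open Classical in
-- Expanding `θ` in `2(α, θ)` writes `|θ|² θ^∨` as the combination of the simple coroots with
-- coefficients `f j |α_j|²`, and each simple coroot pairs to `2` or `0` with the sum of the class.
theorem form_mul_sum_pos_pairingIn (C : ι → Prop) (hC : ∀ i j, C i → C (P.reflectionPerm j i))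
    {f : ι → ℕ} (hf : P.root θ = ∑ j ∈ b.support, f j • P.root j) :
    B.form (P.root θ) (P.root θ) * ((∑ α with b.IsPos α ∧ C α, P.pairingIn ℤ α θ : ℤ) : ℚ) =
      ∑ j ∈ b.support, f j * B.form (P.root j) (P.root j) * if C j then 2 else 0 := by
  have h1 : ∀ α, B.form (P.root θ) (P.root θ) * (P.pairingIn ℤ α θ : ℚ) =
      ∑ j ∈ b.support, f j * B.form (P.root j) (P.root j) * P.pairingIn ℤ α j := by
    intro α
    rw [mul_comm, ← two_mul_form]
    conv_lhs => rw [hf]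
    rw [map_sum, Finset.mul_sum]
    refine Finset.sum_congr rfl fun j _ => ?_
    rw [map_nsmul, nsmul_eq_mul, mul_left_comm, two_mul_form]
    ring
  rw [Int.cast_sum, Finset.mul_sum, Finset.sum_congr rfl fun α _ => h1 α, Finset.sum_comm]
  refine Finset.sum_congr rfl fun j hj => ?_
  rw [← Finset.mul_sum, ← Int.cast_sum, sum_pos_pairingIn_simple C hC hj]
  split_ifs <;> simp

theorem IsLong.reflectionPerm {i : ι} (hi : IsLong B i) (j : ι) :
    IsLong B (P.reflectionPerm j i) := by
  intro k
  have : B.form (P.root (P.reflectionPerm j i)) (P.root (P.reflectionPerm j i)) =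
      B.form (P.root i) (P.root i) := by
    rw [P.root_reflectionPerm]
    exact B.toInvariantForm.apply_reflection_reflection j _ _
  rw [this]
  exact hi k

theorem isLong_reflectionPerm_iff {i j : ι} : IsLong B (P.reflectionPerm j i) ↔ IsLong B i :=
  ⟨fun h => by simpa using h.reflectionPerm j, fun h => h.reflectionPerm j⟩

theorem IsLong.form_eq {i j : ι} (hi : IsLong B i) (hj : IsLong B j) :
    B.form (P.root i) (P.root i) = B.form (P.root j) (P.root j) :=
  le_antisymm (hj i) (hi j)

theorem IsLong.of_form_eq {i j : ι} (hi : IsLong B i)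
    (h : B.form (P.root i) (P.root i) = B.form (P.root j) (P.root j)) : IsLong B j :=
  fun k => h ▸ hi k

/-- Outside of type `G₂`, the squared length of a long root is twice that of a short root. -/
theorem IsLong.form_eq_two_mul [P.IsIrreducible] (hG : ¬ P.IsG2) {i j : ι} (hi : IsLong B i)
    (hj : ¬ IsLong B j) :
    B.form (P.root i) (P.root i) = 2 * B.form (P.root j) (P.root j) := by
  -- By irreducibility some root `k` of the same length as `i` is not orthogonal to `j`, so the
  -- ratio of lengths is a ratio of two nonzero pairings.
  obtain ⟨k, hk, hk'⟩ := P.exists_form_eq_form_and_form_ne_zero B.toInvariantForm j i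
  rw [B.toInvariantForm_form] at hk hk'
  have hnot := P.not_isG2_iff_isNotG2.1 hG
  have h2 := RootPairing.IsNotG2.pairingIn_mem_zero_one_two (P := P) k j
  have h := P.pairingIn_pairingIn_mem_set_of_isCrystallographic k j
  have hs := pairingIn_mul_form_swap B k j
  have hp := form_self_pos B j
  have hlt : B.form (P.root j) (P.root j) < B.form (P.root k) (P.root k) :=
    lt_of_le_of_ne (hk ▸ hi j) fun he => hj (hi.of_form_eq (by rw [← hk, he]))
  have h0 : P.pairingIn ℤ j k ≠ 0 := by
    intro h0
    have := two_mul_form B j k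
    rw [h0] at this
    simp [hk'] at this
  rw [← hk]
  simp only [Set.mem_insert_iff, Set.mem_singleton_iff, Prod.mk.injEq] at h h2
  rcases h with h | h | h | h | h | h | h | h | h | h | h | h | h | h | h | h | h <;>
    first
    | exact absurd h.2 h0
    | (exfalso; rw [h.1] at h2; omega)
    | (rw [h.1, h.2] at hs; push_cast at hs; linarith)

/-- The set of roots whose pairing with the coroot of `θ` is `1`. -/
def pairingOne (P : RootPairing ι ℚ M N) [P.IsCrystallographic] (θ : ι) : Finset ι :=
  {α | P.pairingIn ℤ α θ = 1}

@[simp] theorem mem_pairingOne {α : ι} : α ∈ pairingOne P θ ↔ P.pairingIn ℤ α θ = 1 := by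
  simp [pairingOne]

open Classical in
-- A positive root pairs to `0` or `1` with the coroot of `θ`, except `θ` itself, which contributes
-- `2`.
theorem sum_pos_pairingIn_eq_card (hθ : IsLong B θ) (hdom : IsDominantRoot b θ) (C : ι → Prop) :
    ∑ α with b.IsPos α ∧ C α, P.pairingIn ℤ α θ =
      ((pairingOne P θ).filter C).card + if C θ then 2 else 0 := by
  have h1 : ∀ α ∈ Finset.univ.filter (fun α => b.IsPos α ∧ C α), P.pairingIn ℤ α θ =
      (if P.pairingIn ℤ α θ = 1 then 1 else 0) + if α = θ then 2 else 0 := by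
    intro α hα
    simp only [Finset.mem_filter, Finset.mem_univ, true_and] at hα
    have hnn := hdom.pairingIn_nonneg hα.1
    rcases hθ.pairingIn_cases α with rfl | rfl | h | h | h
    · simp
    · rw [P.pairingIn_reflectionPerm_self_left, P.pairingIn_same] at hnn
      omega
    · have : α ≠ θ := by rintro rfl; simp at h
      simp [h.1, this]
    · have : α ≠ θ := by rintro rfl; simp at h
      simp [h.1, this]
    · omega
  rw [Finset.sum_congr rfl h1, Finset.sum_add_distrib]
  congr 1
  · rw [← Finset.sum_filter, Finset.sum_const, nsmul_one]
    congr 2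
    ext α
    simp only [Finset.mem_filter, Finset.mem_univ, true_and, mem_pairingOne]
    refine ⟨fun h => ⟨h.2, h.1.2⟩, fun h => ⟨⟨hdom.isPos_of_pairingIn_pos (by omega), h.2⟩, h.1⟩⟩
  · rw [Finset.sum_ite_eq']
    simp [hdom.isPos]

open Classical in
theorem htLong_eq [P.IsRootSystem] {f : ι → ℕ}
    (hf : P.root θ = ∑ j ∈ b.support, f j • P.root j) :
    htLong b B (P.root θ) = ∑ j ∈ b.support, (if IsLong B j then (f j : ℚ) else 0)
    ∧ htShort b B (P.root θ) =
      ∑ j ∈ b.support, (if IsLong B j then 0 else (f j : ℚ)) := by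
  have hr : b.toWeightBasis.repr (P.root θ) =
      ∑ j : b.support, (f j : ℚ) • Finsupp.single j (1 : ℚ) := by
    rw [hf, ← Finset.sum_coe_sort, map_sum]
    refine Finset.sum_congr rfl fun j _ => ?_
    rw [map_nsmul, b.toWeightBasis_repr_root, Nat.cast_smul_eq_nsmul]
  have hr' : ∀ j : b.support, b.toWeightBasis.repr (P.root θ) j = f j := by
    intro j
    rw [hr, Finsupp.finsetSum_apply, Finset.sum_eq_single j]
    · simp
    · intro i _ hij
      simp [hij]
    · simp
  simp only [htLong, htShort, hr']
  exact ⟨Finset.sum_coe_sort b.support fun j => if IsLong B j then (f j : ℚ) else 0,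
    Finset.sum_coe_sort b.support fun j => if IsLong B j then 0 else (f j : ℚ)⟩

open Classical in
-- Long simple roots are as long as `θ`, so the sum of the long positive roots pairs to `2L` with
-- `θ^∨`; the subtracted `2` is the share of `θ`.
theorem card_long_pairingOne [P.IsRootSystem] (hθ : IsLong B θ) (hdom : IsDominantRoot b θ)
    {L : ℤ} (hL : (L : ℚ) = htLong b B (P.root θ)) :
    (((pairingOne P θ).filter (IsLong B)).card : ℤ) = 2 * L - 2 := by
  obtain ⟨f, hf⟩ := exists_root_eq_sum_nat hdom.isPos
  have h := form_mul_sum_pos_pairingIn (B := B) (IsLong B) (fun i j h => h.reflectionPerm j) hf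
  rw [sum_pos_pairingIn_eq_card hθ hdom, if_pos hθ] at h
  have h2 : ∑ j ∈ b.support, (f j : ℚ) * B.form (P.root j) (P.root j) *
      (if IsLong B j then 2 else 0) = B.form (P.root θ) (P.root θ) * (2 * L) := by
    rw [hL, (htLong_eq hf).1, Finset.mul_sum, Finset.mul_sum]
    refine Finset.sum_congr rfl fun j _ => ?_
    split_ifs with hj
    · rw [hj.form_eq hθ]; ring
    · simp
  rw [h2] at h
  have := mul_left_cancel₀ (form_self_pos B θ).ne' h
  have h3 : (((pairingOne P θ).filter (IsLong B)).card : ℤ) + 2 = 2 * L := by exact_mod_cast this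
  omega

open Classical in
-- Here the factor `2` of the pairing with a short simple coroot cancels against the ratio `2` of
-- squared lengths, leaving `S`.
theorem card_short_pairingOne [P.IsRootSystem] [P.IsIrreducible] (hG : ¬ P.IsG2)
    (hθ : IsLong B θ) (hdom : IsDominantRoot b θ)
    {S : ℤ} (hS : (S : ℚ) = htShort b B (P.root θ)) :
    (((pairingOne P θ).filter (fun α => ¬ IsLong B α)).card : ℤ) = S := by
  obtain ⟨f, hf⟩ := exists_root_eq_sum_nat hdom.isPos
  have h := form_mul_sum_pos_pairingIn (B := B) (fun i => ¬ IsLong B i)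
    (fun i j h => by rwa [isLong_reflectionPerm_iff]) hf
  rw [sum_pos_pairingIn_eq_card hθ hdom, if_neg (not_not.2 hθ), add_zero] at h
  have h2 : ∑ j ∈ b.support, (f j : ℚ) * B.form (P.root j) (P.root j) *
      (if ¬ IsLong B j then 2 else 0) = B.form (P.root θ) (P.root θ) * S := by
    rw [hS, (htLong_eq hf).2, Finset.mul_sum]
    refine Finset.sum_congr rfl fun j _ => ?_
    by_cases hj : IsLong B j
    · simp [hj]
    · rw [if_pos hj, if_neg hj, hθ.form_eq_two_mul hG hj]; ring
  have h3 := mul_left_cancel₀ (form_self_pos B θ).ne' (h.trans (by convert h2))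
  have h4 := (Int.cast_injective (α := ℚ)) h3
  convert h4

end Heights

/-! ### Action of the extended affine Weyl group on affine roots -/

section AffineAction

theorem affVec_injective : Function.Injective (affVec P) := by
  rintro ⟨i, n⟩ ⟨j, k⟩ h
  simp only [affVec, Prod.mk.injEq, EmbeddingLike.apply_eq_iff_eq, Int.cast_inj] at h
  exact Prod.ext h.1 h.2

/-- The affine root opposite to a given one. -/
def affNeg (a : ι × ℤ) : ι × ℤ := (P.reflectionPerm a.1 a.1, -a.2)

@[simp] theorem affVec_affNeg (a : ι × ℤ) : affVec P (affNeg (P := P) a) = -affVec P a := by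
  simp [affVec, affNeg]

theorem affNeg_affNeg (a : ι × ℤ) : affNeg (P := P) (affNeg (P := P) a) = a :=
  affVec_injective (P := P) (by simp)

theorem affRefl_fst (a : ι × ℤ) (v : M × ℚ) : (affRefl P a v).1 = P.reflection a.1 v.1 := by
  rw [affRefl_apply, P.reflection_apply]
  simp [affVec]

variable [P.IsCrystallographic]

theorem affRefl_affVec (a c : ι × ℤ) :
    affRefl P a (affVec P c) =
      affVec P (P.reflectionPerm a.1 c.1, c.2 - P.pairingIn ℤ c.1 a.1 * a.2) := by
  rw [affRefl_apply]
  refine Prod.ext ?_ ?_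
  · simp [affVec, P.reflection_apply_root]
  · simp [affVec, cast_pairingIn]

/-- The extended affine Weyl group permutes the affine roots, compatibly with the coroots. -/
theorem exists_affAct (g : extAffWeyl P) (a : ι × ℤ) :
    ∃ c, affVec P c = (g : (M × ℚ) ≃ₗ[ℚ] (M × ℚ)) (affVec P a) ∧
      ∀ v, P.coroot' c.1 ((g : (M × ℚ) ≃ₗ[ℚ] (M × ℚ)) v).1 = P.coroot' a.1 v.1 := by
  let good : ((M × ℚ) ≃ₗ[ℚ] (M × ℚ)) → Prop := fun g => ∀ a : ι × ℤ, ∃ c,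
    affVec P c = g (affVec P a) ∧ ∀ v, P.coroot' c.1 (g v).1 = P.coroot' a.1 v.1
  have hmul : ∀ g h, good g → good h → good (g * h) := by
    intro g h hg hh a
    obtain ⟨c, hc, hc'⟩ := hh a
    obtain ⟨d, hd, hd'⟩ := hg c
    exact ⟨d, by rw [hd, hc, LinearEquiv.mul_apply],
      fun v => by rw [LinearEquiv.mul_apply, hd', hc']⟩
  have hrefl : ∀ i, good (affRefl P (i, 0)) := by
    intro i a
    refine ⟨_, (affRefl_affVec (i, 0) a).symm, fun v => ?_⟩
    rw [affRefl_fst, P.coroot'_reflection, P.reflectionPerm_self]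
  have htrans : ∀ lam : coweightLattice P, good (trans P (lam : N)) := by
    intro lam a
    obtain ⟨k, hk⟩ := lam.2 a.1
    refine ⟨(a.1, a.2 - k), Prod.ext rfl ?_, fun v => rfl⟩
    simp only [trans_apply, affVec]
    have : P.toLinearMap (P.root a.1) (lam : N) = k := hk
    rw [this]
    push_cast
    rfl
  -- Asking the property of the inverse as well makes the set a subgroup, so that only the
  -- generators have to be checked.
  let S : Subgroup ((M × ℚ) ≃ₗ[ℚ] (M × ℚ)) :=
    { carrier := {g | good g ∧ good g⁻¹}
      one_mem' := by
        have : good 1 := fun a => ⟨a, rfl, fun v => rfl⟩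
        exact ⟨this, by rwa [inv_one]⟩
      mul_mem' := fun {g h} hg hh =>
        ⟨hmul _ _ hg.1 hh.1, by rw [mul_inv_rev]; exact hmul _ _ hh.2 hg.2⟩
      inv_mem' := fun {g} hg => ⟨hg.2, by rw [inv_inv]; exact hg.1⟩ }
  have hS : extAffWeyl P ≤ S := by
    refine (Subgroup.closure_le S).2 ?_
    rintro g (⟨i, rfl⟩ | ⟨lam, rfl⟩)
    · refine ⟨hrefl i, ?_⟩
      have : (affRefl P (i, 0))⁻¹ = affRefl P (i, 0) := rfl
      rw [this]
      exact hrefl i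
    · refine ⟨htrans lam, ?_⟩
      have : (trans P (lam : N))⁻¹ = trans P ((-lam : coweightLattice P) : N) := by
        rw [inv_eq_iff_mul_eq_one]
        ext v <;> simp [LinearEquiv.mul_apply]
      rw [this]
      exact htrans (-lam)
  exact (hS g.2).1 a

/-- The action of the extended affine Weyl group on the affine roots. -/
def affAct (g : extAffWeyl P) (a : ι × ℤ) : ι × ℤ := (exists_affAct g a).choose

theorem affVec_affAct (g : extAffWeyl P) (a : ι × ℤ) :
    affVec P (affAct g a) = (g : (M × ℚ) ≃ₗ[ℚ] (M × ℚ)) (affVec P a) :=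
  (exists_affAct g a).choose_spec.1

theorem coroot'_affAct (g : extAffWeyl P) (a : ι × ℤ) (v : M × ℚ) :
    P.coroot' (affAct g a).1 ((g : (M × ℚ) ≃ₗ[ℚ] (M × ℚ)) v).1 = P.coroot' a.1 v.1 :=
  (exists_affAct g a).choose_spec.2 v

theorem affAct_eq_of_affVec {g : extAffWeyl P} {a c : ι × ℤ}
    (h : (g : (M × ℚ) ≃ₗ[ℚ] (M × ℚ)) (affVec P a) = affVec P c) : affAct g a = c :=
  affVec_injective (P := P) ((affVec_affAct g a).trans h)

@[simp] theorem affAct_one (a : ι × ℤ) : affAct (1 : extAffWeyl P) a = a :=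
  affAct_eq_of_affVec rfl

theorem affAct_mul (g h : extAffWeyl P) (a : ι × ℤ) :
    affAct (g * h) a = affAct g (affAct h a) :=
  affAct_eq_of_affVec (by rw [affVec_affAct, affVec_affAct]; rfl)

@[simp] theorem affAct_inv_affAct (g : extAffWeyl P) (a : ι × ℤ) :
    affAct g⁻¹ (affAct g a) = a := by rw [← affAct_mul]; simp

@[simp] theorem affAct_affAct_inv (g : extAffWeyl P) (a : ι × ℤ) :
    affAct g (affAct g⁻¹ a) = a := by rw [← affAct_mul]; simp

theorem affAct_affNeg (g : extAffWeyl P) (a : ι × ℤ) :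
    affAct g (affNeg (P := P) a) = affNeg (P := P) (affAct g a) :=
  affAct_eq_of_affVec (by rw [affVec_affNeg, affVec_affNeg, affVec_affAct, map_neg])

theorem affAct_affRefl (a c : ι × ℤ) :
    affAct ⟨affRefl P a, affRefl_mem P a⟩ c =
      (P.reflectionPerm a.1 c.1, c.2 - P.pairingIn ℤ c.1 a.1 * a.2) :=
  affAct_eq_of_affVec (affRefl_affVec a c)

theorem affAct_tau_corootCowt (i : ι) (a : ι × ℤ) :
    affAct (tau P (corootCowt P i)) a = (a.1, a.2 - P.pairingIn ℤ a.1 i) := by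
  refine affAct_eq_of_affVec (Prod.ext rfl ?_)
  change (a.2 : ℚ) - P.toLinearMap (P.root a.1) (P.coroot i) = _
  rw [P.root_coroot_eq_pairing, ← cast_pairingIn]
  simp [affVec]

theorem extAffWeyl_apply_delta (g : extAffWeyl P) (n : ℚ) :
    (g : (M × ℚ) ≃ₗ[ℚ] (M × ℚ)) (0, n) = (0, n) := by
  obtain ⟨g, hg⟩ := g
  change g (0, n) = (0, n)
  induction hg using Subgroup.closure_induction with
  | mem g hg =>
    rcases hg with ⟨i, rfl⟩ | ⟨lam, rfl⟩
    · simp [affRefl_apply]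
    · simp
  | one => rfl
  | mul g h _ _ hg hh => rw [LinearEquiv.mul_apply, hh, hg]
  | inv g _ hg =>
    conv_lhs => rw [← hg]
    rw [← LinearEquiv.mul_apply, inv_mul_cancel, LinearEquiv.coe_one, id]

theorem affAct_add_delta (g : extAffWeyl P) (i : ι) (n : ℤ) :
    affAct g (i, n) = ((affAct g (i, 0)).1, (affAct g (i, 0)).2 + n) := by
  refine affAct_eq_of_affVec ?_
  have h1 : affVec P (i, n) = affVec P (i, 0) + (0, (n : ℚ)) := by simp [affVec]
  rw [h1, map_add, extAffWeyl_apply_delta, ← affVec_affAct]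
  simp [affVec]

end AffineAction

/-! ### A linear form detecting positive affine roots -/

section AffineHeight

variable [Fintype ι] [P.IsRootSystem] (b : P.Base)

/-- The linear form with value `1` on the simple roots. -/
def heightForm : M →ₗ[ℚ] ℚ := b.toWeightBasis.constr ℚ fun _ => 1

theorem heightForm_root (i : ι) : heightForm b (P.root i) = b.height i := by
  obtain ⟨f, -, -, hf⟩ := b.exists_root_eq_sum_int i
  rw [RootPairing.Base.height_eq_sum hf, hf, map_sum, Int.cast_sum]
  refine Finset.sum_congr rfl fun j hj => ?_
  have : heightForm b (P.root j) = 1 := by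
    have h := b.toWeightBasis.constr_basis ℚ (fun _ => (1 : ℚ)) ⟨j, hj⟩
    rwa [b.toWeightBasis_apply] at h
  rw [map_zsmul, this]
  simp

/-- A linear form on `E ⊕ ℚ δ` which is positive on the positive affine roots and negative on the
other ones. -/
def affHeight : M × ℚ →ₗ[ℚ] ℚ :=
  heightForm b ∘ₗ LinearMap.fst ℚ M ℚ +
    (1 + ∑ i, |(b.height i : ℚ)|) • LinearMap.snd ℚ M ℚ

theorem affHeight_affVec (a : ι × ℤ) : affHeight b (affVec P a) =
    b.height a.1 + (1 + ∑ i, |(b.height i : ℚ)|) * a.2 := by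
  simp [affHeight, affVec, heightForm_root]

variable {b}

/-- The coefficient of `δ` in the form exceeds the absolute value of every height, so a positive
multiple of `δ` outweighs any finite root. -/
theorem affHeight_pos {a : ι × ℤ} (ha : AffPos b a) : 0 < affHeight b (affVec P a) := by
  rw [affHeight_affVec]
  have h1 : |(b.height a.1 : ℚ)| ≤ ∑ i, |(b.height i : ℚ)| :=
    Finset.single_le_sum (f := fun i => |(b.height i : ℚ)|) (fun i _ => abs_nonneg _)
      (Finset.mem_univ _)
  have h2 := neg_abs_le (b.height a.1 : ℚ)
  have h3 := abs_nonneg (b.height a.1 : ℚ)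
  rcases ha with h | ⟨h, h'⟩
  · have : (1 : ℚ) ≤ a.2 := by exact_mod_cast h
    have h4 : (1 + ∑ i, |(b.height i : ℚ)|) * 1 ≤ (1 + ∑ i, |(b.height i : ℚ)|) * a.2 :=
      mul_le_mul_of_nonneg_left this (by linarith)
    linarith
  · have h4 : (0 : ℚ) < b.height a.1 := by exact_mod_cast h
    have : (0 : ℚ) ≤ a.2 := by exact_mod_cast h'
    have : 0 ≤ (1 + ∑ i, |(b.height i : ℚ)|) * a.2 := mul_nonneg (by linarith) this
    linarith

theorem affPos_affNeg_of_not {a : ι × ℤ} (ha : ¬ AffPos b a) :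
    AffPos b (affNeg (P := P) a) := by
  simp only [AffPos, affNeg, not_or, not_and, not_lt, not_le, isPos_neg_iff] at ha ⊢
  by_cases h : a.2 = 0
  · exact Or.inr ⟨fun h' => by have := ha.2 h'; omega, by omega⟩
  · left; omega

theorem affHeight_neg {a : ι × ℤ} (ha : ¬ AffPos b a) : affHeight b (affVec P a) < 0 := by
  have := affHeight_pos (affPos_affNeg_of_not ha)
  rw [affVec_affNeg, map_neg] at this
  linarith

theorem affPos_iff {a : ι × ℤ} : AffPos b a ↔ 0 < affHeight b (affVec P a) := by
  refine ⟨affHeight_pos, fun h => ?_⟩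
  by_contra h'
  have := affHeight_neg h'
  linarith

theorem affPos_affNeg {a : ι × ℤ} : AffPos b (affNeg (P := P) a) ↔ ¬ AffPos b a := by
  refine ⟨fun h h' => ?_, affPos_affNeg_of_not⟩
  have h1 := affHeight_pos h
  have h2 := affHeight_pos h'
  rw [affVec_affNeg, map_neg] at h1
  linarith

end AffineHeight

/-! ### Inversions, length and reduced decompositions -/

section Inversions

variable [Fintype ι] [P.IsRootSystem] [P.IsCrystallographic] (b : P.Base)

/-- The inversions of `w`: the positive affine roots made negative by `w`. -/
def inversions (w : extAffWeyl P) : Set (ι × ℤ) := {a | AffPos b a ∧ ¬ AffPos b (affAct w a)}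

theorem len_eq_ncard (w : extAffWeyl P) : len b w = (inversions b w).ncard := by
  rw [len]
  congr 1
  ext a
  simp only [inversions, Set.mem_ofPred_eq, and_congr_right_iff]
  intro _
  constructor
  · rintro ⟨c, hc, h⟩ h'
    have : affAct w a = affNeg (P := P) c := affAct_eq_of_affVec (by rw [h, affVec_affNeg])
    rw [this, affPos_affNeg] at h'
    exact h' hc
  · intro h
    exact ⟨affNeg (P := P) (affAct w a), affPos_affNeg.2 h, by
      rw [affVec_affNeg, affVec_affAct, neg_neg]⟩

/-- As `δ` is fixed by `w`, the image of `α + n δ` is that of `α` shifted by `n`; it is positive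
once `n` exceeds the shift that `w` applies to `α`. -/
theorem inversions_finite (w : extAffWeyl P) : (inversions b w).Finite := by
  refine ((Set.finite_univ (α := ι)).prod
    (Set.finite_Icc (0 : ℤ) (∑ i, |(affAct w (i, 0)).2|))).subset ?_
  rintro ⟨i, n⟩ ⟨h1, h2⟩
  rw [affAct_add_delta] at h2
  simp only [AffPos, not_or, not_lt] at h1 h2
  have h3 : |(affAct w (i, 0)).2| ≤ ∑ i, |(affAct w (i, 0)).2| :=
    Finset.single_le_sum (f := fun i => |(affAct w (i, 0)).2|) (fun i _ => abs_nonneg _)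
      (Finset.mem_univ _)
  have h4 := neg_abs_le (affAct w (i, 0)).2
  refine ⟨Set.mem_univ _, ?_, ?_⟩ <;> dsimp only <;> omega

theorem inversions_eq_empty_iff {w : extAffWeyl P} : len b w = 0 ↔ inversions b w = ∅ := by
  rw [len_eq_ncard, Set.ncard_eq_zero (inversions_finite b w)]

variable {b}

theorem affPos_affAct_iff_of_len_eq_zero {w : extAffWeyl P} (hw : len b w = 0) (a : ι × ℤ) :
    AffPos b (affAct w a) ↔ AffPos b a := by
  rw [inversions_eq_empty_iff, Set.eq_empty_iff_forall_notMem] at hw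
  have key : ∀ a, AffPos b a → AffPos b (affAct w a) := fun a ha => by
    by_contra h
    exact hw a ⟨ha, h⟩
  refine ⟨fun h => ?_, key a⟩
  by_contra h'
  have := key _ (affPos_affNeg_of_not h')
  rw [affAct_affNeg, affPos_affNeg] at this
  exact this h

theorem inversions_mul_of_len_eq_zero {w : extAffWeyl P} (hw : len b w = 0) (g : extAffWeyl P) :
    inversions b (w * g) = inversions b g := by
  ext a
  simp only [inversions, Set.mem_ofPred_eq, affAct_mul, affPos_affAct_iff_of_len_eq_zero hw]

theorem len_mul_of_len_eq_zero {w : extAffWeyl P} (hw : len b w = 0) (g : extAffWeyl P) :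
    len b (w * g) = len b g := by
  rw [len_eq_ncard, len_eq_ncard, inversions_mul_of_len_eq_zero hw]

variable [P.IsReduced] [P.IsIrreducible] {B : P.RootPositiveForm ℚ} {θ : ι}

theorem affAct_simpleRefl_self (i : Option b.support) :
    affAct (simpleRefl b θ i) (simpleAff b θ i) = affNeg (P := P) (simpleAff b θ i) := by
  rw [simpleRefl, affAct_affRefl, P.pairingIn_same, affNeg]
  congr 1
  ring

theorem affPos_simpleAff (i : Option b.support) : AffPos b (simpleAff b θ i) := by
  rcases i with - | i
  · exact Or.inl (by simp [simpleAff])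
  · exact Or.inr ⟨RootPairing.Base.isPos_of_mem_support i.2, le_rfl⟩

theorem simpleRefl_mul_self (i : Option b.support) :
    simpleRefl b θ i * simpleRefl b θ i = 1 := by
  refine Subtype.ext (LinearEquiv.ext fun v => ?_)
  exact Module.involutive_reflection (x := affVec P (simpleAff b θ i))
    (f := P.coroot' (simpleAff b θ i).1 ∘ₗ LinearMap.fst ℚ M ℚ) (by simp [affVec]) v

theorem simpleRefl_inv (i : Option b.support) : (simpleRefl b θ i)⁻¹ = simpleRefl b θ i :=
  inv_eq_of_mul_eq_one_left (simpleRefl_mul_self i)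

/-- A simple reflection permutes the positive affine roots other than its simple root. -/
theorem affPos_affAct_simpleRefl (hθ : IsLong B θ) (hdom : IsDominantRoot b θ)
    (i : Option b.support) {a : ι × ℤ} (ha : AffPos b a) (hne : a ≠ simpleAff b θ i) :
    AffPos b (affAct (simpleRefl b θ i) a) := by
  rcases i with - | i
  · rw [simpleRefl, affAct_affRefl]
    simp only [simpleAff, P.pairingIn_reflectionPerm_self_right, mul_one, sub_neg_eq_add]
    have hc := hθ.pairingIn_cases a.1
    have hpair : P.pairingIn ℤ (P.reflectionPerm (P.reflectionPerm θ θ) a.1) θ =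
        -P.pairingIn ℤ a.1 θ := by
      rw [pairingIn_reflectionPerm_left, P.pairingIn_reflectionPerm_self_right,
        P.pairingIn_reflectionPerm_self_left, P.pairingIn_same]
      ring
    have hpos : P.pairingIn ℤ a.1 θ < 0 →
        b.IsPos (P.reflectionPerm (P.reflectionPerm θ θ) a.1) := fun h =>
      hdom.isPos_of_pairingIn_pos (by omega)
    have hneg : P.pairingIn ℤ a.1 θ < 0 → ¬ b.IsPos a.1 := fun h h' => by
      have := hdom.pairingIn_nonneg h'
      omega
    have hzero : P.pairingIn ℤ a.1 θ = 0 → b.IsPos a.1 →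
        b.IsPos (P.reflectionPerm (P.reflectionPerm θ θ) a.1) := fun h h' => by
      have h1 : P.root (P.reflectionPerm (P.reflectionPerm θ θ) a.1) = P.root a.1 := by
        rw [P.root_reflectionPerm, P.reflection_apply_root, ← cast_pairingIn,
          P.pairingIn_reflectionPerm_self_right, h]
        simp
      rwa [P.root.injective h1]
    -- Here `s₀` adds `⟨α, θ^∨⟩ ≥ -2` to the coefficient of `δ`. When a negative pairing brings the
    -- coefficient to `0`, the reflected finite root pairs positively with the dominant `θ` and is
    -- therefore positive. It becomes negative only for `α = -θ` and coefficient `1`, the excluded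
    -- simple root.
    rcases ha with ha | ⟨ha, ha'⟩
    · rcases hc with h | h | h | h | h
      · rw [h, P.pairingIn_same]; left; dsimp only; omega
      · have h2 : P.pairingIn ℤ a.1 θ = -2 := by
          rw [h, P.pairingIn_reflectionPerm_self_left, P.pairingIn_same]
        have h3 : a.2 ≠ 1 := fun h3 => hne (Prod.ext h h3)
        by_cases h4 : a.2 = 2
        · exact Or.inr ⟨hpos (by omega), by dsimp only; omega⟩
        · left; dsimp only; omega
      · left; dsimp only; omega
      · left; dsimp only; omega
      · exact Or.inr ⟨hpos (by omega), by dsimp only; omega⟩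
    · have hnn := hdom.pairingIn_nonneg ha
      by_cases h : P.pairingIn ℤ a.1 θ = 0
      · exact Or.inr ⟨hzero h ha, by dsimp only; omega⟩
      · left; dsimp only; omega
  · rw [simpleRefl, affAct_affRefl]
    simp only [simpleAff, mul_zero, sub_zero]
    rcases ha with ha | ⟨ha, ha'⟩
    · exact Or.inl ha
    · by_cases h0 : a.2 = 0
      · refine Or.inr ⟨ha.reflectionPerm i.2 fun h => hne (Prod.ext h h0), ha'⟩
      · left; dsimp only; omega

/-- The reflection changes the sign of `g a` only if `g a` is plus or minus the simple root. By the
hypothesis, minus the simple root is not the image of a positive root under `g`. -/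
theorem inversions_simpleRefl_mul (hθ : IsLong B θ) (hdom : IsDominantRoot b θ)
    (i : Option b.support) (g : extAffWeyl P)
    (h : AffPos b (affAct g⁻¹ (simpleAff b θ i))) :
    inversions b (simpleRefl b θ i * g) =
      insert (affAct g⁻¹ (simpleAff b θ i)) (inversions b g) := by
  ext a
  simp only [inversions, Set.mem_ofPred_eq, affAct_mul, Set.mem_insert_iff]
  by_cases h1 : affAct g a = simpleAff b θ i
  · have h2 : a = affAct g⁻¹ (simpleAff b θ i) := by rw [← h1, affAct_inv_affAct]
    rw [h1, affAct_simpleRefl_self, affPos_affNeg, not_not]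
    simp only [← h2, affPos_simpleAff, and_true, true_or, iff_true]
    rwa [h2]
  · have h2 : a ≠ affAct g⁻¹ (simpleAff b θ i) := fun h2 => h1 (by rw [h2, affAct_affAct_inv])
    simp only [h2, false_or, and_congr_right_iff, not_iff_not]
    intro ha
    refine ⟨fun h3 => ?_, fun h3 => affPos_affAct_simpleRefl hθ hdom i h3 h1⟩
    by_contra h4
    by_cases h5 : affNeg (P := P) (affAct g a) = simpleAff b θ i
    · apply affPos_affNeg.1 ((congrArg (AffPos b) _).mp h) ha
      rw [← h5, ← affAct_affNeg, affAct_inv_affAct]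
    · have := affPos_affAct_simpleRefl hθ hdom i (affPos_affNeg.2 h4) h5
      rw [affAct_affNeg, affPos_affNeg] at this
      exact this h3

theorem len_simpleRefl_mul (hθ : IsLong B θ) (hdom : IsDominantRoot b θ)
    (i : Option b.support) (g : extAffWeyl P)
    (h : AffPos b (affAct g⁻¹ (simpleAff b θ i))) :
    len b (simpleRefl b θ i * g) = len b g + 1 := by
  rw [len_eq_ncard, len_eq_ncard, inversions_simpleRefl_mul hθ hdom i g h,
    Set.ncard_insert_of_notMem _ (inversions_finite b g)]
  rintro ⟨-, h'⟩
  rw [affAct_affAct_inv] at h'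
  exact h' (affPos_simpleAff i)

/-- This is `len_simpleRefl_mul` for `s_i g` in place of `g`, since `s_i` is an involution. -/
theorem len_simpleRefl_mul_add_one (hθ : IsLong B θ) (hdom : IsDominantRoot b θ)
    (i : Option b.support) (g : extAffWeyl P)
    (h : ¬ AffPos b (affAct g⁻¹ (simpleAff b θ i))) :
    len b (simpleRefl b θ i * g) + 1 = len b g := by
  have h1 := len_simpleRefl_mul hθ hdom i (simpleRefl b θ i * g) (by
    rw [mul_inv_rev, affAct_mul, simpleRefl_inv, affAct_simpleRefl_self, affAct_affNeg,
      affPos_affNeg]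
    exact h)
  rw [← mul_assoc, simpleRefl_mul_self, one_mul] at h1
  omega

@[simp] theorem len_one : len b (1 : extAffWeyl P) = 0 := by
  rw [inversions_eq_empty_iff, Set.eq_empty_iff_forall_notMem]
  rintro a ⟨h, h'⟩
  rw [affAct_one] at h'
  exact h' h

theorem len_simpleRefl (hθ : IsLong B θ) (hdom : IsDominantRoot b θ) (i : Option b.support) :
    len b (simpleRefl b θ i) = 1 := by
  have := len_simpleRefl_mul hθ hdom i 1 (by
    rw [inv_one, affAct_one]; exact affPos_simpleAff i)
  simpa using this

theorem len_prod_le (hθ : IsLong B θ) (hdom : IsDominantRoot b θ) (js : List (Option b.support)) :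
    len b (js.map (simpleRefl b θ)).prod ≤ js.length := by
  induction js with
  | nil => simp
  | cons j js ih =>
    rw [List.map_cons, List.prod_cons, List.length_cons]
    by_cases h : AffPos b (affAct (js.map (simpleRefl b θ)).prod⁻¹ (simpleAff b θ j))
    · rw [len_simpleRefl_mul hθ hdom j _ h]; omega
    · have := len_simpleRefl_mul_add_one hθ hdom j _ h; omega

/-- The tail of a reduced decomposition is reduced, and its first letter increases the length. -/
theorem reduced_cons (hθ : IsLong B θ) (hdom : IsDominantRoot b θ) {j : Option b.support}
    {js : List (Option b.support)}
    (h : len b ((j :: js).map (simpleRefl b θ)).prod = (j :: js).length) :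
    len b (js.map (simpleRefl b θ)).prod = js.length ∧
      AffPos b (affAct (js.map (simpleRefl b θ)).prod⁻¹ (simpleAff b θ j)) := by
  rw [List.map_cons, List.prod_cons, List.length_cons] at h
  have hle := len_prod_le hθ hdom js
  by_cases h' : AffPos b (affAct (js.map (simpleRefl b θ)).prod⁻¹ (simpleAff b θ j))
  · rw [len_simpleRefl_mul hθ hdom j _ h'] at h
    exact ⟨by omega, h'⟩
  · have := len_simpleRefl_mul_add_one hθ hdom j _ h'
    omega

/-- The finite part of an affine root pairs positively with that of some simple affine root. -/
theorem exists_simpleAff_pairingIn_pos (hdom : IsDominantRoot b θ) (α : ι) :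
    ∃ i : Option b.support, 0 < P.pairingIn ℤ α (simpleAff b θ i).1 := by
  by_contra! h
  -- If `α` paired nonpositively with all simple affine roots, `-α` would be dominant and would have
  -- to pair positively with `θ`, which the condition for `α₀` forbids.
  have h1 : IsDominantRoot b (P.reflectionPerm α α) := by
    rw [isDominantRoot_iff]
    intro j hj
    have := h (some ⟨j, hj⟩)
    simp only [simpleAff] at this
    rw [P.pairingIn_reflectionPerm_self_left]
    omega
  have h2 := hdom.pairingIn_pos h1
  have h3 := h none
  simp only [simpleAff, P.pairingIn_reflectionPerm_self_right] at h3
  rw [P.pairingIn_reflectionPerm_self_left] at h2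
  omega

/-- An element without simple inversions has length zero. -/
theorem exists_simpleAff_mem_inversions (hθ : IsLong B θ) (hdom : IsDominantRoot b θ)
    {w : extAffWeyl P} (hw : len b w ≠ 0) : ∃ i, ¬ AffPos b (affAct w (simpleAff b θ i)) := by
  by_contra! h
  have hne : (inversions b w).Nonempty := by
    rw [Set.nonempty_iff_ne_empty]
    exact fun h => hw ((inversions_eq_empty_iff b).2 h)
  -- Take an inversion of least affine height. Reflecting it in a simple root with which it pairs
  -- positively subtracts a multiple of that root; if `w` kept all simple roots positive, the result
  -- would be an inversion of smaller height.
  obtain ⟨a, ha, hmin⟩ := Set.exists_min_image (inversions b w)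
    (fun a => affHeight b (affVec P a)) (inversions_finite b w) hne
  obtain ⟨i, hi⟩ := exists_simpleAff_pairingIn_pos hdom a.1
  have hne' : a ≠ simpleAff b θ i := fun h' => ha.2 (h' ▸ h i)
  have hpos := affPos_affAct_simpleRefl hθ hdom i ha.1 hne'
  have hvec : affVec P (affAct (simpleRefl b θ i) a) =
      affVec P a - (P.pairingIn ℤ a.1 (simpleAff b θ i).1 : ℚ) • affVec P (simpleAff b θ i) := by
    rw [affVec_affAct]
    change affRefl P _ _ = _
    rw [affRefl_apply, cast_pairingIn]
    rfl
  have hi' : (0 : ℚ) < P.pairingIn ℤ a.1 (simpleAff b θ i).1 := by exact_mod_cast hi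
  have hinv : affAct (simpleRefl b θ i) a ∈ inversions b w := by
    refine ⟨hpos, fun h' => ha.2 ?_⟩
    rw [affPos_iff, affVec_affAct, hvec, map_sub, map_sub, map_smul, map_smul, ← affVec_affAct,
      ← affVec_affAct, smul_eq_mul] at h'
    have h2 := affHeight_pos (h i)
    rw [affPos_iff]
    have := mul_pos hi' h2
    linarith
  have h1 := hmin _ hinv
  rw [hvec, map_sub, map_smul, smul_eq_mul] at h1
  have := mul_pos hi' (affHeight_pos (affPos_simpleAff (b := b) (θ := θ) i))
  linarith

theorem len_inv (w : extAffWeyl P) : len b w⁻¹ = len b w := by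
  have h : inversions b w⁻¹ = (fun a => affNeg (P := P) (affAct w a)) '' inversions b w := by
    ext a
    constructor
    · rintro ⟨h1, h2⟩
      refine ⟨affNeg (P := P) (affAct w⁻¹ a), ⟨affPos_affNeg.2 h2, ?_⟩, ?_⟩
      · rwa [affAct_affNeg, affAct_affAct_inv, affPos_affNeg, not_not]
      · dsimp only
        rw [affAct_affNeg, affAct_affAct_inv, affNeg_affNeg]
    · rintro ⟨c, ⟨h1, h2⟩, rfl⟩
      refine ⟨affPos_affNeg.2 h2, ?_⟩
      rwa [affAct_affNeg, affAct_inv_affAct, affPos_affNeg, not_not]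
  rw [len_eq_ncard, len_eq_ncard, h, Set.ncard_image_of_injective]
  intro a c hac
  have h1 := congrArg (affNeg (P := P)) hac
  simp only [affNeg_affNeg] at h1
  rw [← affAct_inv_affAct w a, h1, affAct_inv_affAct]

/-- Induction on the length: a simple root made negative by `w` can be stripped off on the right.
The length lemmas multiply on the left, hence the passage through `w⁻¹`. -/
theorem exists_reduced_decomposition (hθ : IsLong B θ) (hdom : IsDominantRoot b θ)
    (w : extAffWeyl P) : ∃ (ω : extAffWeyl P) (js : List (Option b.support)),
      len b ω = 0 ∧ w = ω * (js.map (simpleRefl b θ)).prod ∧ len b w = js.length := by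
  induction hn : len b w generalizing w with
  | zero => exact ⟨w, [], hn, by simp, rfl⟩
  | succ n ih =>
    obtain ⟨i, hi⟩ := exists_simpleAff_mem_inversions hθ hdom (w := w) (by omega)
    have h1 := len_simpleRefl_mul_add_one hθ hdom i w⁻¹ (by rwa [inv_inv])
    have h2 : simpleRefl b θ i * w⁻¹ = (w * simpleRefl b θ i)⁻¹ := by
      rw [mul_inv_rev, simpleRefl_inv]
    rw [h2, len_inv, len_inv, hn] at h1
    obtain ⟨ω, js, h3, h4, h5⟩ := ih (w * simpleRefl b θ i) (by omega)
    refine ⟨ω, js ++ [i], h3, ?_, by simp [h5]⟩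
    rw [List.map_append, List.prod_append, ← mul_assoc, ← h4]
    simp [mul_assoc, simpleRefl_mul_self]

end Inversions

/-! ### From the affine Hecke algebra to products of operators -/

section HeckeElements

variable {b : P.Base} [P.IsCrystallographic] {θ : ι}

theorem presentedGroup_of_mul {v w : extAffWeyl P} (h : len b v + len b w = len b (v * w)) :
    (PresentedGroup.of v * PresentedGroup.of w : BraidGroup b) = PresentedGroup.of (v * w) := by
  have h1 : PresentedGroup.mk (braidRels b)
      (FreeGroup.of v * FreeGroup.of w * (FreeGroup.of (v * w))⁻¹) = 1 :=
    PresentedGroup.one_of_mem ⟨v, w, h, rfl⟩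
  rw [map_mul, map_mul, map_inv, mul_inv_eq_one] at h1
  exact h1

theorem heckeT_mul {v w : extAffWeyl P} (h : len b v + len b w = len b (v * w)) :
    heckeT b θ v * heckeT b θ w = heckeT b θ (v * w) := by
  rw [heckeT, heckeT, heckeT, ← map_mul, braidT, braidT, braidT, ← map_mul,
    presentedGroup_of_mul h]

variable [Fintype ι] [P.IsRootSystem] [P.IsReduced] [P.IsIrreducible] {B : P.RootPositiveForm ℚ}

/-- The relation for `v = w = 1` makes `T(1)` an idempotent of the braid group, hence its identity.
-/
theorem heckeT_one : heckeT b θ (1 : extAffWeyl P) = 1 := by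
  have h := presentedGroup_of_mul (b := b) (v := 1) (w := 1) (by simp)
  rw [mul_one, mul_eq_left] at h
  rw [heckeT, braidT, h, map_one, map_one]

theorem heckeT_prod (hθ : IsLong B θ) (hdom : IsDominantRoot b θ)
    {js : List (Option b.support)} (h : len b (js.map (simpleRefl b θ)).prod = js.length) :
    heckeT b θ (js.map (simpleRefl b θ)).prod =
      (js.map fun j => heckeT b θ (simpleRefl b θ j)).prod := by
  induction js with
  | nil => simp [heckeT_one]
  | cons j js ih =>
    have h1 := reduced_cons hθ hdom h
    rw [List.map_cons, List.prod_cons, List.map_cons, List.prod_cons, ← ih h1.1, heckeT_mul]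
    rw [len_simpleRefl hθ hdom, len_simpleRefl_mul hθ hdom j _ h1.2, add_comm]

theorem isHeckeOp_of_isPolyRep (hθ : IsLong B θ) (hdom : IsDominantRoot b θ) {m : ℕ}
    {ρ : HeckeAlgebra b θ →ₐ[Qt] Module.End Qqt (Poly P)} (hρ : IsPolyRep b θ m ρ)
    (w : extAffWeyl P) : IsHeckeOp b θ m w (ρ (heckeT b θ w)) := by
  obtain ⟨ω, js, h1, h2, h3⟩ := exists_reduced_decomposition hθ hdom w
  refine ⟨ω, js, h1, h2, h3, ?_⟩
  have h4 : len b (js.map (simpleRefl b θ)).prod = js.length := by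
    rw [← h3, h2, len_mul_of_len_eq_zero h1]
  have h5 : heckeT b θ w = heckeT b θ ω * (js.map fun j => heckeT b θ (simpleRefl b θ j)).prod := by
    rw [← heckeT_prod hθ hdom h4, heckeT_mul, h2]
    rw [h1, zero_add, len_mul_of_len_eq_zero h1]
  rw [h5, map_mul, hρ.omega ω h1, map_list_prod, List.map_map]
  congr 3
  funext j
  exact hρ.simple j

theorem exists_isHeckeOp (hθ : IsLong B θ) (hdom : IsDominantRoot b θ) (m : ℕ)
    (w : extAffWeyl P) : ∃ F, IsHeckeOp b θ m w F := by
  obtain ⟨ω, js, h1, h2, h3⟩ := exists_reduced_decomposition hθ hdom w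
  exact ⟨_, ω, js, h1, h2, h3, rfl⟩

end HeckeElements

/-! ### Intertwiners of Demazure-Lusztig operators -/

section Operators

open Classical in
/-- The exponential `e^{y + n δ} = q^{-n} e^y` of a vector of `E ⊕ ℚ δ`, set to zero unless `y` is
a weight. -/
def expAt (P : RootPairing ι ℚ M N) (m : ℕ) (v : M × ℚ) : Poly P :=
  if h : v.1 ∈ weightLattice P then affEx m ⟨v.1, h⟩ v.2 else 0

theorem expAt_of_mem {m : ℕ} {v : M × ℚ} (h : v.1 ∈ weightLattice P) :
    expAt P m v = affEx m ⟨v.1, h⟩ v.2 := dif_pos h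

theorem expAt_coe (m : ℕ) (μ : weightLattice P) (n : ℚ) :
    expAt P m ((μ : M), n) = affEx m μ n := expAt_of_mem μ.2

@[simp] theorem affEx_zero (m : ℕ) (μ : weightLattice P) : affEx m μ 0 = ex μ := by
  simp [affEx, qpow]

theorem ex_eq_expAt (m : ℕ) (μ : weightLattice P) : ex μ = expAt P m ((μ : M), 0) := by
  rw [expAt_coe, affEx_zero]

theorem qpow_smul_affEx (m : ℕ) (μ : weightLattice P) (k : ℤ) (n : ℚ) :
    qpow m (-(k : ℚ)) • affEx m μ n = affEx m μ (n + k) := by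
  rw [affEx, affEx, smul_smul, neg_add, mul_comm]
  have := qpow_add_int m (-n) (-k)
  push_cast at this
  rw [this]

theorem expAt_add_int (m : ℕ) (v : M × ℚ) (k : ℤ) :
    qpow m (-(k : ℚ)) • expAt P m v = expAt P m (v + (0, (k : ℚ))) := by
  by_cases h : v.1 ∈ weightLattice P
  · have h' : (v + (0, (k : ℚ))).1 ∈ weightLattice P := by simpa using h
    rw [expAt_of_mem h, expAt_of_mem h', qpow_smul_affEx]
    congr 2
    simp
  · have h' : (v + (0, (k : ℚ))).1 ∉ weightLattice P := by simpa using h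
    rw [expAt, expAt, dif_neg h, dif_neg h', smul_zero]

/-- Vectors `y + n δ` with `y` a weight and `n` an integer. -/
def IsIntegralVec (P : RootPairing ι ℚ M N) (v : M × ℚ) : Prop :=
  v.1 ∈ weightLattice P ∧ ∃ k : ℤ, v.2 = k

theorem IsIntegralVec.eq_add {v : M × ℚ} (hv : IsIntegralVec P v) :
    ∃ (μ : weightLattice P) (k : ℤ), v = ((μ : M), 0) + (0, (k : ℚ)) := by
  obtain ⟨k, hk⟩ := hv.2
  exact ⟨⟨v.1, hv.1⟩, k, by ext <;> simp [hk]⟩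

theorem isIntegralVec_coe (μ : weightLattice P) : IsIntegralVec P ((μ : M), 0) :=
  ⟨μ.2, 0, by simp⟩

theorem end_ext_ex {F G : Module.End Qqt (Poly P)} (h : ∀ μ, F (ex μ) = G (ex μ)) : F = G := by
  refine (AddMonoidAlgebra.basis (weightLattice P) Qqt).ext fun μ => ?_
  have hb : AddMonoidAlgebra.basis (weightLattice P) Qqt μ = ex μ := by simp [ex]
  rw [hb]
  exact h μ

variable [P.IsCrystallographic]

theorem IsIntegralVec.add_zsmul {v : M × ℚ} (hv : IsIntegralVec P v) (j : ℤ) (a : ι × ℤ) :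
    IsIntegralVec P (v + j • affVec P a) := by
  obtain ⟨k, hk⟩ := hv.2
  refine ⟨add_mem hv.1 (zsmul_mem (root_mem_weightLattice P a.1) j), k + j * a.2, ?_⟩
  simp [hk, affVec]

theorem IsIntegralVec.sub_zsmul {v : M × ℚ} (hv : IsIntegralVec P v) (j : ℤ) (a : ι × ℤ) :
    IsIntegralVec P (v - j • affVec P a) := by
  rw [sub_eq_add_neg, ← neg_zsmul]
  exact hv.add_zsmul (-j) a

theorem weylOp_ex (m : ℕ) (w : extAffWeyl P) (μ : weightLattice P) :
    weylOp m w (ex μ) = expAt P m ((w : (M × ℚ) ≃ₗ[ℚ] (M × ℚ)) ((μ : M), 0)) := by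
  rw [weylOp, opOfExp_ex, expAt_of_mem (extAffWeyl_fst_mem P w μ.2)]

theorem weylOp_expAt (m : ℕ) (w : extAffWeyl P) {v : M × ℚ} (hv : IsIntegralVec P v) :
    weylOp m w (expAt P m v) = expAt P m ((w : (M × ℚ) ≃ₗ[ℚ] (M × ℚ)) v) := by
  obtain ⟨μ, k, rfl⟩ := hv.eq_add
  rw [← expAt_add_int, map_smul, ← ex_eq_expAt, weylOp_ex, expAt_add_int, map_add,
    extAffWeyl_apply_delta]

/-- Elements preserving the vectors `y + n δ` with `y` a weight and `n` an integer. -/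
def IsIntegralElt (w : extAffWeyl P) : Prop :=
  ∀ v, IsIntegralVec P v → IsIntegralVec P ((w : (M × ℚ) ≃ₗ[ℚ] (M × ℚ)) v)

/-- The floor in `qpow` is additive only when one exponent is an integer, so the inner element is
asked to keep the coefficients of `δ` integral. Products of reflections do; the outer element, such
as `ω`, is arbitrary. -/
theorem weylOp_mul (m : ℕ) (g : extAffWeyl P) {h : extAffWeyl P} (hh : IsIntegralElt h) :
    weylOp m (g * h) = weylOp m g * weylOp m h := by
  refine end_ext_ex fun μ => ?_
  rw [Module.End.mul_apply, weylOp_ex, weylOp_ex, weylOp_expAt m g (hh _ (isIntegralVec_coe μ))]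
  rfl

theorem weylOp_one (m : ℕ) : weylOp m (1 : extAffWeyl P) = 1 := by
  refine end_ext_ex fun μ => ?_
  rw [weylOp_ex, Module.End.one_apply, ex_eq_expAt m]
  rfl

/-- The reflection in an affine root, as an element of the extended affine Weyl group. -/
def reflElt (P : RootPairing ι ℚ M N) [P.IsCrystallographic] (a : ι × ℤ) : extAffWeyl P :=
  ⟨affRefl P a, affRefl_mem P a⟩

theorem reflElt_apply (a : ι × ℤ) (v : M × ℚ) :
    (reflElt P a : (M × ℚ) ≃ₗ[ℚ] (M × ℚ)) v = v - P.coroot' a.1 v.1 • affVec P a :=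
  affRefl_apply P a v

theorem isIntegralElt_reflElt (a : ι × ℤ) : IsIntegralElt (reflElt P a) := by
  intro v hv
  obtain ⟨k, hk⟩ := hv.1 a.1
  rw [reflElt_apply, hk, Int.cast_smul_eq_zsmul]
  exact hv.sub_zsmul k a

theorem IsIntegralElt.mul {g h : extAffWeyl P} (hg : IsIntegralElt g) (hh : IsIntegralElt h) :
    IsIntegralElt (g * h) := fun v hv => hg _ (hh v hv)

theorem isIntegralElt_one : IsIntegralElt (1 : extAffWeyl P) := fun _ hv => hv

theorem reflElt_mul_self (a : ι × ℤ) : reflElt P a * reflElt P a = 1 := by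
  refine Subtype.ext (LinearEquiv.ext fun v => ?_)
  exact Module.involutive_reflection (x := affVec P a)
    (f := P.coroot' a.1 ∘ₗ LinearMap.fst ℚ M ℚ) (by simp [affVec]) v

theorem mul_reflElt (g : extAffWeyl P) (a : ι × ℤ) :
    g * reflElt P a = reflElt P (affAct g a) * g := by
  refine Subtype.ext (LinearEquiv.ext fun v => ?_)
  change (g : (M × ℚ) ≃ₗ[ℚ] (M × ℚ)) ((reflElt P a : (M × ℚ) ≃ₗ[ℚ] (M × ℚ)) v) =
    (reflElt P (affAct g a) : (M × ℚ) ≃ₗ[ℚ] (M × ℚ)) ((g : (M × ℚ) ≃ₗ[ℚ] (M × ℚ)) v)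
  rw [reflElt_apply, reflElt_apply, coroot'_affAct, affVec_affAct, map_sub, map_smul]

theorem divDiff_expAt (m : ℕ) (a : ι × ℤ) {v : M × ℚ} (hv : IsIntegralVec P v) :
    divDiff m a (expAt P m v) =
      ∑ j ∈ Finset.Ioc ⌊P.coroot' a.1 v.1⌋ 0, expAt P m (v - j • affVec P a) -
        ∑ j ∈ Finset.Ioc 0 ⌊P.coroot' a.1 v.1⌋, expAt P m (v - j • affVec P a) := by
  obtain ⟨μ, k, rfl⟩ := hv.eq_add
  have hterm : ∀ j : ℤ, qpow m (-(k : ℚ)) • affEx m (μ - j • rootWt P a.1)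
      ((-(j * a.2) : ℤ) : ℚ) = expAt P m (((μ : M), 0) + (0, (k : ℚ)) - j • affVec P a) := by
    intro j
    rw [← expAt_coe, expAt_add_int]
    congr 1
    ext
    · simp [affVec, rootWt]
    · simp [affVec]
      ring
  rw [← expAt_add_int, map_smul, ← ex_eq_expAt, divDiff, opOfExp_ex, smul_sub, Finset.smul_sum,
    Finset.smul_sum]
  simp only [hterm]
  simp

theorem divDiff_affAct_mul_weylOp (m : ℕ) {g : extAffWeyl P} (hg : IsIntegralElt g) (a : ι × ℤ) :
    divDiff m (affAct g a) * weylOp m g = weylOp m g * divDiff m a := by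
  refine end_ext_ex fun μ => ?_
  have h1 := isIntegralVec_coe (P := P) μ
  rw [Module.End.mul_apply, Module.End.mul_apply, ex_eq_expAt m, weylOp_expAt m g h1,
    divDiff_expAt m _ (hg _ h1), divDiff_expAt m _ h1, coroot'_affAct, map_sub, map_sum, map_sum]
  congr 1 <;> refine Finset.sum_congr rfl fun j _ => ?_ <;>
    rw [weylOp_expAt m g (h1.sub_zsmul j a), map_sub, map_zsmul, affVec_affAct]

/-- The Demazure-Lusztig operator attached to an affine root. -/
def demLusAt (m : ℕ) (a : ι × ℤ) : Module.End Qqt (Poly P) :=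
  tt • weylOp m (reflElt P a) + (tt - tt⁻¹) • divDiff m a

/-- The operator `s_α T_α`, where `T_α` is the Demazure-Lusztig operator of the affine root `α`. -/
def intertwiner (m : ℕ) (a : ι × ℤ) : Module.End Qqt (Poly P) :=
  tt • 1 + (tt - tt⁻¹) • (weylOp m (reflElt P a) * divDiff m a)

/-- Conjugation by `g` carries the operator of `a` to that of `g a`, because `g` carries `a`-strings
to `g a`-strings. This is what moves all reflections to the left. -/
theorem demLusAt_affAct_mul_weylOp (m : ℕ) {g : extAffWeyl P} (hg : IsIntegralElt g)
    (a : ι × ℤ) : demLusAt m (affAct g a) * weylOp m g = weylOp m g * demLusAt m a := by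
  rw [demLusAt, demLusAt, add_mul, mul_add, smul_mul_assoc, smul_mul_assoc, mul_smul_comm,
    mul_smul_comm, divDiff_affAct_mul_weylOp m hg, ← weylOp_mul m _ hg,
    ← weylOp_mul m _ (isIntegralElt_reflElt a), mul_reflElt]

theorem demLusAt_eq (m : ℕ) (a : ι × ℤ) :
    demLusAt m a = weylOp m (reflElt P a) * intertwiner m a := by
  rw [demLusAt, intertwiner, mul_add, mul_smul_comm, mul_smul_comm, mul_one, ← mul_assoc,
    ← weylOp_mul m _ (isIntegralElt_reflElt a), reflElt_mul_self, weylOp_one, one_mul]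

/-- The divided difference runs along the `a`-string of `v`, and the reflection sends `v - j a` to
`v + (j - k) a`. For `k > 0` the term `j = k` is `v` itself and turns the scalar `t` into `t⁻¹`. -/
theorem intertwiner_expAt (m : ℕ) (a : ι × ℤ) {v : M × ℚ} (hv : IsIntegralVec P v) {k : ℤ}
    (hk : P.coroot' a.1 v.1 = k) :
    intertwiner m a (expAt P m v) = tt • expAt P m v + (tt - tt⁻¹) •
      (∑ j ∈ Finset.Ioc k 0, expAt P m (v + (j - k) • affVec P a) -
        ∑ j ∈ Finset.Ioc 0 k, expAt P m (v + (j - k) • affVec P a)) := by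
  have hterm : ∀ j : ℤ, weylOp m (reflElt P a) (expAt P m (v - j • affVec P a)) =
      expAt P m (v + (j - k) • affVec P a) := by
    intro j
    rw [weylOp_expAt m _ (hv.sub_zsmul j a), reflElt_apply]
    congr 1
    have h1 : P.coroot' a.1 (v - j • affVec P a).1 = ((k - j * 2 : ℤ) : ℚ) := by
      rw [Prod.fst_sub, map_sub, hk, Prod.smul_fst, map_zsmul]
      simp [affVec]
    rw [h1, Int.cast_smul_eq_zsmul]
    module
  rw [intertwiner, LinearMap.add_apply, LinearMap.smul_apply, LinearMap.smul_apply,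
    Module.End.one_apply, Module.End.mul_apply, divDiff_expAt m a hv, hk, Int.floor_intCast,
    map_sub, map_sum, map_sum]
  simp only [hterm]

theorem intertwiner_expAt_zero (m : ℕ) (a : ι × ℤ) {v : M × ℚ} (hv : IsIntegralVec P v)
    (hk : P.coroot' a.1 v.1 = 0) : intertwiner m a (expAt P m v) = tt • expAt P m v := by
  rw [intertwiner_expAt m a hv (k := 0) (by simpa using hk)]
  simp

theorem smul_add_sub_smul_zero_sub {R V : Type*} [CommRing R] [AddCommGroup V] [Module R V]
    (t s : R) (x y : V) : t • x + (t - s) • (0 - (y + x)) = s • x - (t - s) • y := by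
  module

theorem intertwiner_expAt_one (m : ℕ) (a : ι × ℤ) {v : M × ℚ} (hv : IsIntegralVec P v)
    (hk : P.coroot' a.1 v.1 = 1) : intertwiner m a (expAt P m v) = tt⁻¹ • expAt P m v := by
  rw [intertwiner_expAt m a hv (k := 1) (by simpa using hk)]
  have : Finset.Ioc (0 : ℤ) 1 = {1} := by decide
  rw [this]
  simp only [Finset.sum_singleton, sub_self, zero_smul, add_zero]
  rw [Finset.Ioc_eq_empty (by norm_num), Finset.sum_empty, zero_sub, smul_neg, ← sub_eq_add_neg,
    ← sub_smul, sub_sub_cancel]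

theorem intertwiner_expAt_two (m : ℕ) (a : ι × ℤ) {v : M × ℚ} (hv : IsIntegralVec P v)
    (hk : P.coroot' a.1 v.1 = 2) : intertwiner m a (expAt P m v) =
      tt⁻¹ • expAt P m v - (tt - tt⁻¹) • expAt P m (v - affVec P a) := by
  rw [intertwiner_expAt m a hv (k := 2) (by simpa using hk)]
  have : Finset.Ioc (0 : ℤ) 2 = {1, 2} := by decide
  have h2 : v + (1 - 2 : ℤ) • affVec P a = v - affVec P a := by module
  rw [this, Finset.sum_pair (by norm_num), h2, sub_self, zero_smul, add_zero,
    Finset.Ioc_eq_empty (by norm_num), Finset.sum_empty]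
  exact smul_add_sub_smul_zero_sub _ _ _ _

theorem intertwiner_expAt_three (m : ℕ) (a : ι × ℤ) {v : M × ℚ} (hv : IsIntegralVec P v)
    (hk : P.coroot' a.1 v.1 = 3) : intertwiner m a (expAt P m v) =
      tt⁻¹ • expAt P m v - (tt - tt⁻¹) • (expAt P m (v - affVec P a) +
        expAt P m (v - (2 : ℤ) • affVec P a)) := by
  rw [intertwiner_expAt m a hv (k := 3) (by simpa using hk)]
  have : Finset.Ioc (0 : ℤ) 3 = {1, 2, 3} := by decide
  have h2 : v + (2 - 3 : ℤ) • affVec P a = v - affVec P a := by module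
  have h3 : v + (1 - 3 : ℤ) • affVec P a = v - (2 : ℤ) • affVec P a := by module
  rw [this, Finset.sum_insert (by decide), Finset.sum_pair (by norm_num), h2, h3, sub_self, zero_smul,
    add_zero, Finset.Ioc_eq_empty (by norm_num), Finset.sum_empty, ← add_assoc, add_comm (expAt P m
      (v - (2 : ℤ) • affVec P a))]
  exact smul_add_sub_smul_zero_sub _ _ _ _

theorem intertwiner_expAt_neg_one (m : ℕ) (a : ι × ℤ) {v : M × ℚ} (hv : IsIntegralVec P v)
    (hk : P.coroot' a.1 v.1 = -1) : intertwiner m a (expAt P m v) =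
      tt • expAt P m v + (tt - tt⁻¹) • expAt P m (v + affVec P a) := by
  rw [intertwiner_expAt m a hv (k := -1) (by simpa using hk)]
  have : Finset.Ioc (-1 : ℤ) 0 = {0} := by decide
  have h2 : v + (0 - -1 : ℤ) • affVec P a = v + affVec P a := by module
  rw [this, Finset.sum_singleton, h2]
  simp

end Operators

/-! ### The ordered inversions of a reduced word -/

section Sequences

/-- The product `f (k - 1) * ⋯ * f j`, equal to `1` if `k ≤ j`. -/
def prodIco {A : Type*} [Monoid A] (f : ℕ → A) (j : ℕ) : ℕ → A
  | 0 => 1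
  | k + 1 => if j ≤ k then f k * prodIco f j k else 1

theorem prodIco_succ {A : Type*} [Monoid A] (f : ℕ → A) {j k : ℕ} (h : j ≤ k) :
    prodIco f j (k + 1) = f k * prodIco f j k := if_pos h

@[simp] theorem prodIco_self {A : Type*} [Monoid A] (f : ℕ → A) (j : ℕ) : prodIco f j j = 1 := by
  cases j with
  | zero => rfl
  | succ j => exact if_neg (by omega)

theorem prodIco_congr {A : Type*} [Monoid A] {f g : ℕ → A} {j k : ℕ}
    (h : ∀ i < k, f i = g i) : prodIco f j k = prodIco g j k := by
  induction k with
  | zero => rfl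
  | succ k ih => rw [prodIco, prodIco, h k (by omega), ih fun i hi => h i (by omega)]

variable [Fintype ι] [P.IsRootSystem] [P.IsCrystallographic] [P.IsReduced] [P.IsIrreducible]
  {b : P.Base} {B : P.RootPositiveForm ℚ} {θ : ι}

/-- The inversions of a reduced word, in order. Each initial segment of the sequence is cut out,
among the positive affine roots, by a linear form. -/
theorem exists_inversion_sequence (hθ : IsLong B θ) (hdom : IsDominantRoot b θ) (m : ℕ)
    (js : List (Option b.support)) (h : len b (js.map (simpleRefl b θ)).prod = js.length) :
    IsIntegralElt (js.map (simpleRefl b θ)).prod ∧ ∃ β : ℕ → ι × ℤ,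
      Set.InjOn β (Set.Iio js.length) ∧
      (∀ a, a ∈ inversions b (js.map (simpleRefl b θ)).prod ↔ ∃ i < js.length, β i = a) ∧
      (∀ k ≤ js.length, ∃ ψ : M × ℚ →ₗ[ℚ] ℚ, (∀ a, ψ (affVec P a) ≠ 0) ∧
        ∀ a, AffPos b a → (ψ (affVec P a) < 0 ↔ ∃ i < k, β i = a)) ∧
      (js.map (demLus b θ m)).prod = weylOp m (js.map (simpleRefl b θ)).prod *
        prodIco (fun i => intertwiner m (β i)) 0 js.length := by
  induction js with
  | nil =>
    refine ⟨isIntegralElt_one, fun _ => (θ, 0), by simp [Set.InjOn], fun a => ?_, ?_, ?_⟩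
    · have := (inversions_eq_empty_iff b).1 (len_one (b := b))
      simp [this]
    · intro k hk
      refine ⟨affHeight b, fun a => ?_, fun a ha => ?_⟩
      · by_cases ha : AffPos b a
        · exact (affHeight_pos ha).ne'
        · exact (affHeight_neg ha).ne
      · have h0 : k = 0 := by simpa using hk
        have := affHeight_pos ha
        simp only [h0, Nat.not_lt_zero, false_and, exists_false, iff_false]
        linarith
    · simp [weylOp_one]
  | cons j js ih =>
    obtain ⟨h1, h2⟩ := reduced_cons hθ hdom h
    obtain ⟨hint, β, hinj, hmem, hψ, hprod⟩ := ih h1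
    set g := (js.map (simpleRefl b θ)).prod with hg
    -- The new letter on the left contributes the inversion `a₀`, placed at the end of the sequence.
    set a₀ := affAct g⁻¹ (simpleAff b θ j) with ha₀
    have hinv := inversions_simpleRefl_mul hθ hdom j g h2
    have hnot : a₀ ∉ inversions b g := by
      rintro ⟨-, h'⟩
      rw [ha₀, affAct_affAct_inv] at h'
      exact h' (affPos_simpleAff j)
    set β' : ℕ → ι × ℤ := fun i => if i < js.length then β i else a₀ with hβ'
    have hlt : ∀ i < js.length, β' i = β i := fun i hi => if_pos hi
    have hlast : β' js.length = a₀ := if_neg (lt_irrefl _)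
    have hex : ∀ k ≤ js.length, ∀ a, (∃ i < k, β' i = a) ↔ ∃ i < k, β i = a := by
      intro k hk a
      refine exists_congr fun i => and_congr_right fun hi => ?_
      rw [hlt i (by omega)]
    have hmem' : ∀ a, a ∈ inversions b (simpleRefl b θ j * g) ↔
        ∃ i < js.length + 1, β' i = a := by
      intro a
      rw [hinv, Set.mem_insert_iff, hmem, ← hex _ le_rfl]
      constructor
      · rintro (rfl | ⟨i, hi, hi'⟩)
        · exact ⟨_, Nat.lt_succ_self _, hlast⟩
        · exact ⟨i, by omega, hi'⟩
      · rintro ⟨i, hi, hi'⟩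
        rcases Nat.lt_succ_iff_lt_or_eq.1 hi with hi | rfl
        · exact Or.inr ⟨i, hi, hi'⟩
        · exact Or.inl (by rw [← hi', hlast])
    simp only [List.map_cons, List.prod_cons, List.length_cons, ← hg]
    refine ⟨(isIntegralElt_reflElt _).mul hint, β', ?_, hmem', ?_, ?_⟩
    · intro i hi i' hi' heq
      simp only [Set.mem_Iio] at hi hi'
      rcases Nat.lt_succ_iff_lt_or_eq.1 hi with hi | rfl <;>
        rcases Nat.lt_succ_iff_lt_or_eq.1 hi' with hi' | rfl
      · rw [hlt i hi, hlt i' hi'] at heq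
        exact hinj hi hi' heq
      · rw [hlt i hi, hlast] at heq
        exact absurd ((hmem a₀).2 ⟨i, hi, heq⟩) hnot
      · rw [hlt i' hi', hlast] at heq
        exact absurd ((hmem a₀).2 ⟨i', hi', heq.symm⟩) hnot
      · rfl
    · intro k hk
      rcases Nat.le_succ_iff.1 hk with hk | rfl
      · obtain ⟨ψ, h3, h4⟩ := hψ k hk
        exact ⟨ψ, h3, fun a ha => by rw [h4 a ha, hex k hk]⟩
      -- For the whole word the linear form is the affine height composed with the element itself;
      -- shorter segments inherit theirs.
      · have hval : ∀ a, (affHeight b ∘ₗ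
            ((simpleRefl b θ j * g : extAffWeyl P) : (M × ℚ) ≃ₗ[ℚ] (M × ℚ)).toLinearMap)
              (affVec P a) = affHeight b (affVec P (affAct (simpleRefl b θ j * g) a)) := by
          intro a
          rw [affVec_affAct]
          rfl
        refine ⟨affHeight b ∘ₗ
            ((simpleRefl b θ j * g : extAffWeyl P) : (M × ℚ) ≃ₗ[ℚ] (M × ℚ)).toLinearMap,
          fun a => ?_, fun a ha => ?_⟩
        · rw [hval]
          by_cases ha : AffPos b (affAct (simpleRefl b θ j * g) a)
          · exact (affHeight_pos ha).ne'
          · exact (affHeight_neg ha).ne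
        · rw [hval, ← hmem' a]
          constructor
          · intro h5
            refine ⟨ha, fun h6 => ?_⟩
            have := affHeight_pos h6
            linarith
          · exact fun h5 => affHeight_neg h5.2
    -- With `α_j = g a₀`, one has `T_j g = g T_{a₀} = (g s_{a₀}) (s_{a₀} T_{a₀})` and `g s_{a₀} =
    -- s_j g`.
    · have h3 : demLus b θ m j = demLusAt m (affAct g a₀) := by
        rw [ha₀, affAct_affAct_inv]
        rfl
      have h4 : simpleRefl b θ j * g = g * reflElt P a₀ := by
        rw [mul_reflElt, ha₀, affAct_affAct_inv]
        rfl
      have h5 : prodIco (fun i => intertwiner (P := P) m (β' i)) 0 js.length =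
          prodIco (fun i => intertwiner m (β i)) 0 js.length :=
        prodIco_congr fun i hi => by rw [hlt i hi]
      rw [hprod, prodIco_succ _ (Nat.zero_le _), hlast, h5, h4, h3,
        weylOp_mul m g (isIntegralElt_reflElt a₀), ← mul_assoc,
        demLusAt_affAct_mul_weylOp m hint a₀, demLusAt_eq, ← mul_assoc, ← mul_assoc]

end Sequences

/-! ### Convex orders on the roots pairing positively with the highest coroot -/

section ConvexOrder

variable [P.IsCrystallographic]

/-- The sequence `β 0, …, β (n - 1)` enumerates the roots pairing positively with the coroot of
`θ`, and each of its initial segments is cut out, among the positive roots, by a linear form. -/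
structure IsConvexOrder (b : P.Base) (θ : ι) (n : ℕ) (β : ℕ → ι) : Prop where
  injOn : Set.InjOn β (Set.Iio n)
  mem_iff : ∀ α, 0 < P.pairingIn ℤ α θ ↔ ∃ i < n, β i = α
  exists_form : ∀ k ≤ n, ∃ ψ : M →ₗ[ℚ] ℚ, (∀ α, ψ (P.root α) ≠ 0) ∧
    ∀ α, b.IsPos α → (ψ (P.root α) < 0 ↔ ∃ i < k, β i = α)

variable [Fintype ι]

section Inversions

variable [P.IsRootSystem] [P.IsReduced] [P.IsIrreducible]
  {b : P.Base} {B : P.RootPositiveForm ℚ} {θ : ι}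

/-- The translation lowers the coefficient of `δ` by `⟨α, θ^∨⟩`, so the inversions are the `α + n δ`
with `0 ≤ n < ⟨α, θ^∨⟩`; this pairing is at most `2`, with equality only for `θ`. -/
theorem mem_inversions_tau (hθ : IsLong B θ) (hdom : IsDominantRoot b θ) (a : ι × ℤ) :
    a ∈ inversions b (tau P (corootCowt P θ)) ↔
      (0 < P.pairingIn ℤ a.1 θ ∧ a.2 = 0) ∨ (a.1 = θ ∧ a.2 = 1) := by
  have hc := hθ.pairingIn_cases a.1
  have hpos : 0 < P.pairingIn ℤ a.1 θ → b.IsPos a.1 := fun h => hdom.isPos_of_pairingIn_pos h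
  have hneg : b.IsPos a.1 → 0 ≤ P.pairingIn ℤ a.1 θ := fun h => hdom.pairingIn_nonneg h
  have hself : a.1 = θ ↔ P.pairingIn ℤ a.1 θ = 2 := by
    refine ⟨fun h => by rw [h, P.pairingIn_same], fun h => ?_⟩
    rcases hc with h' | h' | h' | h' | h'
    · exact h'
    · rw [h', P.pairingIn_reflectionPerm_self_left, P.pairingIn_same] at h
      omega
    all_goals omega
  have hle : P.pairingIn ℤ a.1 θ ≤ 2 := by
    rcases hc with h' | h' | h' | h' | h'
    · exact (hself.1 h').le
    · rw [h', P.pairingIn_reflectionPerm_self_left, P.pairingIn_same]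
      omega
    all_goals omega
  rw [inversions, Set.mem_ofPred_eq, affAct_tau_corootCowt]
  simp only [AffPos, hself]
  by_cases h1 : b.IsPos a.1
  · have := hneg h1
    simp only [h1, true_and]
    omega
  · have : ¬ 0 < P.pairingIn ℤ a.1 θ := fun h => h1 (hpos h)
    simp only [h1, false_and, or_false]
    omega

/-- The point is that `θ + δ` is the last inversion, so that the rest of the sequence consists of
finite roots. -/
theorem exists_convexOrder (hθ : IsLong B θ) (hdom : IsDominantRoot b θ) {m : ℕ}
    {Y : Module.End Qqt (Poly P)} (hY : IsHeckeOp b θ m (tau P (corootCowt P θ)) Y) :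
    ∃ (n : ℕ) (β : ℕ → ι), IsConvexOrder b θ n β ∧ Y = weylOp m (tau P (corootCowt P θ)) *
      (intertwiner m (θ, 1) * prodIco (fun i => intertwiner m (β i, 0)) 0 n) := by
  obtain ⟨ω, js, hω, hw, hlen, rfl⟩ := hY
  set τ := tau P (corootCowt P θ) with hτ
  have hred : len b (js.map (simpleRefl b θ)).prod = js.length := by
    rw [← hlen, hw, len_mul_of_len_eq_zero hω]
  obtain ⟨hint, β, hinj, hmem, hψ, hprod⟩ := exists_inversion_sequence hθ hdom m js hred
  rw [← inversions_mul_of_len_eq_zero hω, ← hw] at hmem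
  simp only [hτ, mem_inversions_tau hθ hdom] at hmem
  obtain ⟨n, hn, hβn⟩ := (hmem (θ, 1)).1 (Or.inr ⟨rfl, rfl⟩)
  obtain ⟨ψ, hψ0, hψn⟩ := hψ (n + 1) hn
  have hlast : ψ (affVec P (θ, 1)) < 0 := (hψn _ (Or.inl Int.one_pos)).2 ⟨n, by omega, hβn⟩
  -- Write `θ + δ = α + (θ - α + δ)`, or `2θ + (-θ + δ)` if `α = θ`. The bracketed root is positive
  -- and not an inversion, so the form of the segment ending at `θ + δ` is nonnegative on it and
  -- must be negative on `α`.
  have hbefore : ∀ i < js.length, (β i).2 = 0 → i < n := by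
    intro i hi h0
    obtain ⟨α, hα⟩ : ∃ α, β i = (α, 0) := ⟨(β i).1, Prod.ext rfl h0⟩
    have hαU : 0 < P.pairingIn ℤ α θ := by
      have := (hmem (α, 0)).2 ⟨i, hi, hα⟩
      simpa using this
    have hneg : ψ (affVec P (α, 0)) < 0 := by
      by_cases hαθ : α = θ
      · have hnot : ¬ ψ (affVec P (P.reflectionPerm θ θ, 1)) < 0 := by
          rw [hψn _ (Or.inl Int.one_pos)]
          rintro ⟨k, hk, hk'⟩
          rcases (hmem _).2 ⟨k, by omega, hk'⟩ with h | h
          · exact one_ne_zero h.2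
          · have h1 : P.pairingIn ℤ (P.reflectionPerm θ θ) θ = 2 := by
              rw [show P.reflectionPerm θ θ = θ from h.1, P.pairingIn_same]
            rw [P.pairingIn_reflectionPerm_self_left, P.pairingIn_same] at h1
            omega
        have hsum : affVec P (θ, 1) =
            (2 : ℕ) • affVec P (α, 0) + affVec P (P.reflectionPerm θ θ, 1) := by
          rw [hαθ]
          ext
          · simp [affVec]; module
          · simp [affVec]
        rw [hsum, map_add, map_nsmul, nsmul_eq_mul] at hlast
        push_cast at hlast
        linarith
      · have hc : P.pairingIn ℤ α θ = 1 := by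
          rcases hθ.pairingIn_cases α with h | h | h | h | h
          · exact absurd h hαθ
          · rw [h, P.pairingIn_reflectionPerm_self_left, P.pairingIn_same] at hαU; omega
          · omega
          · exact h.1
          · omega
        set γ := P.reflectionPerm (P.reflectionPerm θ α) (P.reflectionPerm θ α) with hγ
        have hγroot : P.root γ = P.root θ - P.root α := by
          rw [hγ, P.root_reflectionPerm, P.reflection_apply_self, P.root_reflectionPerm,
            P.reflection_apply_root, ← cast_pairingIn, hc]
          simp
        have hnot : ¬ ψ (affVec P (γ, 1)) < 0 := by
          rw [hψn _ (Or.inl Int.one_pos)]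
          rintro ⟨k, hk, hk'⟩
          rcases (hmem _).2 ⟨k, by omega, hk'⟩ with h | h
          · exact one_ne_zero h.2
          · rw [show γ = θ from h.1] at hγroot
            exact P.ne_zero α (sub_eq_self.1 hγroot.symm)
        have hsum : affVec P (θ, 1) = affVec P (α, 0) + affVec P (γ, 1) := by
          ext
          · simp [affVec, hγroot]
          · simp [affVec]
        rw [hsum, map_add] at hlast
        linarith
    obtain ⟨k, hk, hk'⟩ := (hψn (α, 0) (Or.inr ⟨hdom.isPos_of_pairingIn_pos hαU, le_rfl⟩)).1 hneg
    have hik : i = k := hinj hi (show k < js.length by omega) (by rw [hα, hk'])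
    have hkn : k ≠ n := by
      rintro rfl
      rw [hk'] at hβn
      exact zero_ne_one (congrArg Prod.snd hβn)
    omega
  have hzero : ∀ i < n, β i = ((β i).1, 0) := by
    intro i hi
    refine Prod.ext rfl ?_
    rcases (hmem (β i)).2 ⟨i, by omega, rfl⟩ with h | h
    · exact h.2
    · have : β i = β n := by rw [hβn]; exact Prod.ext h.1 h.2
      exact absurd (hinj (show i < js.length by omega) hn this) (by omega)
  have hlength : js.length = n + 1 := by
    by_contra hne
    have h1 : n + 1 < js.length := by omega
    rcases (hmem (β (n + 1))).2 ⟨n + 1, h1, rfl⟩ with h | h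
    · have := hbefore (n + 1) h1 h.2
      omega
    · have : β (n + 1) = β n := by rw [hβn]; exact Prod.ext h.1 h.2
      exact absurd (hinj h1 hn this) (by omega)
  have hex : ∀ k ≤ n, ∀ α, (∃ i < k, β i = (α, 0)) ↔ ∃ i < k, (β i).1 = α := by
    intro k hk α
    refine exists_congr fun i => and_congr_right fun hi => ?_
    rw [hzero i (by omega), Prod.mk.injEq]
    simp
  refine ⟨n, fun i => (β i).1, ⟨?_, fun α => ?_, fun k hk => ?_⟩, ?_⟩
  · intro i hi i' hi' heq
    simp only [Set.mem_Iio] at hi hi'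
    refine hinj (show i < js.length by omega) (show i' < js.length by omega) ?_
    rw [hzero i hi, hzero i' hi']
    exact Prod.ext heq rfl
  · rw [← hex n le_rfl]
    have h1 := hmem (α, 0)
    simp only [and_true, zero_ne_one, and_false, or_false] at h1
    rw [h1]
    constructor
    · rintro ⟨i, hi, hi'⟩
      exact ⟨i, hbefore i hi (by rw [hi']), hi'⟩
    · rintro ⟨i, hi, hi'⟩
      exact ⟨i, by omega, hi'⟩
  · obtain ⟨ψ, h1, h2⟩ := hψ k (by omega)
    refine ⟨ψ ∘ₗ LinearMap.inl ℚ M ℚ, fun α => ?_, fun α hα => ?_⟩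
    · simpa [affVec] using h1 (α, 0)
    · rw [← hex k hk, ← h2 (α, 0) (Or.inr ⟨hα, le_rfl⟩)]
      simp [affVec]
  · have h5 : prodIco (fun i => intertwiner (P := P) m ((β i).1, 0)) 0 n =
        prodIco (fun i => intertwiner m (β i)) 0 n :=
      prodIco_congr fun i hi => by rw [hzero i hi]
    rw [hprod, h5, ← mul_assoc, ← weylOp_mul m ω hint, ← hw, hlength,
      prodIco_succ _ (Nat.zero_le _), hβn]

end Inversions

/-- The roots pairing positively with the coroot of `θ`. -/
def pairingPos (P : RootPairing ι ℚ M N) [P.IsCrystallographic] (θ : ι) : Finset ι :=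
  {α | 0 < P.pairingIn ℤ α θ}

@[simp] theorem mem_pairingPos {α θ : ι} : α ∈ pairingPos P θ ↔ 0 < P.pairingIn ℤ α θ := by
  simp [pairingPos]

/-- The position of a root in a sequence. -/
def position (β : ℕ → ι) (n : ℕ) (α : ι) : ℕ := Function.invFunOn β (Set.Iio n) α

namespace IsConvexOrder

variable {b : P.Base} {θ : ι} {n : ℕ} {β : ℕ → ι} (h : IsConvexOrder b θ n β)
include h

theorem pos_of_lt {i : ℕ} (hi : i < n) : 0 < P.pairingIn ℤ (β i) θ := (h.mem_iff _).2 ⟨i, hi, rfl⟩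

theorem position_lt {α : ι} (hα : 0 < P.pairingIn ℤ α θ) : position β n α < n :=
  Function.invFunOn_mem ((h.mem_iff α).1 hα)

theorem apply_position {α : ι} (hα : 0 < P.pairingIn ℤ α θ) : β (position β n α) = α :=
  Function.invFunOn_eq ((h.mem_iff α).1 hα)

theorem position_apply {i : ℕ} (hi : i < n) : position β n (β i) = i :=
  h.injOn (h.position_lt (h.pos_of_lt hi)) hi (h.apply_position (h.pos_of_lt hi))

theorem position_inj {α γ : ι} (hα : 0 < P.pairingIn ℤ α θ) (hγ : 0 < P.pairingIn ℤ γ θ)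
    (heq : position β n α = position β n γ) : α = γ := by
  rw [← h.apply_position hα, heq, h.apply_position hγ]

theorem exists_lt_iff {k : ℕ} (hk : k ≤ n) {α : ι} :
    (∃ i < k, β i = α) ↔ 0 < P.pairingIn ℤ α θ ∧ position β n α < k := by
  constructor
  · rintro ⟨i, hi, rfl⟩
    rw [h.position_apply (by omega)]
    exact ⟨h.pos_of_lt (by omega), hi⟩
  · rintro ⟨h1, h2⟩
    exact ⟨_, h2, h.apply_position h1⟩

/-- The form of the segment ending with `γ` is negative on `γ`, hence on `a` or on `c`, which then
belongs to that segment. -/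
theorem before_or_before {a c γ : ι} (hγ : 0 < P.pairingIn ℤ γ θ) (ha : b.IsPos a)
    (hc : b.IsPos c) (hγpos : b.IsPos γ) (hγa : a ≠ γ) (hγc : c ≠ γ) {k : ℕ}
    (hk : 0 < k) (hsum : k • P.root γ = P.root a + P.root c) :
    (0 < P.pairingIn ℤ a θ ∧ position β n a < position β n γ) ∨
      (0 < P.pairingIn ℤ c θ ∧ position β n c < position β n γ) := by
  have hlt := h.position_lt hγ
  obtain ⟨ψ, -, hψ⟩ := h.exists_form (position β n γ + 1) hlt
  have h1 : ψ (P.root γ) < 0 := (hψ γ hγpos).2 ⟨_, Nat.lt_succ_self _, h.apply_position hγ⟩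
  have h2 := congrArg ψ hsum
  rw [map_nsmul, map_add, nsmul_eq_mul] at h2
  have h3 : (k : ℚ) * ψ (P.root γ) < 0 := mul_neg_of_pos_of_neg (by exact_mod_cast hk) h1
  have key : ∀ a, b.IsPos a → a ≠ γ → ψ (P.root a) < 0 →
      0 < P.pairingIn ℤ a θ ∧ position β n a < position β n γ := by
    intro a ha hne h4
    rw [hψ a ha, h.exists_lt_iff hlt] at h4
    refine ⟨h4.1, lt_of_le_of_ne (Nat.lt_succ_iff.1 h4.2) fun h5 => hne (h.position_inj h4.1 hγ h5)⟩
  by_cases h4 : ψ (P.root a) < 0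
  · exact Or.inl (key a ha hγa h4)
  · exact Or.inr (key c hc hγc (by linarith))

/-- A root `c` orthogonal to `θ` does not occur in the sequence, so of the two summands it is `a`
that precedes `γ`. -/
theorem before_of_not_mem {a c γ : ι} (hγ : 0 < P.pairingIn ℤ γ θ) (ha : b.IsPos a)
    (hc : b.IsPos c) (hγpos : b.IsPos γ) (hγa : a ≠ γ) (hγc : c ≠ γ)
    (hsum : P.root γ = P.root a + P.root c) (hc0 : P.pairingIn ℤ c θ = 0) :
    position β n a < position β n γ := by
  rcases h.before_or_before hγ ha hc hγpos hγa hγc Nat.one_pos (by rwa [one_nsmul]) with h1 | h1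
  · exact h1.2
  · omega

/-- Same argument with the segment that stops just before `γ`: its form is positive on `γ`, and its
nonvanishing on roots excludes the value `0`. -/
theorem after_or_after {a c γ : ι} (hγ : 0 < P.pairingIn ℤ γ θ)
    (ha : 0 < P.pairingIn ℤ a θ) (hc : 0 < P.pairingIn ℤ c θ) (ha' : b.IsPos a)
    (hc' : b.IsPos c) (hγpos : b.IsPos γ) (hγa : a ≠ γ) (hγc : c ≠ γ) {k : ℕ}
    (hk : 0 < k) (hsum : k • P.root γ = P.root a + P.root c) :
    position β n γ < position β n a ∨ position β n γ < position β n c := by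
  have hlt := h.position_lt hγ
  obtain ⟨ψ, hψ0, hψ⟩ := h.exists_form (position β n γ) hlt.le
  have h1 : 0 < ψ (P.root γ) := by
    refine lt_of_le_of_ne (not_lt.1 fun h1 => ?_) (hψ0 γ).symm
    rw [hψ γ hγpos, h.exists_lt_iff hlt.le] at h1
    omega
  have h2 := congrArg ψ hsum
  rw [map_nsmul, map_add, nsmul_eq_mul] at h2
  have h3 : 0 < (k : ℚ) * ψ (P.root γ) := mul_pos (by exact_mod_cast hk) h1
  have key : ∀ a, b.IsPos a → 0 < P.pairingIn ℤ a θ → a ≠ γ → ¬ ψ (P.root a) < 0 →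
      position β n γ < position β n a := by
    intro a ha ha' hne h4
    rw [hψ a ha, h.exists_lt_iff hlt.le, not_and, not_lt] at h4
    exact lt_of_le_of_ne (h4 ha') fun h5 => hne (h.position_inj ha' hγ h5.symm)
  by_cases h4 : ψ (P.root a) < 0
  · exact Or.inr (key c hc' hc hγc (by linarith))
  · exact Or.inl (key a ha' ha hγa h4)

/-- If `a + c` is a positive multiple of `γ`, exactly one of `a` and `c` comes before `γ`. -/
theorem before_iff_not_before (hdom : IsDominantRoot b θ) {a c γ : ι}
    (hγ : 0 < P.pairingIn ℤ γ θ) (ha : 0 < P.pairingIn ℤ a θ) (hc : 0 < P.pairingIn ℤ c θ)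
    (hγa : a ≠ γ) (hγc : c ≠ γ) {k : ℕ} (hk : 0 < k)
    (hsum : k • P.root γ = P.root a + P.root c) :
    position β n a < position β n γ ↔ ¬ position β n c < position β n γ := by
  have h1 := h.before_or_before hγ (hdom.isPos_of_pairingIn_pos ha)
    (hdom.isPos_of_pairingIn_pos hc) (hdom.isPos_of_pairingIn_pos hγ) hγa hγc hk hsum
  have h2 := h.after_or_after hγ ha hc (hdom.isPos_of_pairingIn_pos ha)
    (hdom.isPos_of_pairingIn_pos hc) (hdom.isPos_of_pairingIn_pos hγ) hγa hγc hk hsum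
  omega

theorem sum_Ico_eq {A : Type*} [AddCommMonoid A] (f : ℕ → ι → A) (j : ℕ) {k : ℕ} (hk : k ≤ n) :
    ∑ i ∈ Finset.Ico j k, f i (β i) =
      ∑ α ∈ pairingPos P θ with j ≤ position β n α ∧ position β n α < k,
        f (position β n α) α := by
  refine Finset.sum_bij' (fun i _ => β i) (fun α _ => position β n α) ?_ ?_ ?_ ?_ ?_
  · intro i hi
    rw [Finset.mem_Ico] at hi
    rw [Finset.mem_filter, mem_pairingPos, h.position_apply (by omega)]
    exact ⟨h.pos_of_lt (by omega), hi⟩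
  · intro α hα
    rw [Finset.mem_filter] at hα
    exact Finset.mem_Ico.2 hα.2
  · intro i hi
    rw [Finset.mem_Ico] at hi
    exact h.position_apply (by omega)
  · intro α hα
    rw [Finset.mem_filter, mem_pairingPos] at hα
    exact h.apply_position hα.1
  · intro i hi
    rw [Finset.mem_Ico] at hi
    rw [h.position_apply (by omega)]

theorem card_pairingPos : (pairingPos P θ).card = n := by
  have h1 := h.sum_Ico_eq (fun _ _ => 1) 0 le_rfl
  rw [Finset.filter_true_of_mem] at h1
  · simpa using h1.symm
  · intro α hα
    exact ⟨Nat.zero_le _, h.position_lt (mem_pairingPos.1 hα)⟩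

end IsConvexOrder

end ConvexOrder

/-! ### Products of almost diagonal operators and a geometric sum -/

section Branching

variable {K V : Type*} [Field K] [AddCommGroup V] [Module K V]

/-- The image of a vector under a product of operators, each of which multiplies it by a power of
`t` up to an error term. -/
theorem prodIco_apply_eq {t : K} (ht : t ≠ 0) {f : ℕ → Module.End K V} {v : V} {e : ℕ → ℤ}
    {x : ℕ → V} {j k : ℕ} (hjk : j ≤ k)
    (hf : ∀ i, j ≤ i → i < k → f i v = t ^ e i • v + x i) :
    prodIco f j k v = t ^ (∑ i ∈ Finset.Ico j k, e i) • v +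
      ∑ i ∈ Finset.Ico j k, t ^ (∑ l ∈ Finset.Ico j i, e l) • prodIco f (i + 1) k (x i) := by
  induction k, hjk using Nat.le_induction with
  | base => simp
  | succ k hjk ih =>
    rw [prodIco_succ _ hjk, Module.End.mul_apply, ih fun i h1 h2 => hf i h1 (by omega),
      map_add, map_smul, map_sum, hf k hjk (by omega), Finset.sum_Ico_succ_top hjk,
      Finset.sum_Ico_succ_top hjk, zpow_add₀ ht, prodIco_self, Module.End.one_apply, smul_add,
      smul_smul, add_assoc]
    congr 1
    rw [add_comm]
    congr 1
    refine Finset.sum_congr rfl fun i hi => ?_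
    rw [Finset.mem_Ico] at hi
    rw [map_smul, prodIco_succ f (show i + 1 ≤ k by omega), Module.End.mul_apply]

theorem prodIco_apply_of_smul {t : K} (ht : t ≠ 0) {f : ℕ → Module.End K V} {v : V} {e : ℕ → ℤ}
    {j k : ℕ} (hjk : j ≤ k) (hf : ∀ i, j ≤ i → i < k → f i v = t ^ e i • v) :
    prodIco f j k v = t ^ (∑ i ∈ Finset.Ico j k, e i) • v := by
  rw [prodIco_apply_eq ht (x := fun _ => 0) hjk fun i h1 h2 => by rw [hf i h1 h2, add_zero]]
  simp

/-- Since `(t - t⁻¹) t^k = t^(k+1) - t^(k-1)` and the exponents advance by `2`, the sum telescopes.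
-/
theorem geom_sum_sub_inv {t : K} (ht : t ≠ 0) (c : ℤ) (s : ℕ) :
    (t - t⁻¹) * ∑ w ∈ Finset.range s, t ^ (2 * (w : ℤ) + c) =
      t ^ (2 * (s : ℤ) + c - 1) - t ^ (c - 1) := by
  induction s with
  | zero => simp
  | succ s ih =>
    rw [Finset.sum_range_succ, mul_add, ih]
    have h1 : t ^ (2 * (s : ℤ) + c) = t ^ (2 * (s : ℤ) + c - 1) * t := by
      rw [← zpow_add_one₀ ht]; congr 1; ring
    have h2 : t ^ (2 * ((s + 1 : ℕ) : ℤ) + c - 1) = t ^ (2 * (s : ℤ) + c - 1) * t * t := by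
      rw [← zpow_add_one₀ ht, ← zpow_add_one₀ ht]; congr 1; push_cast; ring
    rw [h1, h2]
    field_simp
    ring

end Branching

/-! ### Two counting principles for finite sets -/

section Counting

/-- Summing over the elements of a finite set of naturals a function of the number of larger
elements. -/
theorem sum_card_gt {A : Type*} [AddCommMonoid A] (f : ℕ → A) (s : Finset ℕ) :
    ∑ x ∈ s, f (s.filter (x < ·)).card = ∑ w ∈ Finset.range s.card, f w := by
  induction s using Finset.induction_on_min with
  | empty => simp
  | insert a s hlt ih =>
    have ha : a ∉ s := fun h => lt_irrefl _ (hlt a h)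
    rw [Finset.sum_insert ha, Finset.card_insert_of_notMem ha, Finset.sum_range_succ, ← ih,
      add_comm]
    congr 1
    · refine Finset.sum_congr rfl fun x hx => ?_
      rw [Finset.filter_insert, if_neg (by have := hlt x hx; omega)]
    · rw [Finset.filter_insert, if_neg (lt_irrefl _), Finset.filter_true_of_mem hlt]

/-- If an involution of a finite set exchanges the elements with some property and the other ones,
then half of the elements have the property. -/
theorem two_mul_card_filter_of_involution {A : Type*} {s : Finset A} (p : A → Prop)
    [DecidablePred p] (σ : A → A) (hs : ∀ x ∈ s, σ x ∈ s) (hσ : ∀ x ∈ s, σ (σ x) = x)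
    (hp : ∀ x ∈ s, p x ↔ ¬ p (σ x)) : 2 * (s.filter p).card = s.card := by
  rw [← Finset.card_filter_add_card_filter_not (s := s) p, two_mul]
  congr 1
  refine Finset.card_bij' (fun x _ => σ x) (fun x _ => σ x) ?_ ?_ ?_ ?_
  · intro x hx
    rw [Finset.mem_filter] at hx ⊢
    exact ⟨hs x hx.1, (hp x hx.1).1 hx.2⟩
  · intro x hx
    rw [Finset.mem_filter] at hx ⊢
    refine ⟨hs x hx.1, ?_⟩
    by_contra h
    exact hx.2 ((hp x hx.1).2 h)
  · intro x hx
    exact hσ x (Finset.mem_filter.1 hx).1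
  · intro x hx
    exact hσ x (Finset.mem_filter.1 hx).1

end Counting

/-! ### Relations between short roots and the highest root outside type `G₂` -/

section ShortRoots

variable [P.IsCrystallographic]

/-- The index of the root `⟨α, γ^∨⟩ γ - α`, the opposite of the reflection of `α` in `γ`. -/
def antiRefl (P : RootPairing ι ℚ M N) (γ α : ι) : ι := P.reflectionPerm γ (P.reflectionPerm α α)

theorem root_antiRefl (γ α : ι) :
    P.root (antiRefl P γ α) = P.pairingIn ℤ α γ • P.root γ - P.root α := by
  rw [antiRefl, P.root_reflectionPerm, P.root_reflectionPerm, P.reflection_apply_self, map_neg,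
    P.reflection_apply_root, ← cast_pairingIn, Int.cast_smul_eq_zsmul, neg_sub]

theorem pairingIn_eq_of_root_eq {γ α δ : ι} {j k : ℤ}
    (h : P.root δ = j • P.root γ + k • P.root α) (κ : ι) :
    P.pairingIn ℤ δ κ = j * P.pairingIn ℤ γ κ + k * P.pairingIn ℤ α κ := by
  have h1 := congrArg (P.coroot' κ) h
  rw [map_add, map_zsmul, map_zsmul] at h1
  simp only [P.root_coroot'_eq_pairing, ← cast_pairingIn, zsmul_eq_mul] at h1
  exact_mod_cast h1

theorem pairingIn_antiRefl (γ α κ : ι) : P.pairingIn ℤ (antiRefl P γ α) κ =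
    P.pairingIn ℤ α γ * P.pairingIn ℤ γ κ - P.pairingIn ℤ α κ := by
  rw [pairingIn_eq_of_root_eq (j := P.pairingIn ℤ α γ) (k := -1) (γ := γ) (α := α)]
  · ring
  · rw [root_antiRefl]; module

theorem pairingIn_antiRefl_same (γ α : ι) :
    P.pairingIn ℤ (antiRefl P γ α) γ = P.pairingIn ℤ α γ := by
  rw [pairingIn_antiRefl, P.pairingIn_same]; ring

theorem antiRefl_antiRefl (γ α : ι) : antiRefl P γ (antiRefl P γ α) = α := by
  apply P.root.injective
  rw [root_antiRefl, pairingIn_antiRefl_same, root_antiRefl]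
  abel

variable [Fintype ι] [P.IsReduced] {b : P.Base} {B : P.RootPositiveForm ℚ} {θ : ι}

theorem isLong_antiRefl_iff {γ α : ι} : IsLong B (antiRefl P γ α) ↔ IsLong B α := by
  rw [antiRefl, isLong_reflectionPerm_iff, isLong_reflectionPerm_iff]

theorem IsLong.eq_of_pairingIn_eq_two (hθ : IsLong B θ) {i : ι} (h : P.pairingIn ℤ i θ = 2) :
    i = θ := by
  rcases hθ.pairingIn_cases i with h1 | rfl | h1 | h1 | h1
  · exact h1
  · rw [P.pairingIn_reflectionPerm_self_left, P.pairingIn_same] at h; omega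
  all_goals omega

theorem IsLong.pairingIn_pos_cases (hθ : IsLong B θ) {i : ι} (h : 0 < P.pairingIn ℤ i θ) :
    i = θ ∨ P.pairingIn ℤ i θ = 1 := by
  rcases hθ.pairingIn_cases i with h1 | rfl | h1 | h1 | h1
  · exact Or.inl h1
  · rw [P.pairingIn_reflectionPerm_self_left, P.pairingIn_same] at h; omega
  all_goals omega

theorem IsLong.pairingIn_comm {i j : ι} (hi : IsLong B i) (hj : IsLong B j) :
    P.pairingIn ℤ i j = P.pairingIn ℤ j i := by
  have h := pairingIn_mul_form_swap B i j
  rw [hi.form_eq hj] at h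
  exact_mod_cast mul_right_cancel₀ (form_self_pos B j).ne' h

theorem IsLong.pairingIn_eq_one (hθ : IsLong B θ) {γ : ι} (hγ : IsLong B γ)
    (h : P.pairingIn ℤ γ θ = 1) : P.pairingIn ℤ θ γ = 1 := by
  rw [hθ.pairingIn_comm hγ, h]

section NotG2

variable [P.IsIrreducible] (hG : ¬ P.IsG2) (hθ : IsLong B θ)
include hG hθ

theorem form_eq_of_not_isLong {α γ : ι} (hα : ¬ IsLong B α) (hγ : ¬ IsLong B γ) :
    B.form (P.root α) (P.root α) = B.form (P.root γ) (P.root γ) := by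
  have h1 := hθ.form_eq_two_mul hG hα
  have h2 := hθ.form_eq_two_mul hG hγ
  linarith

theorem pairingIn_comm_of_not_isLong {α γ : ι} (hα : ¬ IsLong B α) (hγ : ¬ IsLong B γ) :
    P.pairingIn ℤ α γ = P.pairingIn ℤ γ α := by
  have h := pairingIn_mul_form_swap B α γ
  rw [form_eq_of_not_isLong hG hθ hα hγ] at h
  exact_mod_cast mul_right_cancel₀ (form_self_pos B γ).ne' h

theorem pairingIn_eq_two_of_not_isLong {γ : ι} (hγ : ¬ IsLong B γ)
    (h : P.pairingIn ℤ γ θ = 1) : P.pairingIn ℤ θ γ = 2 := by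
  have h1 := pairingIn_mul_form_swap B γ θ
  rw [hθ.form_eq_two_mul hG hγ, h] at h1
  have h2 : (2 : ℚ) = P.pairingIn ℤ θ γ :=
    mul_right_cancel₀ (form_self_pos B γ).ne' (by push_cast at h1; linarith)
  exact_mod_cast h2.symm

theorem pairingIn_short_long {α γ : ι} (hα : ¬ IsLong B α) (hγ : IsLong B γ) :
    P.pairingIn ℤ γ α = 2 * P.pairingIn ℤ α γ := by
  have h1 := pairingIn_mul_form_swap B γ α
  rw [hγ.form_eq_two_mul hG hα] at h1
  have h2 : (P.pairingIn ℤ γ α : ℚ) = 2 * P.pairingIn ℤ α γ :=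
    mul_right_cancel₀ (form_self_pos B α).ne' (by linarith)
  exact_mod_cast h2

/-- A short root pairing to `1` with `θ` pairs to `0` or `1` with the other roots of this kind. -/
theorem pairingIn_eq_zero_or_one {α γ : ι} (hα : ¬ IsLong B α) (hα1 : P.pairingIn ℤ α θ = 1)
    (hγ : 0 < P.pairingIn ℤ γ θ) (hne : γ ≠ α) :
    P.pairingIn ℤ α γ = 0 ∨ P.pairingIn ℤ α γ = 1 := by
  rcases hθ.pairingIn_pos_cases hγ with rfl | hγ1
  · exact Or.inr hα1
  have h0 : 0 ≤ P.pairingIn ℤ α γ := by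
    by_contra h0
    -- With a negative pairing `α + γ` would be a root pairing to `2` with `θ^∨`, hence equal to
    -- `θ`; but `⟨θ, α^∨⟩ = 2` then forces `⟨γ, α^∨⟩ = 0`.
    obtain ⟨i, hi⟩ : P.root α + P.root γ ∈ Set.range P.root :=
      P.root_add_root_mem_of_pairingIn_neg (by omega) fun h => by
        have h1 := pairingIn_eq_of_root_eq (j := -1) (k := 0) (γ := γ) (α := γ) (δ := α)
          (by rw [h]; module) θ
        omega
    have hi' : P.root i = (1 : ℤ) • P.root α + (1 : ℤ) • P.root γ := by rw [hi]; module
    have h1 := pairingIn_eq_of_root_eq hi' θ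
    have h2 := hθ.eq_of_pairingIn_eq_two (i := i) (by omega)
    subst h2
    have h3 := pairingIn_eq_of_root_eq hi' α
    rw [pairingIn_eq_two_of_not_isLong hG hθ hα hα1, P.pairingIn_same] at h3
    have h4 : P.pairingIn ℤ γ α = 0 := by omega
    rw [P.pairingIn_eq_zero_iff] at h4
    omega
  by_cases hγl : IsLong B γ
  · rcases hγl.pairingIn_cases α with rfl | rfl | h | h | h
    · exact absurd rfl hne
    · rw [isLong_reflectionPerm_iff] at hα; exact absurd hγl hα
    all_goals omega
  · have h1 := pairingIn_comm_of_not_isLong hG hθ hα hγl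
    have h2 := P.pairingIn_pairingIn_mem_set_of_isCrystal_of_isRed' α γ (fun h => hne (P.root.injective h).symm) (fun h => by
      have h3 := pairingIn_eq_of_root_eq (j := -1) (k := 0) (γ := γ) (α := γ) (δ := α)
        (by rw [h]; module) θ
      omega)
    simp only [Set.mem_insert_iff, Set.mem_singleton_iff, Prod.mk.injEq] at h2
    omega

/-- The only short root orthogonal to `α`, among those that pair to `1` with `θ`, is `θ - α`. -/
theorem pairingIn_eq_zero_iff_eq_antiRefl {α γ : ι} (hα : ¬ IsLong B α)
    (hα1 : P.pairingIn ℤ α θ = 1) (hγ : ¬ IsLong B γ) (hγ1 : P.pairingIn ℤ γ θ = 1) :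
    P.pairingIn ℤ α γ = 0 ↔ γ = antiRefl P θ α := by
  have h2α := pairingIn_eq_two_of_not_isLong hG hθ hα hα1
  constructor
  · intro h0
    have h2γ := pairingIn_eq_two_of_not_isLong hG hθ hγ hγ1
    -- Reflecting `θ` in the orthogonal roots `α` and `γ` gives `θ - 2α - 2γ`. It pairs to `-2` with
    -- `θ^∨`, so it is `-θ`, whence `γ = θ - α`.
    set i := antiRefl P γ (antiRefl P α θ) with hi
    have h1 : P.pairingIn ℤ (antiRefl P α θ) γ = -2 := by
      rw [pairingIn_antiRefl, h0, h2γ]; ring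
    have h3 : P.root i = P.root θ - (2 : ℤ) • P.root α - (2 : ℤ) • P.root γ := by
      rw [hi, root_antiRefl, h1, root_antiRefl, h2α]; module
    have h4 : P.pairingIn ℤ (P.reflectionPerm i i) θ = 2 := by
      rw [P.pairingIn_reflectionPerm_self_left, hi, pairingIn_antiRefl, h1, hγ1,
        pairingIn_antiRefl, h2α, hα1, P.pairingIn_same]
      norm_num
    have h5 := hθ.eq_of_pairingIn_eq_two h4
    have h6 : P.root θ = -P.root i := by
      conv_lhs => rw [← h5]
      rw [P.root_reflectionPerm, P.reflection_apply_self]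
    apply P.root.injective
    rw [root_antiRefl, hα1]
    rw [h3] at h6
    have h7 : (2 : ℚ) • P.root γ = (2 : ℚ) • ((1 : ℤ) • P.root θ - P.root α) := by
      have : P.root θ + (P.root θ - (2 : ℤ) • P.root α - (2 : ℤ) • P.root γ) = 0 := by
        nth_rewrite 1 [h6]; abel
      have h8 : (2 : ℚ) • ((1 : ℤ) • P.root θ - P.root α) - (2 : ℚ) • P.root γ =
        P.root θ + (P.root θ - (2 : ℤ) • P.root α - (2 : ℤ) • P.root γ) := by module
      exact (sub_eq_zero.1 (h8.trans this)).symm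
    exact smul_right_injective M (two_ne_zero) h7
  · rintro rfl
    rw [pairingIn_comm_of_not_isLong hG hθ hα hγ, pairingIn_antiRefl, hα1, h2α, P.pairingIn_same]
    norm_num

end NotG2

end ShortRoots

/-! ### Counting roots before a given root in a convex order -/

section Counts

variable [Fintype ι] [P.IsCrystallographic]

open Classical in
/-- The long roots whose pairing with the coroot of `θ` is `1`. -/
def longOne (B : P.RootPositiveForm ℚ) (θ : ι) : Finset ι := (pairingOne P θ).filter (IsLong B)

open Classical in
/-- The short roots whose pairing with the coroot of `θ` is `1`. -/
def shortOne (B : P.RootPositiveForm ℚ) (θ : ι) : Finset ι :=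
  (pairingOne P θ).filter fun α => ¬ IsLong B α

variable [P.IsReduced] {b : P.Base} {B : P.RootPositiveForm ℚ} {θ : ι}

@[simp] theorem mem_longOne {α : ι} :
    α ∈ longOne B θ ↔ P.pairingIn ℤ α θ = 1 ∧ IsLong B α := by
  simp [longOne]

@[simp] theorem mem_shortOne {α : ι} :
    α ∈ shortOne B θ ↔ P.pairingIn ℤ α θ = 1 ∧ ¬ IsLong B α := by
  simp [shortOne]

theorem antiRefl_mem_shortOne {α : ι} (hα : α ∈ shortOne B θ) :
    antiRefl P θ α ∈ shortOne B θ := by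
  rw [mem_shortOne] at hα ⊢
  rwa [pairingIn_antiRefl_same, isLong_antiRefl_iff]

theorem antiRefl_mem_longOne {α : ι} (hα : α ∈ longOne B θ) :
    antiRefl P θ α ∈ longOne B θ := by
  rw [mem_longOne] at hα ⊢
  rwa [pairingIn_antiRefl_same, isLong_antiRefl_iff]

theorem IsLong.sum_pairingPos (hθ : IsLong B θ) {A : Type*} [AddCommMonoid A] (f : ι → A) :
    ∑ α ∈ pairingPos P θ, f α =
      f θ + (∑ α ∈ longOne B θ, f α + ∑ α ∈ shortOne B θ, f α) := by
  classical
  have hU : pairingPos P θ = insert θ (longOne B θ ∪ shortOne B θ) := by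
    ext α
    simp only [mem_pairingPos, Finset.mem_insert, Finset.mem_union, mem_longOne, mem_shortOne]
    constructor
    · intro h
      rcases hθ.pairingIn_pos_cases h with h | h
      · exact Or.inl h
      · by_cases hl : IsLong B α
        · exact Or.inr (Or.inl ⟨h, hl⟩)
        · exact Or.inr (Or.inr ⟨h, hl⟩)
    · rintro (rfl | h | h)
      · simp
      all_goals omega
  have hdisj : Disjoint (longOne B θ) (shortOne B θ) := by
    rw [Finset.disjoint_left]
    intro α h1 h2
    exact (mem_shortOne.1 h2).2 (mem_longOne.1 h1).2
  rw [hU, Finset.sum_insert (by simp), Finset.sum_union hdisj]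

theorem IsLong.card_filter_pairingPos (hθ : IsLong B θ) (p : ι → Prop) [DecidablePred p] :
    ((pairingPos P θ).filter p).card =
      (if p θ then 1 else 0) + ((longOne B θ).filter p).card + ((shortOne B θ).filter p).card := by
  rw [Finset.card_filter, Finset.card_filter, Finset.card_filter, hθ.sum_pairingPos (B := B),
    add_assoc]

theorem root_add_root_antiRefl (γ α : ι) :
    P.pairingIn ℤ α γ • P.root γ = P.root α + P.root (antiRefl P γ α) := by
  rw [root_antiRefl]; abel

variable {n : ℕ} {β : ℕ → ι}

theorem IsConvexOrder.card_before (h : IsConvexOrder b θ n β) {k : ℕ} (hk : k ≤ n) :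
    ((pairingPos P θ).filter fun γ => position β n γ < k).card = k := by
  have h1 := h.sum_Ico_eq (fun _ _ => 1) 0 hk
  simpa using h1.symm

variable (h : IsConvexOrder b θ n β) (hθ : IsLong B θ) (hdom : IsDominantRoot b θ)

include hθ in
theorem ne_of_mem_shortOne {α : ι} (hα : α ∈ shortOne B θ) : θ ≠ α := by
  rintro rfl
  exact (mem_shortOne.1 hα).2 hθ

include h hdom in
/-- Reflecting in `θ` reverses the order with respect to `θ`. -/
theorem IsConvexOrder.before_top_iff {α : ι} (hα : P.pairingIn ℤ α θ = 1) :
    position β n α < position β n θ ↔ ¬ position β n (antiRefl P θ α) < position β n θ := by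
  have h1 := pairingIn_antiRefl_same (P := P) θ α
  refine h.before_iff_not_before hdom (by simp) (by omega) (by omega) ?_ ?_ Nat.one_pos ?_
  · rintro rfl; simp at hα
  · intro h2; rw [h2, P.pairingIn_same] at h1; omega
  · rw [← root_add_root_antiRefl, hα]; simp

include h hdom hθ in
-- The involution `γ ↦ θ - γ` exchanges the roots before `θ` with those after it, so `θ` stands in
-- the middle.
theorem IsConvexOrder.two_mul_position_top : 2 * position β n θ + 1 = n := by
  have h1 := hθ.card_filter_pairingPos (B := B) fun γ => position β n γ < position β n θ
  rw [h.card_before (h.position_lt (by simp)).le, if_neg (lt_irrefl _)] at h1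
  have h2 := hθ.card_filter_pairingPos (B := B) fun _ => True
  simp only [Finset.filter_true, if_true] at h2
  rw [h.card_pairingPos] at h2
  have h3 := two_mul_card_filter_of_involution (s := longOne B θ)
    (fun γ => position β n γ < position β n θ) (antiRefl P θ) (fun _ => antiRefl_mem_longOne)
    (fun α _ => antiRefl_antiRefl θ α) fun α hα => h.before_top_iff hdom (mem_longOne.1 hα).1
  have h4 := two_mul_card_filter_of_involution (s := shortOne B θ)
    (fun γ => position β n γ < position β n θ) (antiRefl P θ) (fun _ => antiRefl_mem_shortOne)
    (fun α _ => antiRefl_antiRefl θ α) fun α hα => h.before_top_iff hdom (mem_shortOne.1 hα).1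
  omega

include h hdom in
theorem IsConvexOrder.two_mul_card_shortOne_after :
    2 * ((shortOne B θ).filter fun α => position β n θ < position β n α).card =
      (shortOne B θ).card := by
  refine two_mul_card_filter_of_involution _ (antiRefl P θ) (fun _ => antiRefl_mem_shortOne)
    (fun α _ => antiRefl_antiRefl θ α) fun α hα => ?_
  rw [mem_shortOne] at hα
  have h1 := h.before_top_iff hdom hα.1
  have h3 := pairingIn_antiRefl_same (P := P) θ α
  have h2 : ∀ γ, P.pairingIn ℤ γ θ = 1 → position β n γ ≠ position β n θ := by
    intro γ hγ heq
    have := h.position_inj (by omega) (by simp) heq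
    rw [this, P.pairingIn_same] at hγ
    omega
  have h4 := h2 α hα.1
  have h5 := h2 _ (h3.trans hα.1)
  omega

variable [P.IsIrreducible] (hG : ¬ P.IsG2)

include hG hθ in
-- The pairing with the coroot of `θ - γ` is not visibly linear in `γ`; doubling it gives the
-- pairing of `θ - γ` with `α^∨`, which is.
theorem pairingIn_antiRefl_long {α γ : ι} (hα : α ∈ shortOne B θ) (hγ : γ ∈ longOne B θ) :
    P.pairingIn ℤ α (antiRefl P θ γ) = 1 - P.pairingIn ℤ α γ := by
  have hγ' := antiRefl_mem_longOne hγ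
  rw [mem_shortOne] at hα
  rw [mem_longOne] at hγ hγ'
  have h1 := pairingIn_short_long hG hθ hα.2 hγ.2
  have h2 := pairingIn_short_long hG hθ hα.2 hγ'.2
  rw [pairingIn_antiRefl, hγ.1, pairingIn_eq_two_of_not_isLong hG hθ hα.2 hα.1] at h2
  omega

include hG hθ in
theorem pairingIn_longOne {α γ : ι} (hα : α ∈ shortOne B θ) (hγ : γ ∈ longOne B θ) :
    P.pairingIn ℤ α γ = 0 ∨ P.pairingIn ℤ α γ = 1 := by
  rw [mem_shortOne] at hα
  rw [mem_longOne] at hγ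
  refine pairingIn_eq_zero_or_one hG hθ hα.2 hα.1 (by omega) ?_
  rintro rfl
  exact hα.2 hγ.2

include hG hθ in
theorem two_mul_card_longOne_orthogonal {α : ι} (hα : α ∈ shortOne B θ) :
    2 * ((longOne B θ).filter fun γ => P.pairingIn ℤ α γ = 0).card = (longOne B θ).card := by
  refine two_mul_card_filter_of_involution _ (antiRefl P θ) (fun _ => antiRefl_mem_longOne)
    (fun γ _ => antiRefl_antiRefl θ γ) fun γ hγ => ?_
  rw [pairingIn_antiRefl_long hθ hG hα hγ]
  have := pairingIn_longOne hθ hG hα hγ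
  omega

include hG hθ in
theorem two_mul_card_longOne_not_orthogonal {α : ι} (hα : α ∈ shortOne B θ) :
    2 * ((longOne B θ).filter fun γ => P.pairingIn ℤ α γ ≠ 0).card = (longOne B θ).card := by
  have h1 := two_mul_card_longOne_orthogonal hθ hG hα
  have h2 := Finset.card_filter_add_card_filter_not (s := longOne B θ)
    (fun γ => P.pairingIn ℤ α γ = 0)
  simp only [ne_eq]
  omega

include hG hθ in
theorem filter_shortOne_orthogonal {α : ι} (hα : α ∈ shortOne B θ) :
    ((shortOne B θ).filter fun γ => P.pairingIn ℤ α γ = 0) = {antiRefl P θ α} := by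
  have hα' := antiRefl_mem_shortOne hα
  ext γ
  rw [Finset.mem_filter, Finset.mem_singleton]
  constructor
  · rintro ⟨h1, h2⟩
    rw [mem_shortOne] at hα h1
    exact (pairingIn_eq_zero_iff_eq_antiRefl hG hθ hα.2 hα.1 h1.2 h1.1).1 h2
  · rintro rfl
    refine ⟨hα', ?_⟩
    rw [mem_shortOne] at hα hα'
    exact (pairingIn_eq_zero_iff_eq_antiRefl hG hθ hα.2 hα.1 hα'.2 hα'.1).2 rfl

include hG hθ in
/-- The number of roots of `pairingPos P θ` orthogonal to a short one. -/
theorem card_orthogonal {α : ι} (hα : α ∈ shortOne B θ) :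
    2 * ((pairingPos P θ).filter fun γ => P.pairingIn ℤ α γ = 0).card =
      (longOne B θ).card + 2 := by
  have h0 : P.pairingIn ℤ α θ ≠ 0 := by rw [(mem_shortOne.1 hα).1]; norm_num
  rw [hθ.card_filter_pairingPos (B := B), if_neg h0, filter_shortOne_orthogonal hθ hG hα,
    Finset.card_singleton]
  have := two_mul_card_longOne_orthogonal hθ hG hα
  omega

include hG hθ in
theorem pairingIn_short_eq_zero_iff {α γ : ι} (hα : α ∈ shortOne B θ) (hγ : γ ∈ shortOne B θ) :
    P.pairingIn ℤ α γ = 0 ↔ γ = antiRefl P θ α := by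
  rw [mem_shortOne] at hα hγ
  exact pairingIn_eq_zero_iff_eq_antiRefl hG hθ hα.2 hα.1 hγ.2 hγ.1

include h hθ hdom hG in
/-- For a short root `κ`, the long roots that are not orthogonal to `κ` are exchanged by the
reflection in `κ`, which reverses the order with respect to `κ`. -/
theorem IsConvexOrder.two_mul_card_longOne_before {κ : ι} (hκ : κ ∈ shortOne B θ) :
    2 * (((longOne B θ).filter fun γ => P.pairingIn ℤ κ γ ≠ 0).filter
        fun γ => position β n γ < position β n κ).card =
      ((longOne B θ).filter fun γ => P.pairingIn ℤ κ γ ≠ 0).card := by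
  have hκ' := mem_shortOne.1 hκ
  have key : ∀ γ ∈ (longOne B θ).filter (fun γ => P.pairingIn ℤ κ γ ≠ 0),
      γ ∈ longOne B θ ∧ P.pairingIn ℤ γ κ = 2 := by
    intro γ hγ
    rw [Finset.mem_filter] at hγ
    have h1 := pairingIn_longOne hθ hG hκ hγ.1
    have h2 := pairingIn_short_long hG hθ hκ'.2 (mem_longOne.1 hγ.1).2
    exact ⟨hγ.1, by omega⟩
  have key2 : ∀ γ ∈ (longOne B θ).filter (fun γ => P.pairingIn ℤ κ γ ≠ 0),
      antiRefl P κ γ ∈ longOne B θ := by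
    intro γ hγ
    obtain ⟨h1, h2⟩ := key γ hγ
    rw [mem_longOne] at h1 ⊢
    rw [isLong_antiRefl_iff, pairingIn_antiRefl, h2, h1.1, hκ'.1]
    exact ⟨by norm_num, h1.2⟩
  refine two_mul_card_filter_of_involution _ (antiRefl P κ) (fun γ hγ => ?_)
    (fun γ _ => antiRefl_antiRefl κ γ) fun γ hγ => ?_
  · rw [Finset.mem_filter]
    refine ⟨key2 γ hγ, fun h0 => ?_⟩
    have h1 := pairingIn_antiRefl_same (P := P) κ γ
    rw [(key γ hγ).2, pairingIn_short_long hG hθ hκ'.2 (mem_longOne.1 (key2 γ hγ)).2, h0] at h1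
    omega
  · obtain ⟨h1, h2⟩ := key γ hγ
    have h3 := mem_longOne.1 (key2 γ hγ)
    rw [mem_longOne] at h1
    refine h.before_iff_not_before hdom (by omega) (by omega) (by omega) ?_ ?_ two_pos ?_
    · rintro rfl; exact hκ'.2 h1.2
    · intro h4; rw [h4] at h3; exact hκ'.2 h3.2
    · rw [← root_add_root_antiRefl, h2]
      exact (natCast_zsmul _ 2).symm

include h hθ hdom hG in
/-- The number of roots orthogonal to the short root `α` that come before `θ - α`. -/
theorem IsConvexOrder.card_orthogonal_before_antiRefl {α : ι} (hα : α ∈ shortOne B θ) :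
    4 * ((pairingPos P θ).filter fun γ => position β n γ < position β n (antiRefl P θ α) ∧
      P.pairingIn ℤ α γ = 0).card = (longOne B θ).card := by
  have hκ := antiRefl_mem_shortOne hα
  have h0 : P.pairingIn ℤ α θ ≠ 0 := by rw [(mem_shortOne.1 hα).1]; norm_num
  have h1 : ((shortOne B θ).filter fun γ => position β n γ < position β n (antiRefl P θ α) ∧
      P.pairingIn ℤ α γ = 0) = ∅ := by
    refine Finset.filter_eq_empty_iff.2 fun γ hγ h1 => ?_
    rw [(pairingIn_short_eq_zero_iff hθ hG hα hγ).1 h1.2] at h1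
    exact lt_irrefl _ h1.1
  have h2 := h.two_mul_card_longOne_before hθ hdom hG hκ
  have h3 := two_mul_card_longOne_not_orthogonal hθ hG hκ
  -- A long root is orthogonal to `α` exactly when it is not orthogonal to `θ - α`. Half of the long
  -- roots are such, and half of these come before `θ - α`.
  have h4 : ((longOne B θ).filter fun γ => position β n γ < position β n (antiRefl P θ α) ∧
      P.pairingIn ℤ α γ = 0) = ((longOne B θ).filter fun γ =>
        P.pairingIn ℤ (antiRefl P θ α) γ ≠ 0).filter
        fun γ => position β n γ < position β n (antiRefl P θ α) := by
    rw [Finset.filter_filter]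
    refine Finset.filter_congr fun γ hγ => ?_
    rw [and_comm]
    refine and_congr_left fun _ => ?_
    have h5 := pairingIn_longOne hθ hG hα hγ
    rw [pairingIn_antiRefl, (mem_shortOne.1 hα).1,
      hθ.pairingIn_eq_one (mem_longOne.1 hγ).2 (mem_longOne.1 hγ).1]
    omega
  rw [hθ.card_filter_pairingPos (B := B), if_neg (fun h => h0 h.2), h1, h4, Finset.card_empty]
  omega

include h hθ hdom hG in
/-- The number of roots not orthogonal to the short root `α` that come before it, if `α` comes
after `θ`. -/
theorem IsConvexOrder.card_not_orthogonal_before {α : ι} (hα : α ∈ shortOne B θ)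
    (hlt : position β n θ < position β n α) :
    4 * (((pairingPos P θ).filter fun γ => position β n γ < position β n α ∧
        P.pairingIn ℤ α γ ≠ 0).card +
      ((shortOne B θ).filter fun γ => position β n α < position β n γ).card + 1) =
      (longOne B θ).card + 4 * (shortOne B θ).card := by
  classical
  have hα' := mem_shortOne.1 hα
  have hκ := antiRefl_mem_shortOne hα
  have h0 : P.pairingIn ℤ α θ ≠ 0 := by rw [hα'.1]; norm_num
  have hκlt : position β n (antiRefl P θ α) < position β n α := by
    have := h.before_top_iff hdom hα'.1
    omega
  have h2 := h.two_mul_card_longOne_before hθ hdom hG hα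
  have h3 := two_mul_card_longOne_not_orthogonal hθ hG hα
  -- The one short root orthogonal to `α` is `θ - α`, and it precedes `α` because `α` comes after
  -- `θ`.
  have h1 : ((shortOne B θ).filter fun γ => position β n γ < position β n α ∧
      P.pairingIn ℤ α γ ≠ 0) =
      ((shortOne B θ).filter fun γ => position β n γ < position β n α).erase
        (antiRefl P θ α) := by
    ext γ
    rw [Finset.mem_erase, Finset.mem_filter, Finset.mem_filter]
    constructor
    · rintro ⟨h4, h5, h6⟩
      exact ⟨fun h7 => h6 ((pairingIn_short_eq_zero_iff hθ hG hα h4).2 h7), h4, h5⟩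
    · rintro ⟨h4, h5, h6⟩
      exact ⟨h5, h6, fun h7 => h4 ((pairingIn_short_eq_zero_iff hθ hG hα h5).1 h7)⟩
  have h4 := Finset.card_erase_add_one (s := (shortOne B θ).filter
    fun γ => position β n γ < position β n α) (Finset.mem_filter.2 ⟨hκ, hκlt⟩)
  have h5 : (shortOne B θ).card =
      ((shortOne B θ).filter fun γ => position β n γ < position β n α).card + 1 +
      ((shortOne B θ).filter fun γ => position β n α < position β n γ).card := by
    have h6 : (shortOne B θ).filter (fun γ => ¬ position β n γ < position β n α) =
        insert α ((shortOne B θ).filter fun γ => position β n α < position β n γ) := by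
      ext γ
      rw [Finset.mem_insert, Finset.mem_filter, Finset.mem_filter, not_lt]
      constructor
      · rintro ⟨h7, h8⟩
        rcases h8.eq_or_lt with h9 | h9
        · exact Or.inl (h.position_inj (by omega)
            (by rw [(mem_shortOne.1 h7).1]; exact one_pos) h9).symm
        · exact Or.inr ⟨h7, h9⟩
      · rintro (rfl | h7)
        · exact ⟨hα, le_rfl⟩
        · exact ⟨h7.1, h7.2.le⟩
    rw [← Finset.card_filter_add_card_filter_not (s := shortOne B θ)
      (fun γ => position β n γ < position β n α), h6, Finset.card_insert_of_notMem (by simp)]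
    omega
  have h6 : ((longOne B θ).filter fun γ => position β n γ < position β n α ∧
      P.pairingIn ℤ α γ ≠ 0) = ((longOne B θ).filter fun γ => P.pairingIn ℤ α γ ≠ 0).filter
        fun γ => position β n γ < position β n α := by
    rw [Finset.filter_filter]
    exact Finset.filter_congr fun γ hγ => and_comm
  rw [hθ.card_filter_pairingPos (B := B), if_pos ⟨hlt, h0⟩, h1, h6]
  omega

include h hθ hdom hG in
/-- The other short roots come before the short dominant root. -/
theorem IsConvexOrder.short_before_short {θs γ : ι} (hθs : θs ∈ shortOne B θ)
    (hdoms : IsDominantRoot b θs) (hγ : γ ∈ shortOne B θ) (hne : γ ≠ θs) :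
    position β n γ < position β n θs := by
  have hθs' := mem_shortOne.1 hθs
  have hγ' := mem_shortOne.1 hγ
  -- It suffices to write `θ_s = γ + δ` with `δ` positive; then `δ` is orthogonal to `θ` and is not
  -- in the sequence. The choices are `δ = 2θ_s - θ` if `γ = θ - θ_s`, and `δ = s_γ θ_s` otherwise;
  -- both pair positively with the dominant `θ_s`.
  have key : ∀ δ, P.root θs = P.root γ + P.root δ → 0 < P.pairingIn ℤ δ θs →
      position β n γ < position β n θs := by
    intro δ hδ hpos
    have h0 := pairingIn_eq_of_root_eq (j := 1) (k := -1) (γ := θs) (α := γ) (δ := δ)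
      (by rw [hδ]; module) θ
    have hγs : 0 ≤ P.pairingIn ℤ θs γ := by
      have := pairingIn_eq_zero_or_one hG hθ hθs'.2 hθs'.1 (by omega) hne
      omega
    refine h.before_of_not_mem (by omega) ?_ (hdoms.isPos_of_pairingIn_pos hpos) hdoms.isPos hne
      ?_ hδ (by omega)
    · exact hdom.isPos_of_pairingIn_pos (by omega)
    · rintro rfl
      omega
  rcases pairingIn_eq_zero_or_one hG hθ hθs'.2 hθs'.1 (by omega) hne with h1 | h1
  · have h2 := pairingIn_eq_two_of_not_isLong hG hθ hθs'.2 hθs'.1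
    refine key (antiRefl P θs θ) ?_ ?_
    · rw [(pairingIn_short_eq_zero_iff hθ hG hθs hγ).1 h1, root_antiRefl, root_antiRefl, h2,
        hθs'.1]
      module
    · rw [pairingIn_antiRefl_same, h2]
      exact two_pos
  · refine key (P.reflectionPerm γ θs) ?_ ?_
    · rw [P.root_reflectionPerm, P.reflection_apply_root, ← cast_pairingIn, h1]
      simp
    · rw [pairingIn_reflectionPerm_left, P.pairingIn_same,
        ← pairingIn_comm_of_not_isLong hG hθ hθs'.2 hγ'.2, h1]
      norm_num

include h hθ hdom hG in
/-- The short dominant root comes after `θ`. -/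
theorem IsConvexOrder.top_before_short {θs : ι} (hθs : θs ∈ shortOne B θ)
    (hdoms : IsDominantRoot b θs) : position β n θ < position β n θs := by
  have hθs' := mem_shortOne.1 hθs
  have hκ := antiRefl_mem_shortOne hθs
  have h1 : antiRefl P θ θs ≠ θs := by
    intro h1
    have h2 := (pairingIn_short_eq_zero_iff hθ hG hθs hθs).2 h1.symm
    simp at h2
  have h2 := h.short_before_short hθ hdom hG hθs hdoms hκ h1
  have h3 := h.before_top_iff hdom hθs'.1
  have h4 : position β n θs ≠ position β n θ := fun h4 =>
    ne_of_mem_shortOne hθ hθs (h.position_inj (by omega) (by simp) h4).symm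
  omega

end Counts

/-! ### Intertwiners on exponentials of weights -/

section Exponentials

theorem tt_ne_zero : tt ≠ 0 := by
  rw [tt, Ne, map_eq_zero_iff _ (RatFunc.C_injective)]
  exact RatFunc.X_ne_zero

theorem qpow_intCast (m : ℕ) (k : ℤ) : qpow m k = qq m ^ k := by
  rw [qpow, qq, ← zpow_natCast, ← zpow_mul]
  congr 1
  have : (m : ℚ) * (k : ℚ) = ((m * k : ℤ) : ℚ) := by push_cast; rfl
  rw [this, Int.floor_intCast]

variable [P.IsCrystallographic] (m : ℕ)

theorem coroot'_rootWt (α γ : ι) :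
    P.coroot' γ (rootWt P α : M) = P.pairingIn ℤ α γ := by
  rw [cast_pairingIn]
  rfl

theorem expAt_sub_affVec (μ : weightLattice P) (γ : ι) (k : ℤ) :
    expAt P m (((μ : M), 0) - affVec P (γ, k)) = qq m ^ k • ex (μ - rootWt P γ) := by
  have h : ((μ : M), (0 : ℚ)) - affVec P (γ, k) =
      (((μ - rootWt P γ : weightLattice P) : M), -(k : ℚ)) := by
    ext <;> simp [affVec, rootWt]
  rw [h, expAt_coe, affEx, neg_neg, qpow_intCast]

theorem intertwiner_ex_of_eq_zero {μ : weightLattice P} {a : ι × ℤ}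
    (hk : P.coroot' a.1 (μ : M) = 0) : intertwiner m a (ex μ) = tt • ex μ := by
  rw [ex_eq_expAt m]
  exact intertwiner_expAt_zero m a (isIntegralVec_coe μ) hk

theorem intertwiner_ex_of_eq_one {μ : weightLattice P} {a : ι × ℤ}
    (hk : P.coroot' a.1 (μ : M) = 1) : intertwiner m a (ex μ) = tt⁻¹ • ex μ := by
  rw [ex_eq_expAt m]
  exact intertwiner_expAt_one m a (isIntegralVec_coe μ) hk

theorem intertwiner_ex_of_eq_two {μ : weightLattice P} {γ : ι} {k : ℤ}
    (hk : P.coroot' γ (μ : M) = 2) : intertwiner m (γ, k) (ex μ) =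
      tt⁻¹ • ex μ - ((tt - tt⁻¹) * qq m ^ k) • ex (μ - rootWt P γ) := by
  rw [ex_eq_expAt m μ, intertwiner_expAt_two m (γ, k) (isIntegralVec_coe μ) hk,
    expAt_sub_affVec, smul_smul]

theorem intertwiner_ex_of_eq_three {μ : weightLattice P} {γ : ι}
    (hk : P.coroot' γ (μ : M) = 3) : intertwiner m (γ, 0) (ex μ) =
      tt⁻¹ • ex μ - (tt - tt⁻¹) • (ex (μ - rootWt P γ) + ex (μ - (2 : ℤ) • rootWt P γ)) := by
  have h : ((μ : M), (0 : ℚ)) - (2 : ℤ) • affVec P (γ, 0) =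
      (((μ - rootWt P γ : weightLattice P) : M), 0) - affVec P (γ, 0) := by
    ext
    · simp [affVec, rootWt]; module
    · simp [affVec]
  rw [ex_eq_expAt m μ, intertwiner_expAt_three m (γ, 0) (isIntegralVec_coe μ) hk, h,
    expAt_sub_affVec, expAt_sub_affVec]
  congr 5
  · simp
  · rw [zpow_zero, one_smul, sub_sub, two_zsmul]

theorem intertwiner_ex_of_eq_neg_one {μ : weightLattice P} {γ : ι}
    (hk : P.coroot' γ (μ : M) = -1) : intertwiner m (γ, 0) (ex μ) =
      tt • ex μ + (tt - tt⁻¹) • ex (μ + rootWt P γ) := by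
  have h : ((μ : M), (0 : ℚ)) + affVec P (γ, 0) =
      (((μ + rootWt P γ : weightLattice P) : M), 0) := by
    ext <;> simp [affVec, rootWt]
  rw [ex_eq_expAt m μ, intertwiner_expAt_neg_one m (γ, 0) (isIntegralVec_coe μ) hk, h,
    ← ex_eq_expAt, ← ex_eq_expAt]

theorem intertwiner_ex_zero (a : ι × ℤ) :
    intertwiner m a (ex (0 : weightLattice P)) = tt • ex 0 :=
  intertwiner_ex_of_eq_zero m (by simp)

theorem intertwiner_ex_rootWt_self (α : ι) (k : ℤ) : intertwiner m (α, k) (ex (rootWt P α)) =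
    tt⁻¹ • ex (rootWt P α) - ((tt - tt⁻¹) * qq m ^ k) • ex 0 := by
  rw [intertwiner_ex_of_eq_two m (by rw [coroot'_rootWt, P.pairingIn_same]; norm_num), sub_self]

theorem weylOp_tau_ex {θ : ι} {μ : weightLattice P} {k : ℤ} (hk : P.coroot' θ (μ : M) = k) :
    weylOp m (tau P (corootCowt P θ)) (ex μ) = qq m ^ k • ex μ := by
  have h : (tau P (corootCowt P θ) : (M × ℚ) ≃ₗ[ℚ] (M × ℚ)) ((μ : M), 0) =
      ((μ : M), -(k : ℚ)) := by
    rw [← hk]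
    change trans P (P.coroot θ) ((μ : M), 0) = _
    rw [trans_apply]
    ext
    · rfl
    · simp only [zero_sub, neg_inj]
      rfl
  rw [weylOp_ex, h, expAt_coe, affEx, neg_neg, qpow_intCast]

end Exponentials

/-! ### Exponentials of short roots outside type `G₂` -/

section NotG2

variable [Fintype ι] [P.IsCrystallographic] [P.IsReduced] [P.IsIrreducible] {b : P.Base}
  {B : P.RootPositiveForm ℚ} {θ : ι} {n : ℕ} {β : ℕ → ι}
  (h : IsConvexOrder b θ n β) (hθ : IsLong B θ) (hdom : IsDominantRoot b θ) (hG : ¬ P.IsG2)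
  (m : ℕ)

theorem prodIco_ex_zero (β : ℕ → ι) {j k : ℕ} (hjk : j ≤ k) :
    prodIco (fun i => intertwiner m (β i, 0)) j k (ex (0 : weightLattice P)) =
      tt ^ ((k : ℤ) - j) • ex 0 := by
  rw [prodIco_apply_of_smul tt_ne_zero (e := fun _ => 1) hjk fun i _ _ => by
    rw [intertwiner_ex_zero, zpow_one]]
  simp [hjk]

/-- The exponent of `t` by which a short root `α` is multiplied by the factor of a root `γ`. -/
def sgnPairing (P : RootPairing ι ℚ M N) [P.IsCrystallographic] (α γ : ι) : ℤ :=
  if P.pairingIn ℤ α γ = 0 then 1 else -1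

include h in
theorem IsConvexOrder.sum_sgnPairing (α : ι) {j k : ℕ} (hjk : j ≤ k) (hk : k ≤ n) :
    ∑ i ∈ Finset.Ico j k, sgnPairing P α (β i) =
      (2 * ((pairingPos P θ).filter fun γ => position β n γ < k ∧
        P.pairingIn ℤ α γ = 0).card - k) -
      (2 * ((pairingPos P θ).filter fun γ => position β n γ < j ∧
        P.pairingIn ℤ α γ = 0).card - j) := by
  have key : ∀ k ≤ n, ∑ i ∈ Finset.Ico 0 k, sgnPairing P α (β i) =
      2 * ((pairingPos P θ).filter fun γ => position β n γ < k ∧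
        P.pairingIn ℤ α γ = 0).card - k := by
    intro k hk
    rw [h.sum_Ico_eq (fun _ γ => sgnPairing P α γ) 0 hk]
    simp only [Nat.zero_le, true_and]
    have h1 : ∀ γ, sgnPairing P α γ = 2 * (if P.pairingIn ℤ α γ = 0 then 1 else 0) - 1 := by
      intro γ
      rw [sgnPairing]
      split_ifs <;> norm_num
    have h2 := h.card_before hk
    simp only [h1]
    rw [Finset.sum_sub_distrib, ← Finset.mul_sum, Finset.sum_boole, Finset.filter_filter,
      Finset.sum_const, h2]
    simp
  rw [← key k hk, ← key j (hjk.trans hk), eq_sub_iff_add_eq, add_comm]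
  exact Finset.sum_Ico_consecutive _ (Nat.zero_le j) hjk

include h hθ hG in
-- Every factor scales `e^α` by `t` or `t⁻¹`, except that of `α` itself, which also splits off a
-- multiple of `e^0`. Each of the `n - position - 1` factors that follow multiplies `e^0` by `t`.
theorem IsConvexOrder.prodIco_short {α : ι} (hα : α ∈ shortOne B θ) {j : ℕ} (hj : j ≤ n) :
    prodIco (fun i => intertwiner m (β i, 0)) j n (ex (rootWt P α)) =
      tt ^ (∑ i ∈ Finset.Ico j n, sgnPairing P α (β i)) • ex (rootWt P α) -
        if j ≤ position β n α then
          ((tt - tt⁻¹) * tt ^ (∑ i ∈ Finset.Ico j (position β n α), sgnPairing P α (β i) +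
            n - position β n α - 1)) • ex 0 else 0 := by
  classical
  have hα' := mem_shortOne.1 hα
  have hpos : 0 < P.pairingIn ℤ α θ := by omega
  rw [prodIco_apply_eq tt_ne_zero (e := fun i => sgnPairing P α (β i))
    (x := fun i => if β i = α then -((tt - tt⁻¹) • ex 0) else 0) hj ?_,
    sub_eq_add_neg (tt ^ (∑ i ∈ Finset.Ico j n, sgnPairing P α (β i)) • ex (rootWt P α))]
  · congr 1
    have hlt := h.position_lt hpos
    have hzero : ∀ i ∈ Finset.Ico j n, i ≠ position β n α →
        tt ^ (∑ l ∈ Finset.Ico j i, sgnPairing P α (β l)) •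
          prodIco (fun i => intertwiner m (β i, 0)) (i + 1) n
            (if β i = α then -((tt - tt⁻¹) • ex (0 : weightLattice P)) else 0) = 0 := by
      intro i hi hne
      rw [if_neg, map_zero, smul_zero]
      rintro rfl
      exact hne (h.position_apply (Finset.mem_Ico.1 hi).2).symm
    split_ifs with hle
    · rw [Finset.sum_eq_single_of_mem _ (Finset.mem_Ico.2 ⟨hle, hlt⟩) hzero,
        if_pos (h.apply_position hpos), map_neg, map_smul, prodIco_ex_zero m β hlt, smul_neg,
        smul_smul, smul_smul, mul_comm (tt ^ _) (tt - tt⁻¹), mul_assoc, ← zpow_add₀ tt_ne_zero]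
      congr 4
      push_cast
      ring
    · rw [neg_zero]
      refine Finset.sum_eq_zero fun i hi => hzero i hi ?_
      rw [Finset.mem_Ico] at hi
      omega
  · intro i hji hi
    have h1 := h.pos_of_lt hi
    split_ifs with heq
    · rw [heq, intertwiner_ex_rootWt_self, sgnPairing, P.pairingIn_same]
      simp [sub_eq_add_neg]
    · rw [add_zero, sgnPairing]
      rcases pairingIn_eq_zero_or_one hG hθ hα'.2 hα'.1 h1 heq with h2 | h2
      · rw [h2, if_pos rfl, zpow_one, intertwiner_ex_of_eq_zero]
        rw [coroot'_rootWt, h2]; rfl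
      · rw [h2, if_neg one_ne_zero, zpow_neg_one, intertwiner_ex_of_eq_one]
        rw [coroot'_rootWt, h2]; simp

variable {L S : ℤ} (hL : ((longOne B θ).card : ℤ) = 2 * L - 2)
  (hS : ((shortOne B θ).card : ℤ) = S)

include h hθ hL hS in
theorem IsConvexOrder.card_eq : (n : ℤ) = 2 * L + S - 1 := by
  have h1 := hθ.card_filter_pairingPos (B := B) fun _ => True
  simp only [Finset.filter_true, if_true] at h1
  rw [h.card_pairingPos] at h1
  omega

include h hθ hG hL hS in
theorem IsConvexOrder.sum_sgnPairing_total {α : ι} (hα : α ∈ shortOne B θ) :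
    ∑ i ∈ Finset.Ico 0 n, sgnPairing P α (β i) = 1 - S := by
  have h1 : ((pairingPos P θ).filter fun γ => position β n γ < n ∧ P.pairingIn ℤ α γ = 0) =
      (pairingPos P θ).filter fun γ => P.pairingIn ℤ α γ = 0 := by
    refine Finset.filter_congr fun γ hγ => ?_
    simp [h.position_lt (mem_pairingPos.1 hγ)]
  have h2 := card_orthogonal hθ hG hα
  have h3 := h.card_eq hθ hL hS
  rw [h.sum_sgnPairing α (Nat.zero_le n) le_rfl, h1]
  simp
  omega

include h hθ hdom hG hL hS in
-- The left side is `-2` times the number of roots before `α` not orthogonal to it. In this form the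
-- position of `α` drops out of the exponent of the branch to `e^0`.
theorem IsConvexOrder.sum_sgnPairing_before {α : ι} (hα : α ∈ shortOne B θ)
    (hlt : position β n θ < position β n α) :
    ∑ i ∈ Finset.Ico 0 (position β n α), sgnPairing P α (β i) - position β n α =
      2 * ((shortOne B θ).filter fun γ => position β n α < position β n γ).card
        + 3 - L - 2 * S := by
  have h1 := h.card_not_orthogonal_before hθ hdom hG hα hlt
  have hle := h.position_lt (α := α) (by rw [(mem_shortOne.1 hα).1]; exact one_pos)
  have h2 := h.card_before hle.le
  have h3 := Finset.card_filter_add_card_filter_not (s := (pairingPos P θ).filter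
    fun γ => position β n γ < position β n α) (fun γ => P.pairingIn ℤ α γ = 0)
  rw [Finset.filter_filter, Finset.filter_filter, h2] at h3
  simp only [ne_eq] at h1
  rw [h.sum_sgnPairing α (Nat.zero_le _) hle.le]
  simp
  omega

include h hθ hdom hG hL hS in
theorem IsConvexOrder.prodIco_short_dominant {θs : ι} (hθs : θs ∈ shortOne B θ)
    (hdoms : IsDominantRoot b θs) :
    prodIco (fun i => intertwiner m (β i, 0)) 0 n (ex (rootWt P θs)) =
      tt ^ (1 - S) • ex (rootWt P θs) - ((tt - tt⁻¹) * tt ^ (L - S + 1)) • ex 0 := by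
  have h1 := h.sum_sgnPairing_before hθ hdom hG hL hS hθs
    (h.top_before_short hθ hdom hG hθs hdoms)
  have h2 : ((shortOne B θ).filter fun γ => position β n θs < position β n γ) = ∅ := by
    refine Finset.filter_eq_empty_iff.2 fun γ hγ hlt => ?_
    have := h.short_before_short hθ hdom hG hθs hdoms hγ (by rintro rfl; exact lt_irrefl _ hlt)
    omega
  rw [h2, Finset.card_empty] at h1
  have h3 := h.card_eq hθ hL hS
  rw [h.prodIco_short hθ hG m hθs (Nat.zero_le _), h.sum_sgnPairing_total hθ hG hL hS hθs,
    if_pos (Nat.zero_le _)]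
  congr 4
  push_cast at h1
  omega

include h hθ hdom hG hL hS in
-- This is the branch of `e^θ` at the factor of `κ = θ - α`: the power in front collects the factors
-- `t⁻¹` before `κ`, and the remaining factors act on `e^α`. The factor of `α` is still to come
-- exactly when `α` follows `κ`, that is, follows `θ`. The position of `κ` cancels because a fixed
-- number of roots before it is orthogonal to `α`.
theorem IsConvexOrder.prodIco_short_branch {α : ι} (hα : α ∈ shortOne B θ) :
    tt ^ (-(position β n (antiRefl P θ α) : ℤ)) •
      prodIco (fun i => intertwiner m (β i, 0)) (position β n (antiRefl P θ α) + 1) n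
        (ex (rootWt P α)) =
      tt ^ (1 - L - S) • ex (rootWt P α) -
        if position β n θ < position β n α then
          ((tt - tt⁻¹) * tt ^ (2 * (((shortOne B θ).filter
            fun γ => position β n α < position β n γ).card : ℤ) + (1 - S))) • ex 0 else 0 := by
  have hα' := mem_shortOne.1 hα
  have hκ := antiRefl_mem_shortOne hα
  have hκ' := mem_shortOne.1 hκ
  set κ := antiRefl P θ α with hκdef
  have hle := h.position_lt (α := α) (by omega)
  have hleκ := h.position_lt (α := κ) (by omega)
  have h0 := h.card_orthogonal_before_antiRefl hθ hdom hG hα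
  rw [← hκdef] at h0
  have h1 := h.sum_sgnPairing α (Nat.zero_le _) hleκ.le
  have h2 : sgnPairing P α κ = 1 := if_pos ((pairingIn_short_eq_zero_iff hθ hG hα hκ).2 rfl)
  have h3 : ∑ i ∈ Finset.Ico 0 (position β n κ + 1), sgnPairing P α (β i) =
      ∑ i ∈ Finset.Ico 0 (position β n κ), sgnPairing P α (β i) + 1 := by
    rw [Finset.sum_Ico_succ_top (Nat.zero_le _), h.apply_position (by omega), h2]
  have h4 := h.card_eq hθ hL hS
  have hsplit : ∀ k, position β n κ + 1 ≤ k →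
      ∑ i ∈ Finset.Ico (position β n κ + 1) k, sgnPairing P α (β i) =
      ∑ i ∈ Finset.Ico 0 k, sgnPairing P α (β i) -
        ∑ i ∈ Finset.Ico 0 (position β n κ + 1), sgnPairing P α (β i) := by
    intro k hk
    rw [eq_sub_iff_add_eq, add_comm]
    exact Finset.sum_Ico_consecutive _ (Nat.zero_le _) hk
  simp only [Nat.not_lt_zero, false_and, Finset.filter_false, Finset.card_empty] at h1
  have hiff : position β n κ + 1 ≤ position β n α ↔ position β n θ < position β n α := by
    have h5 := h.before_top_iff hdom hα'.1
    rw [← hκdef] at h5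
    have h6 : position β n α ≠ position β n θ := fun h4 =>
      ne_of_mem_shortOne hθ hα (h.position_inj (by omega) (by simp) h4).symm
    have h7 : position β n κ ≠ position β n θ := fun h4 =>
      ne_of_mem_shortOne hθ hκ (h.position_inj (by omega) (by simp) h4).symm
    omega
  rw [h.prodIco_short hθ hG m hα hleκ, smul_sub, smul_smul, ← zpow_add₀ tt_ne_zero,
    hsplit n hleκ, h.sum_sgnPairing_total hθ hG hL hS hα]
  congr 1
  · congr 2
    omega
  · simp only [hiff]
    split_ifs with hlt
    · have h5 := h.sum_sgnPairing_before hθ hdom hG hL hS hα hlt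
      rw [smul_smul, mul_left_comm, ← zpow_add₀ tt_ne_zero, hsplit _ (hiff.2 hlt)]
      congr 3
      omega
    · rw [smul_zero]

end NotG2

/-! ### The exponential of the highest root outside type `G₂` -/

section HighestRoot

theorem sum_card_gt_of_injOn {A X : Type*} [AddCommMonoid A] (f : ℕ → A) {s : Finset X}
    {g : X → ℕ} (hg : Set.InjOn g s) :
    ∑ x ∈ s, f (s.filter (g x < g ·)).card = ∑ w ∈ Finset.range s.card, f w := by
  classical
  rw [← Finset.card_image_of_injOn hg, ← sum_card_gt f, Finset.sum_image hg]
  refine Finset.sum_congr rfl fun x _ => ?_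
  rw [Finset.filter_image, Finset.card_image_of_injOn (hg.mono (Finset.filter_subset _ _))]

variable [Fintype ι] [P.IsCrystallographic] [P.IsReduced] {b : P.Base}
  {B : P.RootPositiveForm ℚ} {θ : ι} {n : ℕ} {β : ℕ → ι}

variable [P.IsIrreducible]
  (h : IsConvexOrder b θ n β) (hθ : IsLong B θ) (hdom : IsDominantRoot b θ) (hG : ¬ P.IsG2)
  (m : ℕ) {L S : ℤ} (hL : ((longOne B θ).card : ℤ) = 2 * L - 2)
  (hS : ((shortOne B θ).card : ℤ) = S)

open Classical in
/-- The error term in the action on `e^θ` of the factor of a root `γ`. -/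
def topError (B : P.RootPositiveForm ℚ) (θ γ : ι) : Poly P :=
  if γ = θ then -((tt - tt⁻¹) • ex 0) else
    if IsLong B γ then 0 else -((tt - tt⁻¹) • ex (rootWt P (antiRefl P θ γ)))

include hθ hG in
theorem intertwiner_top {γ : ι} (hγ : 0 < P.pairingIn ℤ γ θ) :
    intertwiner m (γ, 0) (ex (rootWt P θ)) =
      tt ^ (-1 : ℤ) • ex (rootWt P θ) + topError B θ γ := by
  rw [topError, zpow_neg_one]
  rcases hθ.pairingIn_pos_cases hγ with rfl | h1
  · rw [if_pos rfl, intertwiner_ex_rootWt_self, zpow_zero, mul_one, sub_eq_add_neg]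
  have hne : γ ≠ θ := by rintro rfl; simp at h1
  rw [if_neg hne]
  split_ifs with hl
  · rw [add_zero, intertwiner_ex_of_eq_one]
    rw [coroot'_rootWt, hθ.pairingIn_eq_one hl h1]; simp
  · rw [intertwiner_ex_of_eq_two, zpow_zero, mul_one, sub_eq_add_neg]
    · congr 4
      ext
      simp [rootWt, root_antiRefl, h1]
    · rw [coroot'_rootWt, pairingIn_eq_two_of_not_isLong hG hθ hl h1]; norm_num

include h hθ hdom hL hS in
-- As `α` runs over the `S/2` short roots after `θ`, the number of short roots after `α` takes each
-- of the values `0, …, S/2 - 1` once.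
theorem IsConvexOrder.sum_shortOne_geom :
    (tt - tt⁻¹) * ∑ α ∈ (shortOne B θ).filter fun α => position β n θ < position β n α,
      tt ^ (2 * (((shortOne B θ).filter
        fun γ => position β n α < position β n γ).card : ℤ) + (1 - S)) =
      1 - tt ^ (-S) := by
  set s := (shortOne B θ).filter fun α => position β n θ < position β n α with hs
  have h1 : ∀ α ∈ s, ((shortOne B θ).filter fun γ => position β n α < position β n γ) =
      s.filter fun γ => position β n α < position β n γ := by
    intro α hα
    rw [hs, Finset.filter_filter]
    refine Finset.filter_congr fun γ _ => ?_
    have := (Finset.mem_filter.1 hα).2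
    omega
  have h2 : Set.InjOn (position β n) s := by
    intro α hα γ hγ heq
    have hα' := mem_shortOne.1 (Finset.mem_filter.1 hα).1
    have hγ' := mem_shortOne.1 (Finset.mem_filter.1 hγ).1
    exact h.position_inj (by omega) (by omega) heq
  have h3 := h.two_mul_card_shortOne_after (B := B) hdom
  rw [← hs] at h3
  rw [Finset.sum_congr rfl fun α hα => by rw [h1 α hα],
    sum_card_gt_of_injOn (fun w => tt ^ (2 * (w : ℤ) + (1 - S))) h2,
    geom_sum_sub_inv tt_ne_zero]
  congr 1
  · have h4 : 2 * (s.card : ℤ) + (1 - S) - 1 = 0 := by omega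
    rw [h4, zpow_zero]
  · congr 1
    ring

include h hθ hdom hG hL hS in
-- The coefficient of `e^0` is `-(t - t⁻¹)` from the factor of `θ`, plus `(t - t⁻¹)(1 - t^(-S))`
-- from the branches that pass through a short root.
theorem IsConvexOrder.prodIco_top :
    prodIco (fun i => intertwiner m (β i, 0)) 0 n (ex (rootWt P θ)) =
      tt ^ (-(n : ℤ)) • ex (rootWt P θ) - ((tt - tt⁻¹) * tt ^ (1 - L - S)) •
        ∑ α ∈ shortOne B θ, ex (rootWt P α) - ((tt - tt⁻¹) * tt ^ (-S)) • ex 0 := by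
  classical
  have htop := h.two_mul_position_top hθ hdom
  have hlt := h.position_lt (α := θ) (by simp)
  rw [prodIco_apply_eq tt_ne_zero (e := fun _ => -1) (x := fun i => topError B θ (β i))
    (Nat.zero_le n) fun i _ hi => intertwiner_top hθ hG m (h.pos_of_lt hi)]
  simp only [Finset.sum_const, Nat.card_Ico, Nat.sub_zero, nsmul_eq_mul, mul_neg, mul_one]
  rw [h.sum_Ico_eq (fun i γ => tt ^ (-(i : ℤ)) •
    prodIco (fun i => intertwiner m (β i, 0)) (i + 1) n (topError B θ γ)) 0 le_rfl,
    Finset.filter_true_of_mem fun γ hγ => ⟨Nat.zero_le _, h.position_lt (mem_pairingPos.1 hγ)⟩,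
    hθ.sum_pairingPos]
  have h1 : ∑ γ ∈ longOne B θ, tt ^ (-(position β n γ : ℤ)) •
      prodIco (fun i => intertwiner m (β i, 0)) (position β n γ + 1) n (topError B θ γ) = 0 := by
    refine Finset.sum_eq_zero fun γ hγ => ?_
    rw [mem_longOne] at hγ
    rw [topError, if_neg, if_pos hγ.2, map_zero, smul_zero]
    rintro rfl
    simp at hγ
  -- As `θ` stands in the middle, the factors `t⁻¹` before it and `t` after it cancel.
  have h2 : tt ^ (-(position β n θ : ℤ)) • prodIco (fun i => intertwiner m (β i, 0))
      (position β n θ + 1) n (topError B θ θ) = -((tt - tt⁻¹) • ex 0) := by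
    rw [topError, if_pos rfl, map_neg, map_smul, prodIco_ex_zero m β hlt, smul_neg, smul_comm,
      smul_smul (tt ^ (-(position β n θ : ℤ))), ← zpow_add₀ tt_ne_zero]
    have h3 : -(position β n θ : ℤ) + ((n : ℤ) - ((position β n θ + 1 : ℕ) : ℤ)) = 0 := by omega
    rw [h3, zpow_zero, one_smul]
  have h3 : ∑ γ ∈ shortOne B θ, tt ^ (-(position β n γ : ℤ)) •
      prodIco (fun i => intertwiner m (β i, 0)) (position β n γ + 1) n (topError B θ γ) =
      ∑ α ∈ shortOne B θ, -((tt - tt⁻¹) • (tt ^ (1 - L - S) • ex (rootWt P α) -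
        if position β n θ < position β n α then
          ((tt - tt⁻¹) * tt ^ (2 * (((shortOne B θ).filter
            fun γ => position β n α < position β n γ).card : ℤ) + (1 - S))) • ex 0 else 0)) := by
    refine Finset.sum_nbij' (antiRefl P θ) (antiRefl P θ) (fun _ => antiRefl_mem_shortOne)
      (fun _ => antiRefl_mem_shortOne) (fun α _ => antiRefl_antiRefl θ α)
      (fun α _ => antiRefl_antiRefl θ α) fun γ hγ => ?_
    rw [← h.prodIco_short_branch hθ hdom hG m hL hS (antiRefl_mem_shortOne hγ),
      antiRefl_antiRefl, topError, if_neg (ne_of_mem_shortOne hθ hγ).symm,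
      if_neg (mem_shortOne.1 hγ).2, map_neg, map_smul, smul_neg, smul_comm]
  have h5 := h.sum_shortOne_geom hθ hdom hL hS
  rw [h1, h2, h3, Finset.sum_neg_distrib, ← Finset.smul_sum, Finset.sum_sub_distrib,
    ← Finset.smul_sum, ← Finset.sum_filter, ← Finset.sum_smul, ← Finset.mul_sum, h5, zero_add]
  rw [smul_sub, smul_smul, smul_smul, mul_sub (tt - tt⁻¹) 1, mul_one,
    sub_smul (tt - tt⁻¹)]
  abel

end HighestRoot

/-! ### The formulas outside type `G₂` -/

section Formulas

variable [Fintype ι] [P.IsRootSystem] [P.IsCrystallographic] [P.IsReduced] [P.IsIrreducible]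
  {b : P.Base} {B : P.RootPositiveForm ℚ} {θ : ι} (hθ : IsLong B θ) (hdom : IsDominantRoot b θ)

include hθ hdom in
theorem posShortNonorth_eq : posShortNonorth b B θ = shortOne B θ := by
  ext α
  simp only [posShortNonorth, Finset.mem_filter, mem_shortOne]
  have h1 := two_mul_form B α θ
  have h2 : B.form (P.root α) (P.root θ) ≠ 0 ↔ P.pairingIn ℤ α θ ≠ 0 := by
    refine not_congr ⟨fun h3 => ?_, fun h3 => ?_⟩
    · rw [h3, mul_zero, eq_comm, mul_eq_zero] at h1
      exact_mod_cast h1.resolve_right (form_self_pos B θ).ne'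
    · rw [h3, Int.cast_zero, zero_mul] at h1
      linarith
  rw [h2]
  constructor
  · rintro ⟨-, h3, h4, h5⟩
    refine ⟨?_, h4⟩
    have h6 := hdom.pairingIn_nonneg h3
    rcases hθ.pairingIn_pos_cases (i := α) (by omega) with rfl | h7
    · exact absurd hθ h4
    · exact h7
  · rintro ⟨h3, h4⟩
    exact ⟨Finset.mem_univ _, hdom.isPos_of_pairingIn_pos (by omega), h4, by omega⟩

include hθ hdom in
/-- The formulas for the action of `Y^{θ^∨}` outside of type `G₂`. -/
theorem formulas_of_not_isG2 (hG : ¬ P.IsG2) (m : ℕ) {L S : ℤ}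
    (hL : (L : ℚ) = htLong b B (P.root θ)) (hS : (S : ℚ) = htShort b B (P.root θ))
    {Y : Module.End Qqt (Poly P)} (hY : IsHeckeOp b θ m (tau P (corootCowt P θ)) Y) :
    Y (ex 0) = tt ^ (2 * L + S) • ex 0 ∧
    Y (ex (rootWt P θ)) =
      (qq m ^ 2 * tt ^ (-(2 * L + S))) • ex (rootWt P θ)
      - ((tt - tt⁻¹) * qq m * tt ^ (-(L + S))) •
          ∑ α ∈ posShortNonorth b B θ, ex (rootWt P α)
      - ((tt - tt⁻¹) * tt ^ (-S + 1) * (qq m * tt ^ (-2 * L) + 1)) • ex 0 ∧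
    ∀ θs : ι, ¬ IsLong B θs → IsDominantRoot b θs →
      Y (ex (rootWt P θs)) =
        (qq m * tt ^ (-S)) • ex (rootWt P θs)
        - ((tt - tt⁻¹) * tt ^ (L - S + 2)) • ex 0 := by
  have hL' : ((longOne B θ).card : ℤ) = 2 * L - 2 := card_long_pairingOne hθ hdom hL
  have hS' : ((shortOne B θ).card : ℤ) = S := card_short_pairingOne hG hθ hdom hS
  obtain ⟨n, β, h, rfl⟩ := exists_convexOrder hθ hdom hY
  have hn := h.card_eq hθ hL' hS'
  have hτ0 : weylOp m (tau P (corootCowt P θ)) (ex (0 : weightLattice P)) = ex 0 := by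
    rw [weylOp_tau_ex m (k := 0) (by simp), zpow_zero, one_smul]
  have hτ1 : ∀ α, P.pairingIn ℤ α θ = 1 →
      weylOp m (tau P (corootCowt P θ)) (ex (rootWt P α)) = qq m • ex (rootWt P α) := by
    intro α hα
    rw [weylOp_tau_ex m (coroot'_rootWt α θ), hα, zpow_one]
  have hτ2 : weylOp m (tau P (corootCowt P θ)) (ex (rootWt P θ)) =
      qq m ^ 2 • ex (rootWt P θ) := by
    rw [weylOp_tau_ex m (coroot'_rootWt θ θ), P.pairingIn_same]
    rfl
  have hI1 : ∀ α, P.pairingIn ℤ α θ = 1 →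
      intertwiner m (θ, 1) (ex (rootWt P α)) = tt⁻¹ • ex (rootWt P α) := by
    intro α hα
    refine intertwiner_ex_of_eq_one m ?_
    rw [coroot'_rootWt, hα]
    simp
  have hmul : ∀ k : ℤ, tt ^ k * tt = tt ^ (k + 1) := fun k => (zpow_add_one₀ tt_ne_zero k).symm
  have hdiv : ∀ k : ℤ, tt ^ k * tt⁻¹ = tt ^ (k - 1) := fun k => (zpow_sub_one₀ tt_ne_zero k).symm
  refine ⟨?_, ?_, fun θs hs hdoms => ?_⟩
  · rw [Module.End.mul_apply, Module.End.mul_apply, prodIco_ex_zero m β (Nat.zero_le n), map_smul,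
      map_smul, intertwiner_ex_zero, map_smul, hτ0, smul_smul, hmul]
    congr 2
    push_cast
    omega
  · have hI : intertwiner m (θ, 1) (∑ α ∈ shortOne B θ, ex (rootWt P α)) =
        tt⁻¹ • ∑ α ∈ shortOne B θ, ex (rootWt P α) := by
      rw [map_sum, Finset.smul_sum]
      exact Finset.sum_congr rfl fun α hα => hI1 α (mem_shortOne.1 hα).1
    have hτ : weylOp m (tau P (corootCowt P θ)) (∑ α ∈ shortOne B θ, ex (rootWt P α)) =
        qq m • ∑ α ∈ shortOne B θ, ex (rootWt P α) := by
      rw [map_sum, Finset.smul_sum]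
      exact Finset.sum_congr rfl fun α hα => hτ1 α (mem_shortOne.1 hα).1
    rw [posShortNonorth_eq hθ hdom, Module.End.mul_apply, Module.End.mul_apply,
      h.prodIco_top hθ hdom hG m hL' hS']
    simp only [map_sub, map_smul, hI, hτ, hτ0, hτ2, intertwiner_ex_zero,
      intertwiner_ex_rootWt_self, zpow_one, smul_sub, smul_smul]
    have e1 : tt ^ (-(n : ℤ)) * tt⁻¹ = tt ^ (-(2 * L + S)) := by rw [hdiv]; congr 1; omega
    have e2 : tt ^ (1 - L - S) * tt⁻¹ = tt ^ (-(L + S)) := by rw [hdiv]; congr 1; ring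
    have e3 : tt ^ (-S) * tt = tt ^ (-S + 1) := hmul _
    have e4 : tt ^ (-(n : ℤ)) = tt ^ (-S + 1) * tt ^ (-2 * L) := by
      rw [← zpow_add₀ tt_ne_zero]; congr 1; omega
    -- The two summands are the branch of `e^θ` at `θ + δ`, which carries a factor `q`, and the
    -- `e^0` produced by the finite roots.
    have e5 : (tt - tt⁻¹) * tt ^ (-S + 1) * (qq m * tt ^ (-2 * L) + 1) =
        tt ^ (-(n : ℤ)) * ((tt - tt⁻¹) * qq m) + (tt - tt⁻¹) * tt ^ (-S) * tt := by
      rw [e4, ← e3]; ring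
    rw [e5, add_smul, ← sub_sub, ← e1, ← e2]
    have e6 : tt ^ (-(n : ℤ)) * tt⁻¹ * qq m ^ 2 = qq m ^ 2 * (tt ^ (-(n : ℤ)) * tt⁻¹) := by ring
    have e7 : qq m * (tt ^ (1 - L - S) * tt⁻¹) = tt ^ (1 - L - S) * (tt⁻¹ * qq m) := by ring
    simp only [e6, e7, mul_assoc]
    abel
  · have hpos := hdom.pairingIn_pos hdoms
    have hone : P.pairingIn ℤ θs θ = 1 := by
      rcases hθ.pairingIn_pos_cases hpos with rfl | h1
      · exact absurd hθ hs
      · exact h1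
    rw [Module.End.mul_apply, Module.End.mul_apply,
      h.prodIco_short_dominant hθ hdom hG m hL' hS' (mem_shortOne.2 ⟨hone, hs⟩) hdoms]
    simp only [map_sub, map_smul, hI1 θs hone, hτ1 θs hone, hτ0, intertwiner_ex_zero, smul_smul]
    rw [hdiv, mul_assoc, hmul, mul_comm (tt ^ _) (qq m)]
    congr 4
    · ring
    · ring

end Formulas

/-! ### The base and the unique convex order in type `G₂` -/

section TypeG2

open RootPairing.EmbeddedG2

variable [Fintype ι] [P.IsRootSystem]

/-- The base of a root system of type `G₂` consists of a short and of a long root, which pair to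
`-3`. -/
theorem exists_base_of_isG2 [P.IsCrystallographic] [P.IsReduced] [P.IsIrreducible] (hG : P.IsG2)
    (b : P.Base) {B : P.RootPositiveForm ℚ} {θ : ι} (hθ : IsLong B θ) :
    ∃ a l, a ∈ b.support ∧ l ∈ b.support ∧ (∀ x ∈ b.support, x = a ∨ x = l) ∧
      ¬ IsLong B a ∧ IsLong B l ∧ P.pairingIn ℤ l a = -3 := by
  classical
  -- Every root is conjugate to a simple one, so simple roots of both lengths exist: `θ` is long,
  -- and a pairing `-3` needs two different lengths.
  obtain ⟨l, hl, hll⟩ : ∃ l ∈ b.support, IsLong B l := by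
    by_contra hno
    push Not at hno
    exact b.induction_reflect θ (p := fun i => ¬ IsLong B i)
      (fun i hi => by rwa [isLong_reflectionPerm_iff]) hno
      (fun i j hi _ => by rwa [isLong_reflectionPerm_iff]) hθ
  obtain ⟨a, ha, hal⟩ : ∃ a ∈ b.support, ¬ IsLong B a := by
    by_contra hno
    push Not at hno
    obtain ⟨i, j, hij⟩ := hG.exists_pairingIn_neg_three
    have hj : IsLong B j := b.induction_reflect j (p := fun i => IsLong B i)
      (fun i hi => by rwa [isLong_reflectionPerm_iff]) hno
      (fun i j hi _ => by rwa [isLong_reflectionPerm_iff])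
    have hi : IsLong B i := b.induction_reflect i (p := fun i => IsLong B i)
      (fun i hi => by rwa [isLong_reflectionPerm_iff]) hno
      (fun i j hi _ => by rwa [isLong_reflectionPerm_iff])
    have h1 := hi.pairingIn_comm hj
    have h2 := P.pairingIn_pairingIn_mem_set_of_isCrystal_of_isRed i j
    simp only [Set.mem_insert_iff, Set.mem_singleton_iff, Prod.mk.injEq] at h2
    omega
  have hne : l ≠ a := by rintro rfl; exact hal hll
  have hsupp : ∀ x ∈ b.support, x = a ∨ x = l := by
    intro x hx
    have h1 : ({a, l} : Finset ι) = b.support := by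
      refine Finset.eq_of_subset_of_card_le ?_ ?_
      · intro x hx
        rw [Finset.mem_insert, Finset.mem_singleton] at hx
        rcases hx with rfl | rfl
        · exact ha
        · exact hl
      · rw [RootPairing.IsG2.card_base_support_eq_two, Finset.card_pair hne.symm]
    rwa [← h1, Finset.mem_insert, Finset.mem_singleton] at hx
  refine ⟨a, l, ha, hl, hsupp, hal, hll, ?_⟩
  · have h1 := b.pairingIn_le_zero_of_ne hne hl ha
    have hne' : P.root l ≠ -P.root a := by
      rw [Ne, P.root_eq_neg_iff]
      rintro rfl
      exact hal (isLong_reflectionPerm_iff.1 hll)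
    have h2 := P.pairingIn_pairingIn_mem_set_of_isCrystal_of_isRed l a
    have h3 := RootPairing.IsG2.pairingIn_mem_zero_one_three P l a
      (fun h => hne (P.root.injective h)) hne'
    simp only [Set.mem_insert_iff, Set.mem_singleton_iff, Prod.mk.injEq] at h2 h3
    -- If the two simple roots were orthogonal, both would be dominant, and dominant roots are never
    -- orthogonal.
    have h4 : P.pairingIn ℤ l a ≠ 0 := by
      intro h0
      have h0' : P.pairingIn ℤ a l = 0 := P.pairingIn_eq_zero_iff.1 h0
      have hsub : ∀ x ∈ b.support, x = a ∨ x = l := hsupp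
      have hda : IsDominantRoot b a := isDominantRoot_iff.2 fun x hx => by
        rcases hsub x hx with rfl | rfl
        · simp
        · exact h0'.ge
      have hdl : IsDominantRoot b l := isDominantRoot_iff.2 fun x hx => by
        rcases hsub x hx with rfl | rfl
        · exact h0.ge
        · simp
      have := hda.pairingIn_pos hdl
      omega
    -- A pairing `-1` would make `a` at least as long as `l`.
    have h5 : P.pairingIn ℤ l a ≠ -1 := by
      intro h5
      have h6 := pairingIn_mul_form_swap B l a
      have h7 : P.pairingIn ℤ a l ≤ -1 := by omega
      have h8 : (P.pairingIn ℤ a l : ℚ) ≤ -1 := by exact_mod_cast h7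
      rw [h5] at h6
      push_cast at h6
      refine hal (hll.of_form_eq (le_antisymm ?_ (hll a)))
      nlinarith [form_self_pos B l]
    omega

variable [P.EmbeddedG2] [P.IsIrreducible] {b : P.Base} {B : P.RootPositiveForm ℚ}

theorem rootWt_shortAddLong :
    rootWt P (shortAddLong P) = (1 : ℤ) • rootWt P (short P) + (1 : ℤ) • rootWt P (long P) := by
  refine Subtype.ext ((shortAddLongRoot_eq P).trans ?_)
  simp [rootWt]

theorem rootWt_twoShortAddLong :
    rootWt P (twoShortAddLong P) =
      (2 : ℤ) • rootWt P (short P) + (1 : ℤ) • rootWt P (long P) := by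
  refine Subtype.ext ((twoShortAddLongRoot_eq P).trans ?_)
  change _ = (2 : ℤ) • P.root (short P) + (1 : ℤ) • P.root (long P)
  module

theorem rootWt_threeShortAddLong :
    rootWt P (threeShortAddLong P) =
      (3 : ℤ) • rootWt P (short P) + (1 : ℤ) • rootWt P (long P) := by
  refine Subtype.ext ((threeShortAddLongRoot_eq P).trans ?_)
  change _ = (3 : ℤ) • P.root (short P) + (1 : ℤ) • P.root (long P)
  module

theorem rootWt_threeShortAddTwoLong :
    rootWt P (threeShortAddTwoLong P) =
      (3 : ℤ) • rootWt P (short P) + (2 : ℤ) • rootWt P (long P) := by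
  refine Subtype.ext ((threeShortAddTwoLongRoot_eq P).trans ?_)
  change _ = (3 : ℤ) • P.root (short P) + (2 : ℤ) • P.root (long P)
  module

theorem eq_or_eq_of_isDominantRoot (ha : short P ∈ b.support) (hl : long P ∈ b.support) {x : ι}
    (hx : IsDominantRoot b x) : x = threeShortAddTwoLong P ∨ x = twoShortAddLong P := by
  have h1 := isDominantRoot_iff.1 hx _ ha
  have h2 := isDominantRoot_iff.1 hx _ hl
  have h3 := mem_allRoots P x
  have hneg : ∀ y, P.root x = -P.root y → ∀ κ, P.pairingIn ℤ x κ = -P.pairingIn ℤ y κ := by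
    intro y hy κ
    have := pairingIn_eq_of_root_eq (j := -1) (k := 0) (γ := y) (α := y) (δ := x)
      (by rw [hy]; module) κ
    omega
  simp only [allRoots, List.mem_cons, List.not_mem_nil, or_false, P.root.injective.eq_iff] at h3
  rcases h3 with h | h | h | h | h | h | h | h | h | h | h | h
  all_goals first
    | exact Or.inl h
    | exact Or.inr h
    | (rw [h] at h1 h2; simp at h1 h2)
    | (rw [hneg _ h] at h1 h2; simp at h1 h2)

theorem mem_pairingPos_threeShortAddTwoLong {x : ι}
    (hx : 0 < P.pairingIn ℤ x (threeShortAddTwoLong P)) :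
    x = long P ∨ x = shortAddLong P ∨ x = threeShortAddTwoLong P ∨ x = twoShortAddLong P ∨
      x = threeShortAddLong P := by
  have h3 := mem_allRoots P x
  have hneg : ∀ y, P.root x = -P.root y → ∀ κ, P.pairingIn ℤ x κ = -P.pairingIn ℤ y κ := by
    intro y hy κ
    have := pairingIn_eq_of_root_eq (j := -1) (k := 0) (γ := y) (α := y) (δ := x)
      (by rw [hy]; module) κ
    omega
  simp only [allRoots, List.mem_cons, List.not_mem_nil, or_false, P.root.injective.eq_iff] at h3
  rcases h3 with h | h | h | h | h | h | h | h | h | h | h | h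
  all_goals first
    | tauto
    | (rw [h] at hx; simp at hx)
    | (rw [hneg _ h] at hx; simp at hx)

/-- In type `G₂`, there is only one convex order. -/
theorem IsConvexOrder.eq_of_embeddedG2 {n : ℕ} {β : ℕ → ι}
    (hdom : IsDominantRoot b (threeShortAddTwoLong P)) (ha : short P ∈ b.support)
    (h : IsConvexOrder b (threeShortAddTwoLong P) n β) :
    n = 5 ∧ β 0 = long P ∧ β 1 = shortAddLong P ∧ β 2 = threeShortAddTwoLong P ∧
      β 3 = twoShortAddLong P ∧ β 4 = threeShortAddLong P := by
  classical
  have h1 : 0 < P.pairingIn ℤ (long P) (threeShortAddTwoLong P) := by simp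
  have h2 : 0 < P.pairingIn ℤ (shortAddLong P) (threeShortAddTwoLong P) := by simp
  have h3 : 0 < P.pairingIn ℤ (threeShortAddTwoLong P) (threeShortAddTwoLong P) := by simp
  have h4 : 0 < P.pairingIn ℤ (twoShortAddLong P) (threeShortAddTwoLong P) := by simp
  have h5 : 0 < P.pairingIn ℤ (threeShortAddLong P) (threeShortAddTwoLong P) := by simp
  have ha0 : P.pairingIn ℤ (short P) (threeShortAddTwoLong P) = 0 := by simp
  have hapos : b.IsPos (short P) := RootPairing.Base.isPos_of_mem_support ha
  have hpos : ∀ {x}, 0 < P.pairingIn ℤ x (threeShortAddTwoLong P) → b.IsPos x :=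
    fun hx => hdom.isPos_of_pairingIn_pos hx
  have hne : ∀ {x}, 0 < P.pairingIn ℤ x (threeShortAddTwoLong P) → short P ≠ x := by
    rintro x hx rfl
    omega
  have hne' : ∀ {x y}, P.pairingIn ℤ x (short P) ≠ P.pairingIn ℤ y (short P) → x ≠ y := by
    rintro x y hxy rfl
    exact hxy rfl
  have r1 : P.root (shortAddLong P) = P.root (short P) + P.root (long P) := shortAddLongRoot_eq P
  have r2 : P.root (twoShortAddLong P) = (2 : ℚ) • P.root (short P) + P.root (long P) :=
    twoShortAddLongRoot_eq P
  have r3 : P.root (threeShortAddLong P) = (3 : ℚ) • P.root (short P) + P.root (long P) :=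
    threeShortAddLongRoot_eq P
  have r4 : P.root (threeShortAddTwoLong P) =
      (3 : ℚ) • P.root (short P) + (2 : ℚ) • P.root (long P) := threeShortAddTwoLongRoot_eq P
  -- The short simple root is orthogonal to `θ`, so adding it moves later in the order. This orders
  -- all the roots except `θ`, which lies between its summands `α₁ + α₂` and `2α₁ + α₂`.
  have o1 : position β n (long P) < position β n (shortAddLong P) :=
    h.before_of_not_mem h2 (hpos h1) hapos (hpos h2) (hne' (by simp)) (hne h2)
      (by rw [r1]; module) ha0
  have o2 : position β n (shortAddLong P) < position β n (twoShortAddLong P) :=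
    h.before_of_not_mem h4 (hpos h2) hapos (hpos h4) (hne' (by simp)) (hne h4)
      (by rw [r1, r2]; module) ha0
  have o3 : position β n (twoShortAddLong P) < position β n (threeShortAddLong P) :=
    h.before_of_not_mem h5 (hpos h4) hapos (hpos h5) (hne' (by simp)) (hne h5)
      (by rw [r2, r3]; module) ha0
  have o4 := h.before_iff_not_before hdom h3 h2 h4 (hne' (by simp)) (hne' (by simp)) Nat.one_pos
    (by rw [r1, r2, r4]; module)
  have o5 : position β n (twoShortAddLong P) ≠ position β n (threeShortAddTwoLong P) := by
    intro h'
    exact hne' (by simp) (h.position_inj h4 h3 h')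
  have hlt := h.position_lt h5
  have hn : n ≤ 5 := by
    rw [← h.card_pairingPos]
    refine (Finset.card_le_card fun x hx => ?_).trans (Finset.card_le_five (a := long P)
      (b := shortAddLong P) (c := threeShortAddTwoLong P) (d := twoShortAddLong P)
      (e := threeShortAddLong P))
    simpa using mem_pairingPos_threeShortAddTwoLong (mem_pairingPos.1 hx)
  have e := fun {x} => h.apply_position (α := x)
  refine ⟨by omega, ?_, ?_, ?_, ?_, ?_⟩
  · rw [← e h1]; congr 1; omega
  · rw [← e h2]; congr 1; omega
  · rw [← e h3]; congr 1; omega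
  · rw [← e h4]; congr 1; omega
  · rw [← e h5]; congr 1; omega

end TypeG2

/-! ### Scalar identities for type `G₂` -/

section Identities

variable {K V : Type*} [Field K] [AddCommGroup V] [Module K V] {t : K}

/-- The left side is the expansion of `Y e^θ` as the rules for the factors leave it: scalars are
nested with the operator applied first outermost, and the powers of `q` from the translation
innermost. -/
theorem g2_top_identity (ht : t ≠ 0) (q : K) (v32 v21 v11 v10 vn v0 : V) :
    t⁻¹ • (t⁻¹ • (t⁻¹ • (t⁻¹ • t⁻¹ • (t⁻¹ • q ^ (2 : ℤ) • v32 - ((t - t⁻¹) * q) • v0) -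
      (t - t⁻¹) • (t • t⁻¹ • q • v11 + (t • t • vn + (t - t⁻¹) • t⁻¹ • q • v21))) -
        (t - t⁻¹) • t • t • t • v0) -
          (t - t⁻¹) • (t⁻¹ • (t⁻¹ • t⁻¹ • t⁻¹ • q • v21 - (t - t⁻¹) • t • t • v0) +
            t • t⁻¹ • t⁻¹ • t • v10)) =
      (q ^ 2 * t ^ (-6 : ℤ)) • v32 - ((t - t⁻¹) * q * t ^ (-3 : ℤ)) • (v21 + v11) -
        ((t - t⁻¹) * t⁻¹) • (v10 + vn) - ((t - t⁻¹) * (q * t ^ (-5 : ℤ) + t⁻¹)) • v0 := by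
  have h2 : q ^ (2 : ℤ) = q ^ 2 := zpow_natCast q 2
  rw [h2]
  match_scalars <;> field_simp <;> ring

theorem g2_short_identity (ht : t ≠ 0) (q : K) (v21 v0 : V) :
    t • t⁻¹ • t⁻¹ • (t⁻¹ • t⁻¹ • t⁻¹ • q • v21 - (t - t⁻¹) • t • t • v0) =
      (q * t ^ (-4 : ℤ)) • v21 - ((t - t⁻¹) * t) • v0 := by
  match_scalars <;> field_simp

end Identities

/-! ### The formulas in type `G₂` -/

section FormulasG2

open RootPairing.EmbeddedG2

variable [Fintype ι] [P.IsRootSystem] [P.EmbeddedG2] [P.IsIrreducible] {b : P.Base}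
  {B : P.RootPositiveForm ℚ} (m : ℕ)

/-- The exponential of an integral combination of the short and long simple roots. -/
def exG2 (P : RootPairing ι ℚ M N) [P.EmbeddedG2] (x y : ℤ) : Poly P :=
  ex (x • rootWt P (short P) + y • rootWt P (long P))

theorem coroot'_g2 {x y k : ℤ} {γ : ι}
    (hk : x * P.pairingIn ℤ (short P) γ + y * P.pairingIn ℤ (long P) γ = k) :
    P.coroot' γ ((x • rootWt P (short P) + y • rootWt P (long P) : weightLattice P) : M) = k := by
  rw [← hk]
  push_cast
  rw [map_add, map_zsmul, map_zsmul, coroot'_rootWt, coroot'_rootWt, zsmul_eq_mul, zsmul_eq_mul]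

theorem exG2_zero : exG2 P 0 0 = ex 0 := by simp [exG2]

theorem intertwiner_exG2_zero {x y k : ℤ} {γ : ι}
    (hk : x * P.pairingIn ℤ (short P) γ + y * P.pairingIn ℤ (long P) γ = 0) :
    intertwiner m (γ, k) (exG2 P x y) = tt • exG2 P x y :=
  intertwiner_ex_of_eq_zero m (by simpa using coroot'_g2 hk)

theorem intertwiner_exG2_one {x y k : ℤ} {γ : ι}
    (hk : x * P.pairingIn ℤ (short P) γ + y * P.pairingIn ℤ (long P) γ = 1) :
    intertwiner m (γ, k) (exG2 P x y) = tt⁻¹ • exG2 P x y :=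
  intertwiner_ex_of_eq_one m (by simpa using coroot'_g2 hk)

theorem intertwiner_exG2_two {x y k : ℤ} {γ : ι} {u v : ℤ} (x₁ y₁ : ℤ)
    (hγ : rootWt P γ = u • rootWt P (short P) + v • rootWt P (long P))
    (hk : x * P.pairingIn ℤ (short P) γ + y * P.pairingIn ℤ (long P) γ = 2)
    (hx₁ : x₁ = x - u) (hy₁ : y₁ = y - v) :
    intertwiner m (γ, k) (exG2 P x y) =
      tt⁻¹ • exG2 P x y - ((tt - tt⁻¹) * qq m ^ k) • exG2 P x₁ y₁ := by
  subst hx₁ hy₁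
  rw [exG2, intertwiner_ex_of_eq_two m (by simpa using coroot'_g2 hk), hγ, exG2]
  congr 3
  module

theorem intertwiner_exG2_three {x y : ℤ} {γ : ι} {u v : ℤ} (x₁ y₁ x₂ y₂ : ℤ)
    (hγ : rootWt P γ = u • rootWt P (short P) + v • rootWt P (long P))
    (hk : x * P.pairingIn ℤ (short P) γ + y * P.pairingIn ℤ (long P) γ = 3)
    (hx₁ : x₁ = x - u) (hy₁ : y₁ = y - v) (hx₂ : x₂ = x - 2 * u) (hy₂ : y₂ = y - 2 * v) :
    intertwiner m (γ, 0) (exG2 P x y) = tt⁻¹ • exG2 P x y -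
      (tt - tt⁻¹) • (exG2 P x₁ y₁ + exG2 P x₂ y₂) := by
  subst hx₁ hy₁ hx₂ hy₂
  rw [exG2, intertwiner_ex_of_eq_three m (by simpa using coroot'_g2 hk), hγ, exG2, exG2]
  congr 4 <;> module

theorem intertwiner_exG2_neg_one {x y : ℤ} {γ : ι} {u v : ℤ} (x₁ y₁ : ℤ)
    (hγ : rootWt P γ = u • rootWt P (short P) + v • rootWt P (long P))
    (hk : x * P.pairingIn ℤ (short P) γ + y * P.pairingIn ℤ (long P) γ = -1)
    (hx₁ : x₁ = x + u) (hy₁ : y₁ = y + v) :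
    intertwiner m (γ, 0) (exG2 P x y) =
      tt • exG2 P x y + (tt - tt⁻¹) • exG2 P x₁ y₁ := by
  subst hx₁ hy₁
  rw [exG2, intertwiner_ex_of_eq_neg_one m (by simpa using coroot'_g2 hk), hγ, exG2]
  congr 3
  module

theorem weylOp_tau_exG2 (x y : ℤ) :
    weylOp m (tau P (corootCowt P (threeShortAddTwoLong P))) (exG2 P x y) =
      qq m ^ y • exG2 P x y :=
  weylOp_tau_ex m (coroot'_g2 (by simp))

/-- The formulas for the action of `Y^{θ^∨}` in type `G₂`. -/
theorem formulas_of_embeddedG2 (hθ : IsLong B (threeShortAddTwoLong P))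
    (hdom : IsDominantRoot b (threeShortAddTwoLong P)) (ha : short P ∈ b.support)
    {Y : Module.End Qqt (Poly P)}
    (hY : IsHeckeOp b (threeShortAddTwoLong P) m
      (tau P (corootCowt P (threeShortAddTwoLong P))) Y) :
    Y (exG2 P 0 0) = tt ^ 6 • exG2 P 0 0 ∧
    Y (exG2 P 3 2) =
      (qq m ^ 2 * tt ^ (-6 : ℤ)) • exG2 P 3 2
      - ((tt - tt⁻¹) * qq m * tt ^ (-3 : ℤ)) • (exG2 P 2 1 + exG2 P 1 1)
      - ((tt - tt⁻¹) * tt⁻¹) • (exG2 P 1 0 + exG2 P (-1) 0)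
      - ((tt - tt⁻¹) * (qq m * tt ^ (-5 : ℤ) + tt⁻¹)) • exG2 P 0 0 ∧
    Y (exG2 P 2 1) =
      (qq m * tt ^ (-4 : ℤ)) • exG2 P 2 1 - ((tt - tt⁻¹) * tt) • exG2 P 0 0 := by
  obtain ⟨n, β, h, rfl⟩ := exists_convexOrder hθ hdom hY
  obtain ⟨rfl, h0, h1, h2, h3, h4⟩ := h.eq_of_embeddedG2 hdom ha
  have hprod : prodIco (fun i => intertwiner (P := P) m (β i, 0)) 0 5 =
      intertwiner m (threeShortAddLong P, 0) * (intertwiner m (twoShortAddLong P, 0) *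
        (intertwiner m (threeShortAddTwoLong P, 0) * (intertwiner m (shortAddLong P, 0) *
          intertwiner m (long P, 0)))) := by
    rw [prodIco_succ _ (by norm_num), prodIco_succ _ (by norm_num), prodIco_succ _ (by norm_num),
      prodIco_succ _ (by norm_num), prodIco_succ _ (by norm_num), prodIco_self, mul_one, h0, h1,
      h2, h3, h4]
  have hz : ∀ a, intertwiner m a (exG2 P 0 0) = tt • exG2 P 0 0 := fun a => by
    rw [exG2_zero, intertwiner_ex_zero]
  have hτ := fun x y => weylOp_tau_exG2 (P := P) m x y
  have l32 : intertwiner m (long P, 0) (exG2 P 3 2) = tt⁻¹ • exG2 P 3 2 :=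
    intertwiner_exG2_one m (by simp)
  have l21 : intertwiner m (long P, 0) (exG2 P 2 1) = tt • exG2 P 2 1 :=
    intertwiner_exG2_zero m (by simp)
  have p32 : intertwiner m (shortAddLong P, 0) (exG2 P 3 2) =
      tt⁻¹ • exG2 P 3 2 - (tt - tt⁻¹) • (exG2 P 2 1 + exG2 P 1 0) :=
    intertwiner_exG2_three m 2 1 1 0 rootWt_shortAddLong (by simp) (by norm_num) (by norm_num)
      (by norm_num) (by norm_num)
  have p21 : intertwiner m (shortAddLong P, 0) (exG2 P 2 1) = tt⁻¹ • exG2 P 2 1 :=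
    intertwiner_exG2_one m (by simp)
  have θ32 : ∀ k, intertwiner m (threeShortAddTwoLong P, k) (exG2 P 3 2) =
      tt⁻¹ • exG2 P 3 2 - ((tt - tt⁻¹) * qq m ^ k) • exG2 P 0 0 := fun k =>
    intertwiner_exG2_two m 0 0 rootWt_threeShortAddTwoLong (by simp) (by norm_num) (by norm_num)
  have θ21 : ∀ k, intertwiner m (threeShortAddTwoLong P, k) (exG2 P 2 1) = tt⁻¹ • exG2 P 2 1 :=
    fun k => intertwiner_exG2_one m (by simp)
  have θ10 : ∀ k, intertwiner m (threeShortAddTwoLong P, k) (exG2 P 1 0) = tt • exG2 P 1 0 :=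
    fun k => intertwiner_exG2_zero m (by simp)
  have θ11 : ∀ k, intertwiner m (threeShortAddTwoLong P, k) (exG2 P 1 1) = tt⁻¹ • exG2 P 1 1 :=
    fun k => intertwiner_exG2_one m (by simp)
  have θn : ∀ k, intertwiner m (threeShortAddTwoLong P, k) (exG2 P (-1) 0) =
      tt • exG2 P (-1) 0 := fun k => intertwiner_exG2_zero m (by simp)
  have q32 : intertwiner m (twoShortAddLong P, 0) (exG2 P 3 2) =
      tt⁻¹ • exG2 P 3 2 - (tt - tt⁻¹) • (exG2 P 1 1 + exG2 P (-1) 0) :=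
    intertwiner_exG2_three m 1 1 (-1) 0 rootWt_twoShortAddLong (by simp) (by norm_num) (by norm_num)
      (by norm_num) (by norm_num)
  have q21 : intertwiner m (twoShortAddLong P, 0) (exG2 P 2 1) =
      tt⁻¹ • exG2 P 2 1 - ((tt - tt⁻¹) * qq m ^ (0 : ℤ)) • exG2 P 0 0 :=
    intertwiner_exG2_two m 0 0 rootWt_twoShortAddLong (by simp) (by norm_num) (by norm_num)
  have q10 : intertwiner m (twoShortAddLong P, 0) (exG2 P 1 0) = tt⁻¹ • exG2 P 1 0 :=
    intertwiner_exG2_one m (by simp)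
  have r32 : intertwiner m (threeShortAddLong P, 0) (exG2 P 3 2) = tt⁻¹ • exG2 P 3 2 :=
    intertwiner_exG2_one m (by simp)
  have r21 : intertwiner m (threeShortAddLong P, 0) (exG2 P 2 1) = tt⁻¹ • exG2 P 2 1 :=
    intertwiner_exG2_one m (by simp)
  have r11 : intertwiner m (threeShortAddLong P, 0) (exG2 P 1 1) = tt • exG2 P 1 1 :=
    intertwiner_exG2_zero m (by simp)
  have r10 : intertwiner m (threeShortAddLong P, 0) (exG2 P 1 0) = tt⁻¹ • exG2 P 1 0 :=
    intertwiner_exG2_one m (by simp)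
  -- The only negative pairing that occurs: `e^{-α₁}`, split off at `2α₁ + α₂`, feeds back into
  -- `e^{θ_s}`.
  have rn : intertwiner m (threeShortAddLong P, 0) (exG2 P (-1) 0) =
      tt • exG2 P (-1) 0 + (tt - tt⁻¹) • exG2 P 2 1 :=
    intertwiner_exG2_neg_one m 2 1 rootWt_threeShortAddLong (by simp) (by norm_num) (by norm_num)
  refine ⟨?_, ?_, ?_⟩
  · simp only [hprod, Module.End.mul_apply, hz, hτ, map_smul, smul_smul]
    congr 1
    rw [zpow_zero]
    ring
  · simp only [hprod, Module.End.mul_apply, hz, hτ, map_smul, map_sub, map_add, l32, p32, θ32, θ21,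
      θ10, θ11, θn, q32, q21, q10, r32, r21, r11, r10, rn, zpow_zero, zpow_one, one_smul, mul_one]
    exact g2_top_identity tt_ne_zero _ _ _ _ _ _ _
  · simp only [hprod, Module.End.mul_apply, hz, hτ, map_smul, map_sub, l21, p21, θ21, q21, r21,
      zpow_zero, zpow_one, one_smul, mul_one]
    exact g2_short_identity tt_ne_zero _ _ _

/-- There are only two dominant roots and two simple roots, so their lengths identify the given
roots with the named roots of the `G₂` system. -/
theorem formulas_of_isDominantRoot (ha : short P ∈ b.support) (hl : long P ∈ b.support)
    (hsupp : ∀ x ∈ b.support, x = short P ∨ x = long P) (hshort : ¬ IsLong B (short P))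
    (hlong : IsLong B (long P)) {θ : ι} (hθ : IsLong B θ) (hdom : IsDominantRoot b θ)
    {Y : Module.End Qqt (Poly P)} (hY : IsHeckeOp b θ m (tau P (corootCowt P θ)) Y) :
    Y (ex 0) = tt ^ 6 • ex 0 ∧
    ∀ θs α₁ α₂ : ι, ¬ IsLong B θs → IsDominantRoot b θs →
      α₁ ∈ b.support → ¬ IsLong B α₁ → α₂ ∈ b.support → IsLong B α₂ →
      Y (ex (rootWt P θ)) =
        (qq m ^ 2 * tt ^ (-6 : ℤ)) • ex (rootWt P θ)
        - ((tt - tt⁻¹) * qq m * tt ^ (-3 : ℤ)) •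
            (ex (rootWt P θs) + ex (rootWt P α₁ + rootWt P α₂))
        - ((tt - tt⁻¹) * tt⁻¹) • (ex (rootWt P α₁) + ex (-rootWt P α₁))
        - ((tt - tt⁻¹) * (qq m * tt ^ (-5 : ℤ) + tt⁻¹)) • ex 0 ∧
      Y (ex (rootWt P θs)) =
        (qq m * tt ^ (-4 : ℤ)) • ex (rootWt P θs) - ((tt - tt⁻¹) * tt) • ex 0 := by
  have hθeq : θ = threeShortAddTwoLong P := by
    refine (eq_or_eq_of_isDominantRoot ha hl hdom).resolve_right ?_
    rintro rfl
    exact hshort (hθ.of_form_eq (twoShortAddLongRoot_shortRoot B.toInvariantForm))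
  subst hθeq
  obtain ⟨h0, hθ', hs'⟩ := formulas_of_embeddedG2 m hθ hdom ha hY
  have e0 : exG2 P 0 0 = ex 0 := exG2_zero
  have e32 : exG2 P 3 2 = ex (rootWt P (threeShortAddTwoLong P)) := by
    rw [exG2, rootWt_threeShortAddTwoLong]
  have e21 : exG2 P 2 1 = ex (rootWt P (twoShortAddLong P)) := by
    rw [exG2, rootWt_twoShortAddLong]
  have e11 : exG2 P 1 1 = ex (rootWt P (short P) + rootWt P (long P)) := by simp [exG2]
  have e10 : exG2 P 1 0 = ex (rootWt P (short P)) := by simp [exG2]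
  have en : exG2 P (-1) 0 = ex (-rootWt P (short P)) := by simp [exG2]
  rw [e0] at h0
  rw [e0, e32, e21, e11, e10, en] at hθ'
  rw [e0, e21] at hs'
  refine ⟨h0, fun θs α₁ α₂ hs hsdom h1 h1' h2 h2' => ?_⟩
  have hθs : θs = twoShortAddLong P := by
    refine (eq_or_eq_of_isDominantRoot ha hl hsdom).resolve_left ?_
    rintro rfl
    exact hs hθ
  have hα₁ : α₁ = short P := by
    refine (hsupp α₁ h1).resolve_right ?_
    rintro rfl
    exact h1' hlong
  have hα₂ : α₂ = long P := by
    refine (hsupp α₂ h2).resolve_left ?_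
    rintro rfl
    exact hshort h2'
  rw [hθs, hα₁, hα₂]
  exact ⟨hθ', hs'⟩

end FormulasG2

end AffineHecke

end

/-! ### The main theorem -/

open AffineHecke in
theorem mainTheorem4 {ι M N : Type*} [Fintype ι]
    [AddCommGroup M] [Module ℚ M] [AddCommGroup N] [Module ℚ N]
    (P : RootPairing ι ℚ M N) [P.IsRootSystem] [P.IsCrystallographic] [P.IsReduced]
    [P.IsIrreducible] (b : P.Base) (B : P.RootPositiveForm ℚ)
    (m : ℕ) (hm : 0 < m) (hmP : ∀ μ ∈ weightLattice P, m • μ ∈ rootLattice P)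
    (θ : ι) (hθlong : IsLong B θ) (hθdom : IsDominantRoot b θ)
    (L S : ℤ) (hL : (L : ℚ) = htLong b B (P.root θ)) (hS : (S : ℚ) = htShort b B (P.root θ)) :
    (∃ F, IsHeckeOp b θ m (tau P (corootCowt P θ)) F) ∧
    (∀ ρ : HeckeAlgebra b θ →ₐ[Qt] Module.End Qqt (Poly P), IsPolyRep b θ m ρ →
      IsHeckeOp b θ m (tau P (corootCowt P θ))
        (ρ (heckeY b θ (corootCowt P θ) (coroot_dominant b B hθdom)))) ∧
    ∀ Y : Module.End Qqt (Poly P), IsHeckeOp b θ m (tau P (corootCowt P θ)) Y →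
      (¬ P.IsG2 →
        Y (ex 0) = tt ^ (2 * L + S) • ex 0 ∧
        Y (ex (rootWt P θ)) =
          (qq m ^ 2 * tt ^ (-(2 * L + S))) • ex (rootWt P θ)
          - ((tt - tt⁻¹) * qq m * tt ^ (-(L + S))) •
              ∑ α ∈ posShortNonorth b B θ, ex (rootWt P α)
          - ((tt - tt⁻¹) * tt ^ (-S + 1) * (qq m * tt ^ (-2 * L) + 1)) • ex 0 ∧
        ∀ θs : ι, ¬ IsLong B θs → IsDominantRoot b θs →
          Y (ex (rootWt P θs)) =
            (qq m * tt ^ (-S)) • ex (rootWt P θs)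
            - ((tt - tt⁻¹) * tt ^ (L - S + 2)) • ex 0) ∧
      (P.IsG2 →
        Y (ex 0) = tt ^ 6 • ex 0 ∧
        ∀ θs α₁ α₂ : ι, ¬ IsLong B θs → IsDominantRoot b θs →
          α₁ ∈ b.support → ¬ IsLong B α₁ → α₂ ∈ b.support → IsLong B α₂ →
          Y (ex (rootWt P θ)) =
            (qq m ^ 2 * tt ^ (-6 : ℤ)) • ex (rootWt P θ)
            - ((tt - tt⁻¹) * qq m * tt ^ (-3 : ℤ)) •
                (ex (rootWt P θs) + ex (rootWt P α₁ + rootWt P α₂))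
            - ((tt - tt⁻¹) * tt⁻¹) • (ex (rootWt P α₁) + ex (-rootWt P α₁))
            - ((tt - tt⁻¹) * (qq m * tt ^ (-5 : ℤ) + tt⁻¹)) • ex 0 ∧
          Y (ex (rootWt P θs)) =
            (qq m * tt ^ (-4 : ℤ)) • ex (rootWt P θs) - ((tt - tt⁻¹) * tt) • ex 0) := by
  refine ⟨exists_isHeckeOp hθlong hθdom m _, fun ρ hρ => isHeckeOp_of_isPolyRep hθlong hθdom hρ _,
    fun Y hY => ⟨fun hG => formulas_of_not_isG2 hθlong hθdom hG m hL hS hY, fun hG => ?_⟩⟩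
  obtain ⟨a, l, ha, hl, hsupp, hal, hll, hpair⟩ := exists_base_of_isG2 hG b hθlong
  -- Embedding `G₂` through the simple roots of `b` makes the named roots compatible with the given
  -- base.
  let _ : P.EmbeddedG2 := { long := l, short := a, pairingIn_long_short := hpair }
  exact formulas_of_isDominantRoot m ha hl hsupp hal hll hθlong hθdom hY
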